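/- Let $W\subseteq\mathbb C$ and $I\subseteq\mathbb R$ be non-empty, open and connected, let $g:I\to\mathbb C$ be smooth, and for $f=f(\zeta,u)$ on $W\times I$ consider the vacuum pp-wave $$ds^2=2\,d\zeta\,d\bar\zeta-2\,du\,dv-(f+\bar f)\,du^2,\qquad \zeta\in W,\ u\in I,\ v\in\mathbb R .$$ A normalized tetrad is a smooth null tetrad $(\delta,\delta^*,\Delta,D)=(m,\bar m,l,k)$, i.e. $\langle m,\bar m\rangle=1$, $\langle k,l\rangle=-1$, all other products zero, with $D$ a multiple of $\partial_v$, $\delta\bar\zeta=0$ (orientation), $\Psi_4=R(\bar m,l,\bar m,l)=1$ and $\gamma=0$. Here, writing $(e_1,e_2,e_3,e_4)=(m,\bar m,l,k)$ and $\omega_{ab}(V)=\langle e_a,\nabla_V e_b\rangle$, the spin coefficients are $$\alpha=-\tfrac12(\omega_{12}+\omega_{34})(\bar m),\quad \gamma=-\tfrac12(\omega_{12}+\omega_{34})(l),\quad \mu=\omega_{23}(m),\quad \nu=\omega_{23}(l).$$ Put $$A=\frac{\delta^*\alpha}{\alpha^2},\qquad B=\mu A-\mu^*,\qquad M=\alpha\mu,\qquad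 Y=(3-A)\nu-\frac1\alpha+\frac{\Delta\mu+\mu^2}{\alpha^*},$$ where $*$ on scalars is complex conjugation. Let $f$ have one of the following forms, where $\log$ denotes any holomorphic branch on $W$ (assumed to exist) of the logarithm of the indicated argument: * $\mathrm{BL}_{13}$: $f=Cu^{-2}\log\zeta+g(u)u^{-2}\zeta$ with $C\in\mathbb C\setminus\{0\}$ and $0\notin I$; * $\mathrm{AP}_{13}$: $f=(k_0\zeta)^{2ik_1}+g(u)\zeta=\exp(2ik_1\log(k_0\zeta))+g(u)\zeta$ with $k_0,k_1\in\mathbb R\setminus\{0\}$; * $\mathrm{AE}_{13}$: $f=\exp(k\zeta)+g(u)\zeta$ with $k\in\mathbb R\setminus\{0\}$; * $\mathrm{AL}_{13}$: $f=e^{ik}\log\zeta+g(u)\zeta$ with $k\in\mathbb R$. Then a normalized tetrad exists, and for every normalized tetrad $\alpha$ vanishes nowhere and * for $\mathrm{BL}_{13}$: $B=0$, $A=1$, $\Delta\mu=\mu^2$, $\mu\ne0$ everywhere, and $M^2=-1/(2\bar C)$; * for $\mathrm{AP}_{13}$: $\mu=0$, $AA^*=1$, $A^2\neq1$ everywhere;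 * for $\mathrm{AE}_{13}$: $\mu=0$, $A=-1$; * for $\mathrm{AL}_{13}$: $\mu=0$, $A=1$. In each of the four classes the following are equivalent: 1. $d\alpha\wedge d\nu=0$; 2. $Y=0$; 3. $g=0$; 4. the invariant count is $(0,1,1)$: $\alpha\neq0$ and $d\alpha\wedge d\alpha^*=d\alpha\wedge d\mu=d\alpha\wedge dA=d\alpha\wedge d\nu=0$; 5. the metric is a $G_3$: its Killing vector fields form a real vector space of dimension $3$. So the $G_3$ metrics in these classes are exactly those with $$f=Cu^{-2}\log\zeta\ (\mathrm{BL}_{11}),\quad f=(k_0\zeta)^{2ik_1}\ (\mathrm{AP}_{11}),\quad f=e^{k\zeta}\ (\mathrm{AE}_{11}),\quad f=e^{ik}\log\zeta\ (\mathrm{AL}_{11}).$$ In particular the coefficient $C$ of $u^{-2}\log\zeta$ may be any non-zero complex number, not only a real one, and it is determined by the invariant $M^2=-1/(2\bar C)$. -/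

import Mathlib

open scoped ContDiff ComplexConjugate

noncomputable section

namespace PPWave

/-! ## Coordinates, metrics and the Levi-Civita connection on open subsets of `ℝ⁴` -/

/-- Coordinate space. The coordinates are `(Re ζ, Im ζ, u, v)`. -/
abbrev Pt := Fin 4 → ℝ

/-- Real vector fields, by their coordinate components. -/
abbrev RField := Pt → Fin 4 → ℝ

/-- Complex vector fields (sections of the complexified tangent bundle), by their components. -/
abbrev CField := Pt → Fin 4 → ℂ

/-- A field of bilinear forms, by its component matrix. -/
abbrev Metric := Pt → Matrix (Fin 4) (Fin 4) ℝ

/-- Partial derivative in the `i`-th coordinate. -/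
def pd {F : Type*} [NormedAddCommGroup F] [NormedSpace ℝ F] (i : Fin 4) (φ : Pt → F) (x : Pt) : F :=
  fderiv ℝ φ x (Pi.single i 1)

/-- A real vector field seen as a complex one. -/
def toC (V : RField) : CField := fun x i => (V x i : ℂ)

/-- The complex conjugate of a complex vector field. -/
def cconj (V : CField) : CField := fun x i => conj (V x i)

/-- Derivative `V(φ)` of a complex function along a complex vector field. -/
def along (V : CField) (φ : Pt → ℂ) (x : Pt) : ℂ := ∑ i, V x i * pd i φ x

/-- The complex bilinear extension of the metric, `G(V, W)`. -/
def dot (G : Metric) (V W : CField) (x : Pt) : ℂ := ∑ i, ∑ j, (G x i j : ℂ) * V x i * W x j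

/-- Christoffel symbol `Γ^k_{ij}`. -/
def christoffel (G : Metric) (k i j : Fin 4) (x : Pt) : ℝ :=
  (1 / 2) * ∑ l, (G x)⁻¹ k l *
    (pd i (fun y => G y l j) x + pd j (fun y => G y l i) x - pd l (fun y => G y i j) x)

/-- Covariant derivative `∇_V W`. -/
def nabla (G : Metric) (V W : CField) : CField := fun x k =>
  ∑ i, V x i * (pd i (fun y => W y k) x + ∑ j, (christoffel G k i j x : ℂ) * W x j)

/-- Curvature tensor `R^i_{jkl} = ∂_k Γ^i_{lj} - ∂_l Γ^i_{kj} + Γ^i_{kq} Γ^q_{lj} - Γ^i_{lq} Γ^q_{kj}`. -/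
def riemannUp (G : Metric) (i j k l : Fin 4) (x : Pt) : ℝ :=
  pd k (christoffel G i l j) x - pd l (christoffel G i k j) x
    + ∑ q, (christoffel G i k q x * christoffel G q l j x
        - christoffel G i l q x * christoffel G q k j x)

/-- Curvature tensor with all indices down, `R_{ijkl}`. -/
def riemann (G : Metric) (i j k l : Fin 4) (x : Pt) : ℝ := ∑ q, G x i q * riemannUp G q j k l x

/-- The wedge product `dφ ∧ dψ` of the differentials of two complex functions vanishes on `U`. -/
def WedgeZero (U : Set Pt) (φ ψ : Pt → ℂ) : Prop :=
  ∀ x ∈ U, ∀ X Y : Pt,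
    fderiv ℝ φ x X * fderiv ℝ ψ x Y - fderiv ℝ φ x Y * fderiv ℝ ψ x X = 0

/-! ## Killing vector fields -/

/-- `X` is a smooth vector field on `U` with `ℒ_X G = 0`. A field on `U` is represented by its
extension by zero, so that distinct representatives are distinct fields on `U`. -/
structure IsKilling (G : Metric) (U : Set Pt) (X : RField) : Prop where
  smooth : ContDiffOn ℝ ∞ X U
  zero_off : ∀ x ∉ U, X x = 0
  lie : ∀ x ∈ U, ∀ i j, ∑ k, (X x k * pd k (fun y => G y i j) x
    + G x k j * pd i (fun y => X y k) x + G x i k * pd j (fun y => X y k) x) = 0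

/-- The real vector space of Killing fields of `G` on the open set `U`. -/
def killing (G : Metric) (U : Set Pt) (hU : IsOpen U) : Submodule ℝ RField where
  carrier := {X | IsKilling G U X}
  zero_mem' := by
    refine ⟨contDiffOn_const (c := (0 : Fin 4 → ℝ)), fun _ _ => rfl, fun x _ i j => ?_⟩
    simp [pd]
  add_mem' := by
    rintro X Y ⟨hX, hX0, hXL⟩ ⟨hY, hY0, hYL⟩
    refine ⟨hX.add hY, fun x hx => by simp [hX0 x hx, hY0 x hx], fun x hx i j => ?_⟩
    have dX : ∀ k, DifferentiableAt ℝ (fun y => X y k) x := fun k =>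
      differentiableAt_pi.1 ((hX.contDiffAt (hU.mem_nhds hx)).differentiableAt (by simp)) k
    have dY : ∀ k, DifferentiableAt ℝ (fun y => Y y k) x := fun k =>
      differentiableAt_pi.1 ((hY.contDiffAt (hU.mem_nhds hx)).differentiableAt (by simp)) k
    have key : ∀ a k, pd a (fun y => X y k + Y y k) x
        = pd a (fun y => X y k) x + pd a (fun y => Y y k) x := by
      intro a k
      simp only [pd]
      rw [fderiv_fun_add (dX k) (dY k)]
      rfl
    have h1 := hXL x hx i j
    have h2 := hYL x hx i j
    simp only [Pi.add_apply, key]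
    rw [← add_zero (0 : ℝ)]
    nth_rewrite 1 [← h1]
    rw [← h2, ← Finset.sum_add_distrib]
    exact Finset.sum_congr rfl fun k _ => by ring
  smul_mem' := by
    rintro c X ⟨hX, hX0, hXL⟩
    refine ⟨contDiffOn_const.smul hX, fun x hx => by simp [hX0 x hx], fun x hx i j => ?_⟩
    have dX : ∀ k, DifferentiableAt ℝ (fun y => X y k) x := fun k =>
      differentiableAt_pi.1 ((hX.contDiffAt (hU.mem_nhds hx)).differentiableAt (by simp)) k
    have key : ∀ a k, pd a (fun y => c * X y k) x = c * pd a (fun y => X y k) x := by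
      intro a k
      simp only [pd]
      rw [fderiv_const_mul (dX k)]
      rfl
    have h1 := hXL x hx i j
    simp only [Pi.smul_apply, smul_eq_mul, key]
    rw [← mul_zero c, ← h1, Finset.mul_sum]
    exact Finset.sum_congr rfl fun k _ => by ring

/-! ## Vacuum pp-waves -/

/-- The complex coordinate `ζ` of a point. -/
def zeta (x : Pt) : ℂ := (x 0 : ℂ) + (x 1 : ℂ) * Complex.I

/-- The space-time `{(ζ, u, v) : ζ ∈ W, u ∈ I, v ∈ ℝ}`. -/
def spacetime (W : Set ℂ) (I : Set ℝ) : Set Pt := {x | zeta x ∈ W ∧ x 2 ∈ I}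

theorem isOpen_spacetime {W : Set ℂ} {I : Set ℝ} (hW : IsOpen W) (hI : IsOpen I) :
    IsOpen (spacetime W I) := by
  have h1 : Continuous zeta := by unfold zeta; fun_prop
  exact (hW.preimage h1).inter (hI.preimage (continuous_apply 2))

/-- The metric `2 dζ dζ̄ - 2 du dv - (f + f̄) du²`, where `f = f(ζ, u)`. -/
def ppMetric (f : ℂ → ℝ → ℂ) : Metric := fun x =>
  !![2, 0, 0, 0;
     0, 2, 0, 0;
     0, 0, -(2 * (f (zeta x) (x 2)).re), -1;
     0, 0, -1, 0]

/-! ## Null tetrads and Newman-Penrose quantities -/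

/-- The constituents of a tetrad: `m` is the operator `δ`, `m̄` is `δ*`, `l` is `Δ`, `k` is `D`. -/
structure Tetrad where
  m : CField
  l : RField
  k : RField

namespace Tetrad

variable (T : Tetrad) (G : Metric)

/-- The frame `(e₁, e₂, e₃, e₄) = (m, m̄, l, k)`. -/
def frame : Fin 4 → CField := ![T.m, cconj T.m, toC T.l, toC T.k]

/-- Connection form `ω_{ab}(V) = G(e_a, ∇_V e_b)`; indices are numbered from `0`. -/
def conn (a b : Fin 4) (V : CField) (x : Pt) : ℂ := dot G (T.frame a) (nabla G V (T.frame b)) x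

/-- The operator `δ`. -/
def δ (φ : Pt → ℂ) : Pt → ℂ := along T.m φ

/-- The operator `δ*`. -/
def δs (φ : Pt → ℂ) : Pt → ℂ := along (cconj T.m) φ

/-- The operator `Δ`. -/
def Δ (φ : Pt → ℂ) : Pt → ℂ := along (toC T.l) φ

/-- Spin coefficient `α = -(ω₁₂ + ω₃₄)(m̄)/2`. -/
def α : Pt → ℂ := fun x => -(T.conn G 0 1 (cconj T.m) x + T.conn G 2 3 (cconj T.m) x) / 2

/-- Spin coefficient `γ = -(ω₁₂ + ω₃₄)(l)/2`. -/
def γ : Pt → ℂ := fun x => -(T.conn G 0 1 (toC T.l) x + T.conn G 2 3 (toC T.l) x) / 2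

/-- Spin coefficient `μ = ω₂₃(m)`. -/
def μ : Pt → ℂ := fun x => T.conn G 1 2 T.m x

/-- Spin coefficient `ν = ω₂₃(l)`. -/
def ν : Pt → ℂ := fun x => T.conn G 1 2 (toC T.l) x

/-- The curvature component `Ψ₄ = R(m̄, l, m̄, l)`. As `m̄` and `l` span a totally null plane,
the trace parts of the curvature do not contribute, so this is the Weyl component. -/
def Ψ₄ : Pt → ℂ := fun x =>
  ∑ a, ∑ b, ∑ c, ∑ d, (riemann G a b c d x : ℂ)
    * cconj T.m x a * toC T.l x b * cconj T.m x c * toC T.l x d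

/-- The invariant `A = δ*α / α²`. -/
def A : Pt → ℂ := fun x => T.δs (T.α G) x / (T.α G x) ^ 2

/-- The invariant `B = μ A - μ*`. -/
def B : Pt → ℂ := fun x => T.μ G x * T.A G x - conj (T.μ G x)

/-- The invariant `M = α μ`. -/
def M : Pt → ℂ := fun x => T.α G x * T.μ G x

/-- The invariant `Y = (3 - A) ν - 1/α + (Δμ + μ²)/α*`. -/
def Y : Pt → ℂ := fun x =>
  (3 - T.A G x) * T.ν G x - 1 / T.α G x + (T.Δ (T.μ G) x + (T.μ G x) ^ 2) / conj (T.α G x)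

/-- A smooth null tetrad on `U`: `G = 2 θ¹θ² - 2 θ³θ⁴` in the dual coframe. -/
structure IsNull (U : Set Pt) : Prop where
  smooth_m : ContDiffOn ℝ ∞ T.m U
  smooth_l : ContDiffOn ℝ ∞ T.l U
  smooth_k : ContDiffOn ℝ ∞ T.k U
  gram : ∀ x ∈ U, ∀ a b, dot G (T.frame a) (T.frame b) x
    = (!![0, 1, 0, 0; 1, 0, 0, 0; 0, 0, 0, -1; 0, 0, -1, 0] : Matrix (Fin 4) (Fin 4) ℂ) a b

/-- The normalized tetrads of a pp-wave on `U`: null tetrads with `D` along the covariantly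
constant null field `∂_v`, with `Ψ₄ = 1` and `γ = 0`. The orientation is the one for which `δ`
annihilates `ζ̄`; it decides which of two conjugate null directions is called `m`. -/
structure IsNormalized (U : Set Pt) : Prop extends T.IsNull G U where
  aligned : ∀ x ∈ U, ∀ i, i ≠ 3 → T.k x i = 0
  oriented : ∀ x ∈ U, T.δ (fun y => conj (zeta y)) x = 0
  psi4 : ∀ x ∈ U, T.Ψ₄ G x = 1
  gamma : ∀ x ∈ U, T.γ G x = 0

/-- The invariant count is `(0, 1, 1)`: `α ≠ 0` and
`dα ∧ dα* = dα ∧ dμ = dα ∧ dA = dα ∧ dν = 0`. -/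
def Count011 (U : Set Pt) : Prop :=
  (∀ x ∈ U, T.α G x ≠ 0) ∧
  WedgeZero U (T.α G) (fun x => conj (T.α G x)) ∧
  WedgeZero U (T.α G) (T.μ G) ∧
  WedgeZero U (T.α G) (T.A G) ∧
  WedgeZero U (T.α G) (T.ν G)

end Tetrad

/-! ## The four solution forms -/

/-- `L` is a holomorphic branch of `log (c ζ)` on `W`. -/
def IsLogBranch (c : ℂ) (L : ℂ → ℂ) (W : Set ℂ) : Prop :=
  DifferentiableOn ℂ L W ∧ ∀ ζ ∈ W, Complex.exp (L ζ) = c * ζ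

/-- `C u⁻² log ζ + g(u) u⁻² ζ`, where `L` is the branch of `log ζ`. -/
def formBL (L : ℂ → ℂ) (C : ℂ) (g : ℝ → ℂ) : ℂ → ℝ → ℂ := fun ζ u =>
  C * ((u : ℂ) ^ 2)⁻¹ * L ζ + g u * ((u : ℂ) ^ 2)⁻¹ * ζ

/-- `(k₀ ζ)^{2 i k₁} + g(u) ζ`, where `L` is the branch of `log (k₀ ζ)`. -/
def formAP (L : ℂ → ℂ) (k₁ : ℝ) (g : ℝ → ℂ) : ℂ → ℝ → ℂ := fun ζ u =>
  Complex.exp (2 * Complex.I * k₁ * L ζ) + g u * ζ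

/-- `exp (k ζ) + g(u) ζ`. -/
def formAE (k : ℝ) (g : ℝ → ℂ) : ℂ → ℝ → ℂ := fun ζ u => Complex.exp (k * ζ) + g u * ζ

/-- `e^{i k} log ζ + g(u) ζ`, where `L` is the branch of `log ζ`. -/
def formAL (L : ℂ → ℂ) (k : ℝ) (g : ℝ → ℂ) : ℂ → ℝ → ℂ := fun ζ u =>
  Complex.exp (Complex.I * k) * L ζ + g u * ζ

/-- The metric of the pp-wave with profile `f` is a `G₃` on `{ζ ∈ W, u ∈ I}`: its Killing fields
form a three-dimensional real vector space. -/
def IsG3 (W : Set ℂ) (I : Set ℝ) (hW : IsOpen W) (hI : IsOpen I) (f : ℂ → ℝ → ℂ) : Prop :=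
  Module.finrank ℝ (killing (ppMetric f) (spacetime W I) (isOpen_spacetime hW hI)) = 3

end PPWave

end

/-! All four classes have one shape, `AffineProfile`: f = w(u) F(ζ) + G(u) ζ with F'' = exp Ψ, 1/Ψ'
an affine function τ = t ζ + τ₀, and w = 1 or u⁻². Put ρ = w'/w. The constant t is encoded by a
complex number c of modulus one with c² = -4 t̄ - 1, and c² turns out to be A. The logarithmic
classes have t = -1/2 and c = 1, AE has t = 0 and c = i, AP has t = 1/(2ik₁ - 2). In BL, G = g u⁻²;
elsewhere G = g.

Rigidity of the tetrad. A null tetrad with D along ∂_v and the given orientation is described by a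
phase λ, a real scale s and a complex shift q (`Tetrad.Shape`). Then Ψ₄ = 1 reads λ² w conj(exp Ψ) =
2 s²; modulus and argument fix s² and λ², so λ and s are known up to sign and their logarithmic
differentials are explicit (`adapted_of_psi4`). The condition γ = 0 becomes q = -ρ τ (`shift_eq`).
All invariants are now closed formulas.

The wedge condition. Let θ = c̄ dζ/τ + c dζ̄/τ̄, a real form. The differentials of α and μ are
multiples of θ, and A is constant. The invariant Y is a nowhere vanishing factor times the conjugate
of G (`Y_eq`), and ν is a nonzero multiple of Y plus an expression in α and μ (`ν_eq_Y`). The ζ and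
ζ̄ parts of dY are in ratio 1 : 3 relative to dζ/τ and dζ̄/τ̄; proportionality to θ would need c = 3
c̄, impossible for |c| = 1. So dα ∧ dν = 0 forces Y = 0, hence G = 0, and conversely G = 0 makes
every differential a multiple of θ.

Killing fields. For a field with ζ-component z, u-component a and v-component b, the integrability
conditions and f'' ≠ 0 make a affine in u alone and z holomorphic in ζ with constant rotation rate ω
(`KillingSystem.reduced`). The second ζ-derivative of the last Killing equation gives z = -(2iω + κ)
τ with κ = aρ + 2a'. Comparing with dz leaves one real parameter: z = i c r τ. Thus a, r and b at a
point determine the field, and the dimension is at most 3 (`killing_eq_zero`). If it is 3, some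
field has a = 0 and r = 1 at any chosen point, and the remaining equation iωG + aG' + 2a'G = 0
forces G = 0 there. If G = 0, fields with arbitrary data are written down (`exists_killing`). -/

noncomputable section

namespace PPWave

/-! ## Calculus with `dζ`, `dζ̄`, `du` -/

/-- The differential of `ζ`. -/
def dzeta : Pt →L[ℝ] ℂ :=
  Complex.ofRealCLM.comp (ContinuousLinearMap.proj 0) +
    Complex.I • Complex.ofRealCLM.comp (ContinuousLinearMap.proj 1)

theorem dzeta_apply (x : Pt) : dzeta x = zeta x := by
  simp [dzeta, zeta, mul_comm]

/-- The complex-valued form `a dζ + b dζ̄ + c du`. -/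
def dform (a b c : ℂ) : Pt →L[ℝ] ℂ :=
  a • dzeta + b • (Complex.conjCLE.toContinuousLinearMap.comp dzeta) +
    c • Complex.ofRealCLM.comp (ContinuousLinearMap.proj 2)

theorem dform_apply (a b c : ℂ) (x : Pt) :
    dform a b c x = a * zeta x + b * conj (zeta x) + c * (x 2 : ℂ) := by
  simp [dform, dzeta_apply]

/-- `dφ = a dζ + b dζ̄ + c du` at `x`. -/
abbrev HasD (φ : Pt → ℂ) (a b c : ℂ) (x : Pt) : Prop := HasFDerivAt φ (dform a b c) x

namespace HasD

variable {φ ψ : Pt → ℂ} {a b c a' b' c' : ℂ} {x : Pt}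

theorem congr' (h : HasD φ a b c x) (ha : a = a') (hb : b = b') (hc : c = c') :
    HasD φ a' b' c' x := by subst ha hb hc; exact h

theorem const (k : ℂ) : HasD (fun _ => k) 0 0 0 x := by
  have : dform 0 0 0 = 0 := by ext; simp [dform_apply]
  rw [HasD, this]; exact hasFDerivAt_const k x

theorem zeta : HasD zeta 1 0 0 x := by
  have : dform 1 0 0 = dzeta := by ext; simp [dform_apply, dzeta_apply]
  rw [HasD, this]
  have := dzeta.hasFDerivAt (x := x)
  convert this using 1
  ext y; rw [dzeta_apply]

theorem ofCoord {k : ℝ → ℂ} {k' : ℂ} (h : HasDerivAt k k' (x 2)) :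
    HasD (fun y => k (y 2)) 0 0 k' x := by
  have h1 : HasFDerivAt (fun y : Pt => y 2) (ContinuousLinearMap.proj (R := ℝ) (φ := fun _ => ℝ) 2) x :=
    (ContinuousLinearMap.proj (R := ℝ) (φ := fun _ => ℝ) (2 : Fin 4)).hasFDerivAt
  exact (h.hasFDerivAt.comp x h1).congr_fderiv (ContinuousLinearMap.ext fun y => by
    simp [dform_apply, mul_comm])

theorem add (h : HasD φ a b c x) (h' : HasD ψ a' b' c' x) :
    HasD (fun y => φ y + ψ y) (a + a') (b + b') (c + c') x :=
  (HasFDerivAt.add h h').congr_fderiv (ContinuousLinearMap.ext fun y => by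
    simp [dform_apply]; ring)

theorem neg (h : HasD φ a b c x) : HasD (fun y => -φ y) (-a) (-b) (-c) x :=
  (HasFDerivAt.neg h).congr_fderiv (ContinuousLinearMap.ext fun y => by
    simp [dform_apply]; ring)

theorem sub (h : HasD φ a b c x) (h' : HasD ψ a' b' c' x) :
    HasD (fun y => φ y - ψ y) (a - a') (b - b') (c - c') x :=
  (HasFDerivAt.sub h h').congr_fderiv (ContinuousLinearMap.ext fun y => by
    simp [dform_apply]; ring)

theorem mul (h : HasD φ a b c x) (h' : HasD ψ a' b' c' x) :
    HasD (fun y => φ y * ψ y) (a * ψ x + φ x * a') (b * ψ x + φ x * b') (c * ψ x + φ x * c') x :=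
  (HasFDerivAt.mul h h').congr_fderiv (ContinuousLinearMap.ext fun y => by
    simp [dform_apply]; ring)

theorem conjugate (h : HasD φ a b c x) :
    HasD (fun y => conj (φ y)) (conj b) (conj a) (conj c) x :=
  (Complex.conjCLE.toContinuousLinearMap.hasFDerivAt.comp x h).congr_fderiv
    (ContinuousLinearMap.ext fun y => by simp [dform_apply]; ring)

theorem comp {k : ℂ → ℂ} {k' : ℂ} (hk : HasDerivAt k k' (φ x)) (h : HasD φ a b c x) :
    HasD (fun y => k (φ y)) (k' * a) (k' * b) (k' * c) x :=
  ((hk.hasFDerivAt.restrictScalars ℝ).comp x h).congr_fderiv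
    (ContinuousLinearMap.ext fun y => by simp [dform_apply]; ring)

theorem exp (h : HasD φ a b c x) :
    HasD (fun y => Complex.exp (φ y)) (Complex.exp (φ x) * a) (Complex.exp (φ x) * b)
      (Complex.exp (φ x) * c) x :=
  comp (Complex.hasDerivAt_exp _) h

theorem inv (h : HasD φ a b c x) (h0 : φ x ≠ 0) :
    HasD (fun y => (φ y)⁻¹) (-(a / φ x ^ 2)) (-(b / φ x ^ 2)) (-(c / φ x ^ 2)) x :=
  (comp (hasDerivAt_inv h0) h).congr' (by ring) (by ring) (by ring)

theorem pd0 (h : HasD φ a b c x) : pd 0 φ x = a + b := by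
  simp [pd, HasFDerivAt.fderiv h, dform_apply, PPWave.zeta]

theorem pd1 (h : HasD φ a b c x) : pd 1 φ x = Complex.I * (a - b) := by
  simp [pd, HasFDerivAt.fderiv h, dform_apply, PPWave.zeta]; ring

theorem pd2 (h : HasD φ a b c x) : pd 2 φ x = c := by
  simp [pd, HasFDerivAt.fderiv h, dform_apply, PPWave.zeta]

/-- `dform` has no dv term, so `HasD` includes the claim that φ is stationary in the v direction. -/
theorem pd3 (h : HasD φ a b c x) : pd 3 φ x = 0 := by
  simp [pd, HasFDerivAt.fderiv h, dform_apply, PPWave.zeta]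

theorem along (h : HasD φ a b c x) (V : CField) :
    along V φ x = (V x 0 + Complex.I * V x 1) * a + (V x 0 - Complex.I * V x 1) * b
      + V x 2 * c := by
  simp only [PPWave.along, Fin.sum_univ_four, h.pd0, h.pd1, h.pd2, h.pd3]
  ring

theorem pd_re (h : HasD φ a b c x) (i : Fin 4) :
    pd i (fun y => 2 * (φ y).re) x = 2 * (dform a b c (Pi.single i 1)).re := by
  have h1 : HasFDerivAt (fun y => 2 * (φ y).re) ((2 : ℝ) • Complex.reCLM.comp (dform a b c)) x :=
    (Complex.reCLM.hasFDerivAt.comp x h).const_mul 2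
  simp [pd, h1.fderiv]

end HasD

theorem pd_congr {F : Type*} [NormedAddCommGroup F] [NormedSpace ℝ F] {φ ψ : Pt → F} {U : Set Pt}
    (hU : IsOpen U) (h : ∀ x ∈ U, φ x = ψ x) {x : Pt} (hx : x ∈ U) (i : Fin 4) :
    pd i φ x = pd i ψ x := by
  unfold pd
  rw [Filter.EventuallyEq.fderiv_eq (Filter.eventually_of_mem (hU.mem_nhds hx) h)]

theorem along_congr {φ ψ : Pt → ℂ} {U : Set Pt} (hU : IsOpen U) (h : ∀ x ∈ U, φ x = ψ x) {x : Pt}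
    (hx : x ∈ U) (V : CField) : along V φ x = along V ψ x := by
  simp only [along, pd_congr hU h hx]

/-! ## Geometry of a metric `2 dζ dζ̄ - 2 du dv - H du²` -/

/-- The function `H = f + f̄`. -/
def potential (f : ℂ → ℝ → ℂ) (x : Pt) : ℝ := 2 * (f (zeta x) (x 2)).re

theorem pd_ppMetric (f : ℂ → ℝ → ℂ) (i l j : Fin 4) (x : Pt) :
    pd i (fun y => ppMetric f y l j) x = if l = 2 ∧ j = 2 then -pd i (potential f) x else 0 := by
  fin_cases l <;> fin_cases j <;> simp [ppMetric, pd]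
  rfl

theorem ppMetric_inv (f : ℂ → ℝ → ℂ) (x : Pt) :
    (ppMetric f x)⁻¹ = !![1 / 2, 0, 0, 0; 0, 1 / 2, 0, 0; 0, 0, 0, -1; 0, 0, -1, potential f x] := by
  apply Matrix.inv_eq_right_inv
  ext i j
  fin_cases i <;> fin_cases j <;> simp [ppMetric, potential, Matrix.mul_apply, Fin.sum_univ_four]

/-- Needs no regularity of φ, so the Christoffel formulas below hold for an arbitrary profile f. -/
theorem pd_three_eq_zero {φ : Pt → ℝ} (h : ∀ (x : Pt) (t : ℝ), φ (x + t • Pi.single 3 1) = φ x)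
    (x : Pt) : pd 3 φ x = 0 := by
  unfold pd
  by_cases hd : DifferentiableAt ℝ φ x
  · have h1 := hd.hasFDerivAt.hasLineDerivAt (Pi.single 3 1)
    have h2 : HasLineDerivAt ℝ φ 0 x (Pi.single 3 1) := by
      unfold HasLineDerivAt
      simp only [h]
      exact hasDerivAt_const 0 (φ x)
    exact h1.unique h2
  -- `fderiv` takes the default value 0 where φ is not differentiable.
  · rw [fderiv_zero_of_not_differentiableAt hd]; rfl

theorem pd_three_potential (f : ℂ → ℝ → ℂ) (x : Pt) : pd 3 (potential f) x = 0 :=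
  pd_three_eq_zero (fun x t => by simp [potential, zeta]) x

theorem christoffel_zero (f : ℂ → ℝ → ℂ) (i j : Fin 4) (x : Pt) :
    christoffel (ppMetric f) 0 i j x = if i = 2 ∧ j = 2 then pd 0 (potential f) x / 4 else 0 := by
  simp only [christoffel, ppMetric_inv, pd_ppMetric, Fin.sum_univ_four]
  fin_cases i <;> fin_cases j <;> simp; ring

theorem christoffel_one (f : ℂ → ℝ → ℂ) (i j : Fin 4) (x : Pt) :
    christoffel (ppMetric f) 1 i j x = if i = 2 ∧ j = 2 then pd 1 (potential f) x / 4 else 0 := by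
  simp only [christoffel, ppMetric_inv, pd_ppMetric, Fin.sum_univ_four]
  fin_cases i <;> fin_cases j <;> simp; ring

/-- The only inverse-metric entry with index u pairs it with v, and no metric component depends on v
or has a varying v-slot. -/
theorem christoffel_two (f : ℂ → ℝ → ℂ) (i j : Fin 4) (x : Pt) :
    christoffel (ppMetric f) 2 i j x = 0 := by
  simp only [christoffel, ppMetric_inv, pd_ppMetric, Fin.sum_univ_four]
  fin_cases i <;> fin_cases j <;> simp [pd_three_potential]

theorem christoffel_three (f : ℂ → ℝ → ℂ) (i j : Fin 4) (x : Pt) :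
    christoffel (ppMetric f) 3 i j x =
      ((if i = 2 then pd j (potential f) x else 0) + (if j = 2 then pd i (potential f) x else 0)
        - if i = 2 ∧ j = 2 then pd 2 (potential f) x else 0) / 2 := by
  simp only [christoffel, ppMetric_inv, pd_ppMetric, Fin.sum_univ_four]
  fin_cases i <;> fin_cases j <;> simp [pd_three_potential] <;> ring

/-- The derivative of the component `W k` along `V`. -/
theorem nabla_apply (f : ℂ → ℝ → ℂ) (V W : CField) (x : Pt) :
    nabla (ppMetric f) V W x 0 =
        along V (fun y => W y 0) x + ((pd 0 (potential f) x : ℝ) : ℂ) / 4 * V x 2 * W x 2 ∧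
    nabla (ppMetric f) V W x 1 =
        along V (fun y => W y 1) x + ((pd 1 (potential f) x : ℝ) : ℂ) / 4 * V x 2 * W x 2 ∧
    nabla (ppMetric f) V W x 2 = along V (fun y => W y 2) x := by
  simp only [nabla, along, Fin.sum_univ_four, christoffel_zero, christoffel_one, christoffel_two]
  refine ⟨?_, ?_, ?_⟩ <;> simp <;> ring

theorem dot_ppMetric (f : ℂ → ℝ → ℂ) (V W : CField) (x : Pt) :
    dot (ppMetric f) V W x = 2 * V x 0 * W x 0 + 2 * V x 1 * W x 1
      - potential f x * V x 2 * W x 2 - V x 2 * W x 3 - V x 3 * W x 2 := by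
  simp [dot, ppMetric, potential, Fin.sum_univ_four]
  ring

/-- The surviving curvature components are R_{iuju}, half the Hessian of H, because products of
Christoffel symbols cancel. The two mixed derivatives are kept apart since f is not assumed smooth
here. -/
theorem riemann_contract (f : ℂ → ℝ → ℂ) (x : Pt) (m l : Fin 4 → ℂ) (hm : m 2 = 0) :
    ∑ a, ∑ b, ∑ c, ∑ d, (riemann (ppMetric f) a b c d x : ℂ) * m a * l b * m c * l d =
      l 2 ^ 2 / 2 * (m 0 * m 0 * (pd 0 (pd 0 (potential f)) x : ℝ) + m 0 * m 1 * (pd 1 (pd 0 (potential f)) x : ℝ)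
        + m 1 * m 0 * (pd 0 (pd 1 (potential f)) x : ℝ) + m 1 * m 1 * (pd 1 (pd 1 (potential f)) x : ℝ)) := by
  have e0 : ∀ i j, christoffel (ppMetric f) 0 i j =
      if i = 2 ∧ j = 2 then fun x => pd 0 (potential f) x / 4 else fun _ => 0 := fun i j => by
    ext x; rw [christoffel_zero]; split_ifs <;> rfl
  have e1 : ∀ i j, christoffel (ppMetric f) 1 i j =
      if i = 2 ∧ j = 2 then fun x => pd 1 (potential f) x / 4 else fun _ => 0 := fun i j => by
    ext x; rw [christoffel_one]; split_ifs <;> rfl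
  have e2 : ∀ i j, christoffel (ppMetric f) 2 i j = fun _ => 0 := fun i j => by
    ext x; rw [christoffel_two]
  -- Translation in v preserves H, hence also its partial derivatives.
  have z3 : ∀ i, pd 3 (pd i (potential f)) x = 0 := fun i => by
    refine pd_three_eq_zero (fun x t => ?_) x
    have : potential f = fun y => potential f (y + t • Pi.single 3 1) := by
      ext y; simp [potential, zeta]
    unfold pd
    conv_rhs => rw [this, fderiv_comp_add_right]
  have hq : ∀ (k : Fin 4) (φ : Pt → ℝ), pd k (fun x => φ x / 4) x = pd k φ x / 4 := by
    intro k φ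
    have : (fun x => φ x / 4) = (4 : ℝ)⁻¹ • φ := by ext; simp; ring
    rw [this]; unfold pd
    rw [fderiv_const_smul_field]; simp; ring
  have hz : ∀ k, pd k (fun _ : Pt => (0 : ℝ)) x = 0 := fun k => by simp [pd]
  have r0 : ∀ b c d, riemann (ppMetric f) 0 b c d x =
      if b = 2 then ((if d = 2 then pd c (pd 0 (potential f)) x else 0)
        - (if c = 2 then pd d (pd 0 (potential f)) x else 0)) / 2 else 0 := by
    intro b c d
    have : riemann (ppMetric f) 0 b c d x = 2 * riemannUp (ppMetric f) 0 b c d x := by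
      simp [riemann, ppMetric, Fin.sum_univ_four]
    rw [this]
    simp only [riemannUp, e0, e1, e2, Fin.sum_univ_four]
    fin_cases b <;> fin_cases c <;> fin_cases d <;> simp [hz, hq] <;> ring
  have r1 : ∀ b c d, riemann (ppMetric f) 1 b c d x =
      if b = 2 then ((if d = 2 then pd c (pd 1 (potential f)) x else 0)
        - (if c = 2 then pd d (pd 1 (potential f)) x else 0)) / 2 else 0 := by
    intro b c d
    have : riemann (ppMetric f) 1 b c d x = 2 * riemannUp (ppMetric f) 1 b c d x := by
      simp [riemann, ppMetric, Fin.sum_univ_four]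
    rw [this]
    simp only [riemannUp, e0, e1, e2, Fin.sum_univ_four]
    fin_cases b <;> fin_cases c <;> fin_cases d <;> simp [hz, hq] <;> ring
  have r3 : ∀ b c d, riemann (ppMetric f) 3 b c d x = 0 := by
    intro b c d
    have : riemann (ppMetric f) 3 b c d x = - riemannUp (ppMetric f) 2 b c d x := by
      simp [riemann, ppMetric, Fin.sum_univ_four]
    rw [this]
    simp only [riemannUp, e2, Fin.sum_univ_four, hz]
    simp
  simp only [Fin.sum_univ_four (fun a => ∑ b, ∑ c, ∑ d, (riemann (ppMetric f) a b c d x : ℂ)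
    * m a * l b * m c * l d), hm, r0, r1, r3]
  simp [Fin.sum_univ_four, hm, z3]
  ring

end PPWave
end

/-! ### Aligned null tetrads: connection forms and Ψ₄ from phase, scale and shift -/

noncomputable section

namespace PPWave

@[simp]
theorem conj_two : conj (2 : ℂ) = 2 := map_ofNat _ 2

@[simp]
theorem conj_four : conj (4 : ℂ) = 4 := map_ofNat _ 4

theorem isPreconnected_spacetime {W : Set ℂ} {I : Set ℝ} (hW : IsPreconnected W)
    (hI : IsPreconnected I) : IsPreconnected (spacetime W I) := by
  have h := (hW.prod (hI.prod (isPreconnected_univ (α := ℝ)))).image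
    (fun p : ℂ × ℝ × ℝ => (![p.1.re, p.1.im, p.2.1, p.2.2] : Pt)) (Continuous.continuousOn (by
      refine continuous_pi fun i => ?_
      fin_cases i <;> simp <;> fun_prop))
  convert h using 1
  ext x
  constructor
  · rintro ⟨h1, h2⟩
    refine ⟨(zeta x, x 2, x 3), ⟨h1, h2, trivial⟩, ?_⟩
    ext i; fin_cases i <;> simp [zeta]
  · rintro ⟨⟨z, u, v⟩, ⟨h1, h2, -⟩, rfl⟩
    exact ⟨by simpa [zeta, Complex.re_add_im] using h1, by simpa using h2⟩

/-- First and second derivatives of the profile along `ζ`, and their `u`-derivatives. -/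
structure HasJet (f : ℂ → ℝ → ℂ) (U : Set Pt) (f₁ f₂ fu f₁u : Pt → ℂ) : Prop where
  d : ∀ x ∈ U, HasD (fun y => f (zeta y) (y 2)) (f₁ x) 0 (fu x) x
  d₁ : ∀ x ∈ U, HasD f₁ (f₂ x) 0 (f₁u x) x

namespace HasJet

variable {f : ℂ → ℝ → ℂ} {U : Set Pt} {f₁ f₂ fu f₁u : Pt → ℂ}

theorem pd0 (h : HasJet f U f₁ f₂ fu f₁u) {x : Pt} (hx : x ∈ U) :
    pd 0 (potential f) x = 2 * (f₁ x).re := by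
  unfold potential
  rw [(h.d x hx).pd_re]; simp [dform_apply, zeta]

theorem pd1 (h : HasJet f U f₁ f₂ fu f₁u) {x : Pt} (hx : x ∈ U) :
    pd 1 (potential f) x = 2 * (Complex.I * f₁ x).re := by
  unfold potential
  rw [(h.d x hx).pd_re]; simp [dform_apply, zeta]

theorem pd2 (h : HasJet f U f₁ f₂ fu f₁u) {x : Pt} (hx : x ∈ U) :
    pd 2 (potential f) x = 2 * (fu x).re := by
  unfold potential
  rw [(h.d x hx).pd_re]; simp [dform_apply, zeta]

theorem d₁I (h : HasJet f U f₁ f₂ fu f₁u) {x : Pt} (hx : x ∈ U) :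
    HasD (fun y => Complex.I * f₁ y) (Complex.I * f₂ x) 0 (Complex.I * f₁u x) x :=
  ((HasD.const Complex.I).mul (h.d₁ x hx)).congr' (by simp) (by simp) (by simp)

theorem pd_pd0 (h : HasJet f U f₁ f₂ fu f₁u) (hU : IsOpen U) {x : Pt} (hx : x ∈ U) (i : Fin 4) :
    pd i (pd 0 (potential f)) x = 2 * (dform (f₂ x) 0 (f₁u x) (Pi.single i 1)).re := by
  rw [pd_congr hU (fun y hy => h.pd0 hy) hx, (h.d₁ x hx).pd_re]

theorem pd_pd1 (h : HasJet f U f₁ f₂ fu f₁u) (hU : IsOpen U) {x : Pt} (hx : x ∈ U) (i : Fin 4) :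
    pd i (pd 1 (potential f)) x =
      2 * (dform (Complex.I * f₂ x) 0 (Complex.I * f₁u x) (Pi.single i 1)).re := by
  rw [pd_congr hU (fun y hy => h.pd1 hy) hx, (h.d₁I hx).pd_re]

end HasJet

namespace Tetrad

variable {T : Tetrad} {f : ℂ → ℝ → ℂ} {U : Set Pt}

/-- The phase of `m̄ = λ̄ ∂_ζ̄ + …`. -/
def phase (T : Tetrad) (x : Pt) : ℂ := 2 * conj (T.m x 0)

/-- The scale of `k = s ∂_v`. -/
def scale (T : Tetrad) (x : Pt) : ℂ := (T.k x 3 : ℂ)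

/-- The shift of `l = s⁻¹ (∂_u + q ∂_ζ + …)`. -/
def shift (T : Tetrad) (x : Pt) : ℂ := (T.l x 0 + Complex.I * T.l x 1) * T.k x 3

/-- The algebraic form of an aligned null tetrad. -/
structure Shape (T : Tetrad) (x : Pt) : Prop where
  phase_mul : conj (T.phase x) * T.phase x = 1
  scale_ne : T.scale x ≠ 0
  m0 : T.m x 0 = conj (T.phase x) / 2
  m1 : T.m x 1 = -Complex.I * conj (T.phase x) / 2
  m2 : T.m x 2 = 0
  m3 : T.m x 3 = conj (T.phase x) * conj (T.shift x)
  l01 : (T.l x 0 : ℂ) + Complex.I * T.l x 1 = T.shift x / T.scale x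
  l01' : (T.l x 0 : ℂ) - Complex.I * T.l x 1 = conj (T.shift x) / T.scale x
  l2 : (T.l x 2 : ℂ) = 1 / T.scale x
  k0 : T.k x 0 = 0
  k1 : T.k x 1 = 0
  k2 : T.k x 2 = 0

theorem conj_scale (x : Pt) : conj (T.scale x) = T.scale x := Complex.conj_ofReal _

/-- Pure algebra: products with k = s ∂_v give the u-components of m and l, orientation makes m a
multiple of ∂_ζ modulo ∂_v, ⟨m, m̄⟩ = 1 normalizes the phase, and ⟨m, l⟩ = 0 gives the v-component
of m. -/
theorem IsNormalized.shape (h : T.IsNormalized (ppMetric f) U) {x : Pt} (hx : x ∈ U) :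
    T.Shape x := by
  have k0 := h.aligned x hx 0 (by decide)
  have k1 := h.aligned x hx 1 (by decide)
  have k2 := h.aligned x hx 2 (by decide)
  have g03 := h.gram x hx 0 3
  have g23 := h.gram x hx 2 3
  have g01 := h.gram x hx 0 1
  have g02 := h.gram x hx 0 2
  have ho := h.oriented x hx
  have hz : HasD (fun y => conj (zeta y)) 0 1 0 x := (HasD.zeta.conjugate).congr' (by simp) (by simp) (by simp)
  rw [Tetrad.δ, hz.along] at ho
  simp only [dot_ppMetric] at g03 g23 g01 g02
  simp [Tetrad.frame, toC, cconj, k0, k1, k2] at g03 g23 g01 g02 ho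
  have hk3 : (T.k x 3 : ℂ) ≠ 0 := by
    intro h0; rw [h0] at g23; simp at g23
  have hm2 : T.m x 2 = 0 := by
    rcases g03 with h1 | h1
    · exact h1
    · exact absurd (by exact_mod_cast h1) hk3
  have hI := Complex.I_sq
  have hm1 : T.m x 1 = -Complex.I * T.m x 0 := by
    linear_combination Complex.I * ho + T.m x 1 * hI
  have hl2 : (T.l x 2 : ℂ) = 1 / T.scale x := by
    rw [scale]; field_simp; exact g23
  have hm1c : conj (T.m x 1) = Complex.I * conj (T.m x 0) := by rw [hm1]; simp
  have hl01' : (T.l x 0 : ℂ) - Complex.I * T.l x 1 = conj (T.shift x) / T.scale x := by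
    simp only [shift, scale]; simp; field_simp; ring
  refine ⟨?_, hk3, ?_, ?_, hm2, ?_, ?_, hl01', hl2, k0, k1, k2⟩
  · rw [hm2, hm1, map_mul] at g01
    simp at g01
    simp only [phase, map_mul, Complex.conj_conj, map_ofNat]
    linear_combination g01 + 2 * T.m x 0 * conj (T.m x 0) * hI
  · simp [phase]
  · simp [phase, hm1]; ring
  · have : T.m x 3 = 2 * T.m x 0 * (T.l x 0 - Complex.I * T.l x 1) * T.k x 3 := by
      rw [hm1, hm2] at g02
      have : 2 * T.m x 0 * (T.l x 0 - Complex.I * T.l x 1) = T.m x 3 * T.l x 2 := by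
        linear_combination g02
      rw [this, mul_assoc, g23, mul_one]
    rw [this, hl01']
    simp only [phase, scale, map_mul, Complex.conj_conj, map_ofNat]
    field_simp
  · simp only [shift, scale]; field_simp

namespace Shape

variable {x : Pt} {φ : Pt → ℂ} {a b c : ℂ}

/-- On functions stationary in v, m acts as λ̄ ∂_ζ, m̄ as λ ∂_ζ̄, and l as s⁻¹(q ∂_ζ + q̄ ∂_ζ̄ +
∂_u). -/
theorem along_m (hs : T.Shape x) (h : HasD φ a b c x) : along T.m φ x = conj (T.phase x) * a := by
  rw [h.along, hs.m0, hs.m1, hs.m2]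
  linear_combination (-conj (T.phase x) * a / 2 + conj (T.phase x) * b / 2) * Complex.I_sq

theorem mbar1 (hs : T.Shape x) : conj (T.m x 1) = Complex.I * T.phase x / 2 := by
  rw [hs.m1]; simp

theorem along_mbar (hs : T.Shape x) (h : HasD φ a b c x) :
    along (cconj T.m) φ x = T.phase x * b := by
  rw [h.along]
  simp only [cconj]
  rw [hs.m0, hs.mbar1, hs.m2]
  simp
  linear_combination (T.phase x * a / 2 - T.phase x * b / 2) * Complex.I_sq

theorem along_l (hs : T.Shape x) (h : HasD φ a b c x) :
    along (toC T.l) φ x = (T.shift x * a + conj (T.shift x) * b + c) / T.scale x := by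
  rw [h.along]
  simp only [toC]
  rw [hs.l01, hs.l01', hs.l2]
  ring

end Shape

variable {x : Pt} {V : CField}

/-- The Christoffel terms drop out because m and m̄ have no u-component; only the rotation of the
phase is seen. -/
theorem conn01 (hU : IsOpen U) (hs : ∀ x ∈ U, T.Shape x) (hx : x ∈ U)
    {a b c : ℂ} (h : HasD T.phase a b c x) :
    T.conn (ppMetric f) 0 1 V x = conj (T.phase x) * along V T.phase x := by
  have hx' := hs x hx
  have e0 : along V (fun y => cconj T.m y 0) x = along V T.phase x / 2 := by
    rw [along_congr hU (ψ := fun y => 1 / 2 * T.phase y) (fun y hy => by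
      simp [cconj, (hs y hy).m0]; ring) hx, ((HasD.const _).mul h).along, h.along]
    ring
  have e1 : along V (fun y => cconj T.m y 1) x = Complex.I * along V T.phase x / 2 := by
    rw [along_congr hU (ψ := fun y => Complex.I / 2 * T.phase y) (fun y hy => by
      simp [cconj, (hs y hy).mbar1]; ring) hx, ((HasD.const _).mul h).along, h.along]
    ring
  have e2 : along V (fun y => cconj T.m y 2) x = 0 := by
    rw [along_congr hU (ψ := fun y => 0) (fun y hy => by
      simp [cconj, (hs y hy).m2]) hx, (HasD.const 0).along]
    ring
  obtain ⟨n0, n1, n2⟩ := nabla_apply f V (cconj T.m) x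
  have hb2 : cconj T.m x 2 = 0 := by simp [cconj, hx'.m2]
  rw [conn, dot_ppMetric]
  simp only [frame, Matrix.cons_val_zero, Matrix.cons_val_one]
  rw [n0, n1, n2, e0, e1, e2, hb2, hx'.m0, hx'.m1, hx'.m2]
  linear_combination (-conj (T.phase x) * along V T.phase x / 2) * Complex.I_sq

/-- Since ∂_v is parallel, only the scale of k is differentiated. -/
theorem conn23 (hU : IsOpen U) (hs : ∀ x ∈ U, T.Shape x) (hx : x ∈ U) :
    T.conn (ppMetric f) 2 3 V x = -(along V T.scale x) / T.scale x := by
  have hx' := hs x hx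
  have e : ∀ i, (∀ y ∈ U, T.k y i = 0) → along V (fun y => toC T.k y i) x = 0 := fun i hi => by
    rw [along_congr hU (ψ := fun y => 0) (fun y hy => by
      simp [toC, hi y hy]) hx, (HasD.const 0).along]
    ring
  obtain ⟨n0, n1, n2⟩ := nabla_apply f V (toC T.k) x
  have n3 : nabla (ppMetric f) V (toC T.k) x 3 = along V T.scale x := by
    simp only [nabla, along, Fin.sum_univ_four, christoffel_three]
    simp [toC, hx'.k0, hx'.k1, hx'.k2, pd_three_potential]
    rfl
  have hb2 : toC T.k x 2 = 0 := by simp [toC, hx'.k2]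
  rw [conn, dot_ppMetric]
  simp only [frame, Matrix.cons_val]
  rw [n0, n1, n2, n3, e 0 (fun y hy => (hs y hy).k0), e 1 (fun y hy => (hs y hy).k1),
    e 2 (fun y hy => (hs y hy).k2), hb2]
  simp only [toC]
  rw [hx'.l2]
  ring

/-- Differentiating the factor s⁻¹ of l gives a multiple of l, which is orthogonal to m̄; what
remains is the change of the shift and the Christoffel term ∂_ζ̄ H. -/
theorem conn12 {f₁ f₂ fu f₁u : Pt → ℂ} (hf : HasJet f U f₁ f₂ fu f₁u)
    (hU : IsOpen U) (hs : ∀ x ∈ U, T.Shape x) (hx : x ∈ U)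
    {a b c a' b' c' : ℂ} (h : HasD T.shift a b c x) (h' : HasD T.scale a' b' c' x) :
    T.conn (ppMetric f) 1 2 V x =
      T.phase x / T.scale x * (along V T.shift x + V x 2 * conj (f₁ x) / 2) := by
  have hx' := hs x hx
  have hI := Complex.I_sq
  have hne := hx'.scale_ne
  have hinv := h'.inv hne
  have hp := h.mul hinv
  have hlin : ∀ {p r : ℂ} {φ ψ : Pt → ℂ} {α β γ α' β' γ' : ℂ}, HasD φ α β γ x → HasD ψ α' β' γ' x →
      along V (fun y => p * φ y + r * ψ y) x = p * along V φ x + r * along V ψ x := by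
    intro p r φ ψ α β γ α' β' γ' h1 h2
    rw [(((HasD.const p).mul h1).add ((HasD.const r).mul h2)).along, h1.along, h2.along]
    ring
  have hq := h.conjugate.mul hinv
  have e0 : along V (fun y => toC T.l y 0) x = 1 / 2 * along V (fun y => T.shift y * (T.scale y)⁻¹) x
      + 1 / 2 * along V (fun y => conj (T.shift y) * (T.scale y)⁻¹) x := by
    rw [← hlin hp hq]
    refine along_congr hU (fun y hy => ?_) hx V
    simp only [toC]
    linear_combination (1 / 2) * (hs y hy).l01 + (1 / 2) * (hs y hy).l01'
  have e1 : along V (fun y => toC T.l y 1) x =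
      (-Complex.I / 2) * along V (fun y => T.shift y * (T.scale y)⁻¹) x
      + (Complex.I / 2) * along V (fun y => conj (T.shift y) * (T.scale y)⁻¹) x := by
    rw [← hlin hp hq]
    refine along_congr hU (fun y hy => ?_) hx V
    simp only [toC]
    linear_combination (-Complex.I / 2) * (hs y hy).l01 + (Complex.I / 2) * (hs y hy).l01'
      + (T.l y 1 : ℂ) * hI
  have e2 : along V (fun y => toC T.l y 2) x = along V (fun y => (T.scale y)⁻¹) x :=
    along_congr hU (fun y hy => by simp only [toC]; rw [(hs y hy).l2, one_div]) hx V
  obtain ⟨n0, n1, n2⟩ := nabla_apply f V (toC T.l) x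
  have hb0 : cconj T.m x 0 = T.phase x / 2 := by simp [cconj, hx'.m0]
  have hb1 : cconj T.m x 1 = Complex.I * T.phase x / 2 := by simp [cconj, hx'.mbar1]
  have hb2 : cconj T.m x 2 = 0 := by simp [cconj, hx'.m2]
  have hb3 : cconj T.m x 3 = T.phase x * T.shift x := by simp [cconj, hx'.m3]
  have hl2 : toC T.l x 2 = 1 / T.scale x := hx'.l2
  -- This is (∂₀ + i ∂₁) H = 2 ∂_ζ̄ H.
  have hf1 : ((2 * (f₁ x).re : ℝ) : ℂ) + Complex.I * ((2 * (Complex.I * f₁ x).re : ℝ) : ℂ)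
      = 2 * conj (f₁ x) := by
    apply Complex.ext <;> simp
  have hsplit : along V (fun y => T.shift y * (T.scale y)⁻¹) x =
      along V T.shift x / T.scale x + T.shift x * along V (fun y => (T.scale y)⁻¹) x := by
    rw [hp.along, h.along, hinv.along]; field_simp; ring
  rw [conn, dot_ppMetric]
  simp only [frame, Matrix.cons_val_zero, Matrix.cons_val_one, Matrix.cons_val]
  rw [n0, n1, n2, e0, e1, e2, hb0, hb1, hb2, hb3, hl2, hf.pd0 hx, hf.pd1 hx, hsplit]
  linear_combination (T.phase x / T.scale x / 4 * V x 2) * hf1 - (1/2) * T.phase x *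
    (along V T.shift x / T.scale x + T.shift x * along V (fun y => (T.scale y)⁻¹) x -
      along V (fun y => conj (T.shift y) * (T.scale y)⁻¹) x) * hI

/-- Contracting twice with m̄ extracts ∂_ζ̄² H, the conjugate of f''. -/
theorem psi4_eq {f₁ f₂ fu f₁u : Pt → ℂ} (hf : HasJet f U f₁ f₂ fu f₁u) (hU : IsOpen U)
    (hs : T.Shape x) (hx : x ∈ U) :
    T.Ψ₄ (ppMetric f) x = T.phase x ^ 2 * conj (f₂ x) / (2 * T.scale x ^ 2) := by
  have hb0 : cconj T.m x 0 = T.phase x / 2 := by simp [cconj, hs.m0]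
  have hb1 : cconj T.m x 1 = Complex.I * T.phase x / 2 := by simp [cconj, hs.mbar1]
  have hb2 : cconj T.m x 2 = 0 := by simp [cconj, hs.m2]
  have hl2 : toC T.l x 2 = 1 / T.scale x := hs.l2
  rw [Ψ₄, riemann_contract f x (cconj T.m x) (toC T.l x) hb2, hf.pd_pd0 hU hx, hf.pd_pd0 hU hx,
    hf.pd_pd1 hU hx, hf.pd_pd1 hU hx, hb0, hb1, hl2]
  have hne := hs.scale_ne
  have h1 : conj (f₂ x) = (f₂ x).re - (f₂ x).im * Complex.I := by
    apply Complex.ext <;> simp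
  rw [h1]
  simp [dform_apply, zeta]
  field_simp
  ring_nf
  simp only [Complex.I_sq]
  ring

end Tetrad
end PPWave
end

noncomputable section

namespace PPWave

/-! ## A common form of the four classes -/

/-- Profiles `w(u) F(ζ) + G(u) ζ` with `F'' = exp Ψ`, where `1 / Ψ'` is the affine function
`τ = t ζ + τ₀`. -/
structure AffineProfile (W : Set ℂ) (I : Set ℝ) where
  (F F₁ Ψ : ℂ → ℂ)
  (t τ₀ c : ℂ)
  (w ρ : ℝ → ℝ)
  G : ℝ → ℂ
  hF : ∀ ζ ∈ W, HasDerivAt F (F₁ ζ) ζ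
  hF₁ : ∀ ζ ∈ W, HasDerivAt F₁ (Complex.exp (Ψ ζ)) ζ
  hΨ : ∀ ζ ∈ W, HasDerivAt Ψ (t * ζ + τ₀)⁻¹ ζ
  hτ : ∀ ζ ∈ W, t * ζ + τ₀ ≠ 0
  -- Both sides have derivative (1 + t) exp Ψ; demanding equality fixes the integration constant,
  -- which is what makes G an unambiguous coefficient.
  hF₁τ : ∀ ζ ∈ W, (1 + t) * F₁ ζ = (t * ζ + τ₀) * Complex.exp (Ψ ζ)
  -- The next two fields say that -4 t̄ - 1, the future value of A, has modulus one, and choose a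
  -- square root c of it.
  hc : c * conj c = 1
  hct : c ^ 2 = -4 * conj t - 1
  hG : ContDiffOn ℝ ∞ G I
  hw : (∀ u, w u = 1 ∧ ρ u = 0) ∨ (c.im = 0 ∧ (0 : ℝ) ∉ I ∧ ∀ u, w u = (u ^ 2)⁻¹ ∧ ρ u = -2 / u)

namespace AffineProfile

variable {W : Set ℂ} {I : Set ℝ} (P : AffineProfile W I)

/-- The profile itself. -/
def f (ζ : ℂ) (u : ℝ) : ℂ := P.w u * P.F ζ + P.G u * ζ

/-- The function `1 / Ψ'`. -/
def τ (x : Pt) : ℂ := P.t * zeta x + P.τ₀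

theorem τ_ne {x : Pt} (hx : x ∈ spacetime W I) : P.τ x ≠ 0 := P.hτ _ hx.1

theorem w_pos {u : ℝ} (hu : u ∈ I) : 0 < P.w u := by
  rcases P.hw with h | ⟨-, h0, h⟩
  · rw [(h u).1]; exact one_pos
  · have : u ≠ 0 := fun h => h0 (h ▸ hu)
    rw [(h u).1]; positivity

theorem hasDerivAt_w {u : ℝ} (hu : u ∈ I) : HasDerivAt P.w (P.ρ u * P.w u) u := by
  rcases P.hw with h | ⟨-, h0, h⟩
  · have : P.w = fun _ => 1 := funext fun u => (h u).1
    rw [(h u).2, this, zero_mul]; exact hasDerivAt_const _ _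
  · have hu0 : u ≠ 0 := fun h => h0 (h ▸ hu)
    have : P.w = fun u => (u ^ 2)⁻¹ := funext fun u => (h u).1
    rw [(h u).2, this]
    refine ((hasDerivAt_pow 2 u).fun_inv (by positivity)).congr_deriv ?_
    push_cast
    field_simp

theorem hasDerivAt_ρ {u : ℝ} (hu : u ∈ I) : HasDerivAt P.ρ (P.ρ u ^ 2 / 2) u := by
  rcases P.hw with h | ⟨-, h0, h⟩
  · have : P.ρ = fun _ => 0 := funext fun u => (h u).2
    rw [this]; simpa using hasDerivAt_const u (0 : ℝ)
  · have hu0 : u ≠ 0 := fun h => h0 (h ▸ hu)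
    have : P.ρ = fun u => -2 * u⁻¹ := funext fun u => by rw [(h u).2]; ring
    rw [this]
    refine ((hasDerivAt_inv hu0).const_mul (-2)).congr_deriv ?_
    field_simp

/-- A u-dependent weight is allowed only for real c; then |c| = 1 gives c² = 1 and so t = -1/2.
Identities containing ρ are checked in these two cases. -/
theorem ρ_cases (u : ℝ) : P.ρ u = 0 ∨ (conj P.c = P.c ∧ P.c ^ 2 = 1 ∧ P.t = -1 / 2) := by
  rcases P.hw with h | ⟨h0, -⟩
  · exact Or.inl (h u).2
  · right
    have h1 : conj P.c = P.c := Complex.conj_eq_iff_im.2 h0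
    have h2 : P.c ^ 2 = 1 := by have := P.hc; rw [h1] at this; rw [sq, this]
    refine ⟨h1, h2, ?_⟩
    have h3 := congrArg conj P.hct
    rw [map_pow, h1, h2] at h3
    simp at h3
    linear_combination h3 / 4

/-- Otherwise c² = 3, against |c| = 1. This is also the statement A ≠ 3, since 3 - A = 4 (1 + t̄).
-/
theorem one_add_t_ne : 1 + conj P.t ≠ 0 := by
  intro h
  have h1 : P.c ^ 2 = 3 := by rw [P.hct]; linear_combination -4 * h
  have h2 := congrArg norm P.hc
  have h3 := congrArg norm h1
  simp at h2 h3
  rw [← sq] at h2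
  rw [h2] at h3
  norm_num at h3

theorem hasD_Ψ {x : Pt} (hx : x ∈ spacetime W I) :
    HasD (fun y => P.Ψ (zeta y)) (P.τ x)⁻¹ 0 0 x :=
  (HasD.comp (P.hΨ _ hx.1) HasD.zeta).congr' (by simp [τ]) (by simp) (by simp)

theorem hasD_τ (x : Pt) : HasD P.τ P.t 0 0 x :=
  (((HasD.const P.t).mul HasD.zeta).add (HasD.const P.τ₀)).congr' (by simp) (by simp) (by simp)

theorem hasD_w {x : Pt} (hx : x ∈ spacetime W I) :
    HasD (fun y => (P.w (y 2) : ℂ)) 0 0 (P.ρ (x 2) * P.w (x 2)) x := by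
  have := HasD.ofCoord (k := fun u => (P.w u : ℂ)) (P.hasDerivAt_w hx.2).ofReal_comp
  simpa using this

theorem hasD_ρ {x : Pt} (hx : x ∈ spacetime W I) :
    HasD (fun y => (P.ρ (y 2) : ℂ)) 0 0 ((P.ρ (x 2) : ℂ) ^ 2 / 2) x := by
  have := HasD.ofCoord (k := fun u => (P.ρ u : ℂ)) (P.hasDerivAt_ρ hx.2).ofReal_comp
  simpa using this

theorem hasD_G (hI : IsOpen I) {x : Pt} (hx : x ∈ spacetime W I) :
    HasD (fun y => P.G (y 2)) 0 0 (deriv P.G (x 2)) x :=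
  HasD.ofCoord (((P.hG.contDiffAt (hI.mem_nhds hx.2)).differentiableAt (by simp)).hasDerivAt)

/-- `∂f/∂ζ`. -/
def f₁ (x : Pt) : ℂ := P.w (x 2) * P.F₁ (zeta x) + P.G (x 2)

/-- `∂²f/∂ζ²`. -/
def f₂ (x : Pt) : ℂ := P.w (x 2) * Complex.exp (P.Ψ (zeta x))

theorem hasJet (hI : IsOpen I) : HasJet P.f (spacetime W I) P.f₁ P.f₂
    (fun x => P.ρ (x 2) * P.w (x 2) * P.F (zeta x) + deriv P.G (x 2) * zeta x)
    (fun x => P.ρ (x 2) * P.w (x 2) * P.F₁ (zeta x) + deriv P.G (x 2)) where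
  d x hx := (((P.hasD_w hx).mul (HasD.comp (P.hF _ hx.1) HasD.zeta)).add
    ((P.hasD_G hI hx).mul HasD.zeta)).congr' (by simp [f₁]) (by simp) (by simp)
  d₁ x hx := (((P.hasD_w hx).mul (HasD.comp (P.hF₁ _ hx.1) HasD.zeta)).add
    (P.hasD_G hI hx)).congr' (by simp [f₂]) (by simp) (by simp)

theorem hasD_f₂ {x : Pt} (hx : x ∈ spacetime W I) :
    HasD P.f₂ (P.f₂ x / P.τ x) 0 (P.ρ (x 2) * P.f₂ x) x :=
  ((P.hasD_w hx).mul (P.hasD_Ψ hx).exp).congr' (by simp [f₂]; ring) (by simp)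
    (by simp [f₂]; ring)

end AffineProfile

/-- Phase and scale are known only through their squares; this recovers their differentials without
choosing a sign. -/
theorem HasD.of_mul_self {φ : Pt → ℂ} {a b c : ℂ} {x : Pt} (h : DifferentiableAt ℝ φ x)
    (h0 : φ x ≠ 0)
    (h2 : HasD (fun y => φ y * φ y) (2 * φ x * a) (2 * φ x * b) (2 * φ x * c) x) :
    HasD φ a b c x := by
  have h1 := h.hasFDerivAt
  have h3 := (HasFDerivAt.mul h1 h1).unique h2
  refine h1.congr_fderiv (ContinuousLinearMap.ext fun y => ?_)
  have := congrArg (fun D : Pt →L[ℝ] ℂ => D y) h3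
  simp [dform_apply] at this ⊢
  refine mul_left_cancel₀ h0 ?_
  linear_combination this / 2

theorem HasD.congr_on {φ ψ : Pt → ℂ} {a b c : ℂ} {x : Pt} {U : Set Pt} (hU : IsOpen U)
    (h : HasD ψ a b c x) (hx : x ∈ U) (he : ∀ y ∈ U, φ y = ψ y) : HasD φ a b c x :=
  HasFDerivAt.congr_of_eventuallyEq h (Filter.eventually_of_mem (hU.mem_nhds hx) he)

/-! ## The invariants of a normalized tetrad -/

namespace AffineProfile

variable {W : Set ℂ} {I : Set ℝ} (P : AffineProfile W I)

/-- The consequences of the normalization for phase, scale and shift of a tetrad. -/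
structure Adapted (T : Tetrad) (x : Pt) : Prop where
  shape : T.Shape x
  hasD_phase : HasD T.phase (T.phase x / (4 * P.τ x)) (-T.phase x / (4 * conj (P.τ x))) 0 x
  hasD_scale : HasD T.scale (T.scale x / (4 * P.τ x)) (T.scale x / (4 * conj (P.τ x)))
    (P.ρ (x 2) * T.scale x / 2) x
  psi4 : T.phase x ^ 2 * (P.w (x 2) * conj (Complex.exp (P.Ψ (zeta x)))) = 2 * T.scale x ^ 2

variable {P} {T : Tetrad}

/-- Splits Ψ₄ = 1 into s² = (w/2) exp(Re Ψ) and λ² = exp(i Im Ψ). The condition γ = 0 is not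
assumed, so that the lemma can serve to compute γ for the standard tetrad. -/
theorem adapted_of_psi4 (hW : IsOpen W) (hI : IsOpen I)
    (hm : ContDiffOn ℝ ∞ T.m (spacetime W I)) (hk : ContDiffOn ℝ ∞ T.k (spacetime W I))
    (hs : ∀ y ∈ spacetime W I, T.Shape y)
    (hΨ₄ : ∀ y ∈ spacetime W I, T.Ψ₄ (ppMetric P.f) y = 1) {x : Pt} (hx : x ∈ spacetime W I) :
    P.Adapted T x := by
  have hU := isOpen_spacetime hW hI
  have h4 : ∀ y ∈ spacetime W I,
      T.phase y ^ 2 * (P.w (y 2) * conj (Complex.exp (P.Ψ (zeta y)))) = 2 * T.scale y ^ 2 := by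
    intro y hy
    have := Tetrad.psi4_eq (P.hasJet hI) hU (hs y hy) hy
    rw [hΨ₄ y hy] at this
    have hne := (hs y hy).scale_ne
    rw [eq_div_iff (mul_ne_zero two_ne_zero (pow_ne_zero 2 hne))] at this
    rw [← one_mul (2 * T.scale y ^ 2), this, f₂]
    simp
  have hsq : ∀ y ∈ spacetime W I, T.scale y * T.scale y =
      P.w (y 2) / 2 * Complex.exp ((P.Ψ (zeta y) + conj (P.Ψ (zeta y))) / 2) := by
    intro y hy
    have h1 := congrArg norm (h4 y hy)
    have hn : ‖T.phase y‖ = 1 := by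
      have := congrArg norm (hs y hy).phase_mul
      simp at this
      nlinarith [norm_nonneg (T.phase y)]
    have hw := P.w_pos hy.2
    simp [hn, Tetrad.scale, Complex.norm_exp, abs_of_pos hw] at h1
    have h2 : (P.Ψ (zeta y) + conj (P.Ψ (zeta y))) / 2 = ((P.Ψ (zeta y)).re : ℂ) := by
      rw [Complex.add_conj]; push_cast; ring
    rw [h2, ← Complex.ofReal_exp, Tetrad.scale]
    have h3 : (T.k y 3) * (T.k y 3) = P.w (y 2) / 2 * Real.exp (P.Ψ (zeta y)).re := by
      linarith
    exact_mod_cast h3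
  have hpq : ∀ y ∈ spacetime W I, T.phase y * T.phase y =
      Complex.exp ((P.Ψ (zeta y) - conj (P.Ψ (zeta y))) / 2) := by
    intro y hy
    have hw : (P.w (y 2) : ℂ) ≠ 0 := by exact_mod_cast (P.w_pos hy.2).ne'
    have h1 := h4 y hy
    rw [sq (T.scale y), hsq y hy, ← Complex.exp_conj] at h1
    have h2 : (P.Ψ (zeta y) + conj (P.Ψ (zeta y))) / 2
      = (P.Ψ (zeta y) - conj (P.Ψ (zeta y))) / 2 + conj (P.Ψ (zeta y)) := by ring
    rw [h2, Complex.exp_add] at h1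
    have h3 := Complex.exp_ne_zero (conj (P.Ψ (zeta y)))
    have h5 : (P.w (y 2) : ℂ) * Complex.exp (conj (P.Ψ (zeta y))) ≠ 0 := mul_ne_zero hw h3
    apply mul_right_cancel₀ h5
    linear_combination h1
  have dm := hm.contDiffAt (hU.mem_nhds hx) |>.differentiableAt (by simp)
  have dk := hk.contDiffAt (hU.mem_nhds hx) |>.differentiableAt (by simp)
  have dphase : DifferentiableAt ℝ T.phase x := by
    have := (differentiableAt_pi.1 dm 0)
    exact (Complex.conjCLE.differentiableAt.comp x this).const_mul 2
  have dscale : DifferentiableAt ℝ T.scale x :=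
    Complex.ofRealCLM.differentiableAt.comp x (differentiableAt_pi.1 dk 3)
  have hp0 : T.phase x ≠ 0 := fun h => by
    have := (hs x hx).phase_mul; rw [h] at this; simp at this
  have hτ := P.τ_ne hx
  have hτ' : conj (P.τ x) ≠ 0 := by simpa using hτ
  have hΨ := P.hasD_Ψ hx
  refine ⟨hs x hx, HasD.of_mul_self dphase hp0 ?_, HasD.of_mul_self dscale (hs x hx).scale_ne ?_,
    h4 x hx⟩
  · have h1 := (((hΨ.sub hΨ.conjugate).mul (HasD.const (1 / 2))).exp)
    refine (h1.congr_on hU hx (fun y hy => ?_)).congr' ?_ ?_ ?_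
    · rw [hpq y hy]; congr 1; ring
    · rw [← mul_div_assoc, mul_one, ← hpq x hx]; simp; field_simp; norm_num
    · rw [← mul_div_assoc, mul_one, ← hpq x hx]; simp; field_simp; norm_num
    · simp
  · have h1 := ((P.hasD_w hx).mul (((hΨ.add hΨ.conjugate).mul (HasD.const (1 / 2))).exp)).mul
      (HasD.const (1 / 2))
    have h2 := hsq x hx
    refine (h1.congr_on hU hx (fun y hy => ?_)).congr' ?_ ?_ ?_
    · rw [hsq y hy]; ring_nf
    · rw [← mul_div_assoc, mul_one]; simp
      field_simp
      linear_combination -8 * h2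
    · rw [← mul_div_assoc, mul_one]; simp
      field_simp
      linear_combination -8 * h2
    · rw [← mul_div_assoc, mul_one]; simp
      rw [← div_eq_mul_inv]
      linear_combination (-P.ρ (x 2)) * h2

theorem adapted (hW : IsOpen W) (hI : IsOpen I)
    (hT : T.IsNormalized (ppMetric P.f) (spacetime W I)) {x : Pt} (hx : x ∈ spacetime W I) :
    P.Adapted T x :=
  adapted_of_psi4 hW hI hT.smooth_m hT.smooth_k (fun _ hy => hT.shape hy) hT.psi4 hx

section

variable (hW : IsOpen W) (hI : IsOpen I) (hA : ∀ x ∈ spacetime W I, P.Adapted T x)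
include hW hI hA

/-- The rotation form and the boost form contribute equally along m̄. -/
theorem α_eq {x : Pt} (hx : x ∈ spacetime W I) :
    T.α (ppMetric P.f) x = T.phase x / (4 * conj (P.τ x)) := by
  have hU := isOpen_spacetime hW hI
  have hs := fun y hy => (hA y hy).shape
  have h := hA x hx
  rw [Tetrad.α, Tetrad.conn01 hU hs hx h.hasD_phase, Tetrad.conn23 hU hs hx,
    h.shape.along_mbar h.hasD_phase, h.shape.along_mbar h.hasD_scale]
  have h1 := h.shape.phase_mul
  have hτ' : conj (P.τ x) ≠ 0 := by simpa using P.τ_ne hx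
  have := h.shape.scale_ne
  field_simp
  linear_combination T.phase x * h1

/-- Along l the terms in q of the two forms cancel and those in q̄ add, so γ = 0 is a linear
equation for the shift. -/
theorem γ_eq {x : Pt} (hx : x ∈ spacetime W I) :
    T.γ (ppMetric P.f) x
      = (conj (T.shift x) + P.ρ (x 2) * conj (P.τ x)) / (4 * T.scale x * conj (P.τ x)) := by
  have hU := isOpen_spacetime hW hI
  have hs := fun y hy => (hA y hy).shape
  have h := hA x hx
  rw [Tetrad.γ, Tetrad.conn01 hU hs hx h.hasD_phase, Tetrad.conn23 hU hs hx,
    h.shape.along_l h.hasD_phase, h.shape.along_l h.hasD_scale]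
  have h1 := h.shape.phase_mul
  have hτ := P.τ_ne hx
  have hτ' : conj (P.τ x) ≠ 0 := by simpa using P.τ_ne hx
  have := h.shape.scale_ne
  field_simp
  linear_combination (-2 * (T.shift x * conj (P.τ x) - conj (T.shift x) * P.τ x)) * h1

end

end AffineProfile
end PPWave
end

/-! ### Closed formulas for the invariants, and the wedge condition -/

noncomputable section

namespace PPWave

/-- Applied below with a dζ + b dζ̄ equal to θ = c̄ dζ/τ + c dζ̄/τ̄. -/
theorem WedgeZero.of_hasD {U : Set Pt} {φ ψ : Pt → ℂ}
    (h : ∀ x ∈ U, ∃ p q a b, HasD φ (p * a) (p * b) 0 x ∧ HasD ψ (q * a) (q * b) 0 x) :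
    WedgeZero U φ ψ := by
  intro x hx X Y
  obtain ⟨p, q, a, b, h1, h2⟩ := h x hx
  rw [HasFDerivAt.fderiv h1, HasFDerivAt.fderiv h2]
  simp only [dform_apply]
  ring

namespace AffineProfile

variable {W : Set ℂ} {I : Set ℝ} {P : AffineProfile W I} {T : Tetrad}

section

variable (hW : IsOpen W) (hI : IsOpen I) (hT : T.IsNormalized (ppMetric P.f) (spacetime W I))
include hW hI hT

theorem shift_eq {x : Pt} (hx : x ∈ spacetime W I) : T.shift x = -P.ρ (x 2) * P.τ x := by
  have hA := fun y hy => P.adapted hW hI hT (x := y) hy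
  have h := γ_eq hW hI hA hx
  rw [hT.gamma x hx] at h
  have hτ' : conj (P.τ x) ≠ 0 := by simpa using P.τ_ne hx
  have h2 : 4 * T.scale x * conj (P.τ x) ≠ 0 :=
    mul_ne_zero (mul_ne_zero (by norm_num : (4 : ℂ) ≠ 0) (hA x hx).shape.scale_ne) hτ'
  rw [eq_comm, div_eq_zero_iff, or_iff_left h2] at h
  have := congrArg conj h
  simp at this
  linear_combination this

theorem hasD_shift {x : Pt} (hx : x ∈ spacetime W I) :
    HasD T.shift (-P.ρ (x 2) * P.t) 0 (-(P.ρ (x 2) : ℂ) ^ 2 / 2 * P.τ x) x :=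
  (((P.hasD_ρ hx).neg.mul (P.hasD_τ x)).congr_on (isOpen_spacetime hW hI) hx
    (fun _ hy => shift_eq hW hI hT hy)).congr' (by simp) (by simp) (by simp; ring)

theorem phase_ne {x : Pt} (hx : x ∈ spacetime W I) : T.phase x ≠ 0 := fun h => by
  have := (P.adapted hW hI hT hx).shape.phase_mul
  rw [h] at this; simp at this

theorem α_eq' {x : Pt} (hx : x ∈ spacetime W I) :
    T.α (ppMetric P.f) x = T.phase x / (4 * conj (P.τ x)) :=
  α_eq hW hI (fun y hy => P.adapted hW hI hT (x := y) hy) hx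

theorem α_ne {x : Pt} (hx : x ∈ spacetime W I) : T.α (ppMetric P.f) x ≠ 0 := by
  have hτ' : conj (P.τ x) ≠ 0 := by simpa using P.τ_ne hx
  rw [α_eq' hW hI hT hx]
  exact div_ne_zero (phase_ne hW hI hT hx) (mul_ne_zero (by norm_num : (4 : ℂ) ≠ 0) hτ')

/-- dα = (α c/4) θ: the ζ-coefficient uses c c̄ = 1, the ζ̄-coefficient uses c² = -4 t̄ - 1. This is
the reason for introducing c. -/
theorem hasD_α {x : Pt} (hx : x ∈ spacetime W I) :
    HasD (T.α (ppMetric P.f)) (T.α (ppMetric P.f) x * P.c / 4 * (conj P.c / P.τ x))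
      (T.α (ppMetric P.f) x * P.c / 4 * (P.c / conj (P.τ x))) 0 x := by
  have hτ := P.τ_ne hx
  have hτ' : conj (P.τ x) ≠ 0 := by simpa using hτ
  have hA := P.adapted hW hI hT hx
  have h4 : (4 : ℂ) * conj (P.τ x) ≠ 0 := mul_ne_zero (by norm_num : (4 : ℂ) ≠ 0) hτ'
  have h1 := hA.hasD_phase.mul (((HasD.const 4).mul (P.hasD_τ x).conjugate).inv h4)
  refine (h1.congr_on (isOpen_spacetime hW hI) hx
    (fun y hy => by rw [α_eq' hW hI hT hy, div_eq_mul_inv])).congr' ?_ ?_ ?_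
  · rw [α_eq' hW hI hT hx]; simp; field_simp
    linear_combination (-T.phase x) * P.hc
  · rw [α_eq' hW hI hT hx]; simp; field_simp
    linear_combination (-T.phase x) * P.hct
  · simp

theorem A_eq {x : Pt} (hx : x ∈ spacetime W I) : T.A (ppMetric P.f) x = P.c ^ 2 := by
  have hA := P.adapted hW hI hT hx
  have hτ' : conj (P.τ x) ≠ 0 := by simpa using P.τ_ne hx
  have hp := phase_ne hW hI hT hx
  rw [Tetrad.A, Tetrad.δs, hA.shape.along_mbar (hasD_α hW hI hT hx), α_eq' hW hI hT hx]
  field_simp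

theorem μ_eq {x : Pt} (hx : x ∈ spacetime W I) :
    T.μ (ppMetric P.f) x = -P.ρ (x 2) * P.t / T.scale x := by
  have hU := isOpen_spacetime hW hI
  have hA := fun y hy => P.adapted hW hI hT (x := y) hy
  have h := hA x hx
  rw [Tetrad.μ, Tetrad.conn12 (P.hasJet hI) hU (fun y hy => (hA y hy).shape) hx
    (hasD_shift hW hI hT hx) h.hasD_scale, h.shape.along_m (hasD_shift hW hI hT hx), h.shape.m2]
  linear_combination (-P.ρ (x 2) * P.t / T.scale x) * h.shape.phase_mul

theorem ν_eq {x : Pt} (hx : x ∈ spacetime W I) :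
    T.ν (ppMetric P.f) x = T.phase x / T.scale x ^ 2 *
      ((P.ρ (x 2) : ℂ) ^ 2 * P.τ x * (P.t - 1 / 2) + conj (P.f₁ x) / 2) := by
  have hU := isOpen_spacetime hW hI
  have hA := fun y hy => P.adapted hW hI hT (x := y) hy
  have h := hA x hx
  have hl2 : toC T.l x 2 = 1 / T.scale x := h.shape.l2
  rw [Tetrad.ν, Tetrad.conn12 (P.hasJet hI) hU (fun y hy => (hA y hy).shape) hx
    (hasD_shift hW hI hT hx) h.hasD_scale, h.shape.along_l (hasD_shift hW hI hT hx), hl2,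
    shift_eq hW hI hT hx]
  ring

/-- The du part cancels because ρ' = ρ²/2 while s grows in u at logarithmic rate ρ/2. -/
theorem hasD_μ {x : Pt} (hx : x ∈ spacetime W I) :
    HasD (T.μ (ppMetric P.f)) (-T.μ (ppMetric P.f) x / 4 / P.τ x)
      (-T.μ (ppMetric P.f) x / 4 / conj (P.τ x)) 0 x := by
  have hA := P.adapted hW hI hT hx
  have hs := hA.shape.scale_ne
  have h1 := (((P.hasD_ρ hx).neg).mul (HasD.const P.t)).mul (hA.hasD_scale.inv hs)
  refine (h1.congr_on (isOpen_spacetime hW hI) hx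
    (fun y hy => by rw [μ_eq hW hI hT hy, div_eq_mul_inv])).congr' ?_ ?_ ?_
  · rw [μ_eq hW hI hT hx]; simp; field_simp
  · rw [μ_eq hW hI hT hx]; simp; field_simp
  · simp; field_simp; ring

theorem μ_cases {x : Pt} (hx : x ∈ spacetime W I) : T.μ (ppMetric P.f) x = 0 ∨
    (conj P.c = P.c ∧ P.c ^ 2 = 1 ∧ P.t = -1 / 2) := by
  rcases P.ρ_cases (x 2) with h | h
  · left; rw [μ_eq hW hI hT hx, h]; simp
  · exact Or.inr h

theorem Δμ_eq {x : Pt} (hx : x ∈ spacetime W I) :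
    T.Δ (T.μ (ppMetric P.f)) x = T.μ (ppMetric P.f) x ^ 2 := by
  have hA := P.adapted hW hI hT hx
  have hs := hA.shape.scale_ne
  have hτ := P.τ_ne hx
  have hτ' : conj (P.τ x) ≠ 0 := by simpa using hτ
  rw [Tetrad.Δ, hA.shape.along_l (hasD_μ hW hI hT hx), shift_eq hW hI hT hx, μ_eq hW hI hT hx]
  rcases P.ρ_cases (x 2) with h | ⟨-, -, h⟩
  · rw [h]; simp
  · rw [h]; simp; field_simp; ring

theorem B_eq {x : Pt} (hx : x ∈ spacetime W I) : T.B (ppMetric P.f) x = 0 := by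
  rw [Tetrad.B, A_eq hW hI hT hx, μ_eq hW hI hT hx]
  rcases P.ρ_cases (x 2) with h | ⟨-, h1, h⟩
  · rw [h]; simp
  · rw [h, h1]; simp [Tetrad.conj_scale]

/-- Squaring removes the sign ambiguity: λ²/s² is given by Ψ₄ = 1. -/
theorem M_sq {x : Pt} (hx : x ∈ spacetime W I) : T.M (ppMetric P.f) x ^ 2 =
    (P.ρ (x 2) : ℂ) ^ 2 * P.t ^ 2 / (8 * (P.w (x 2) * conj (P.τ x ^ 2 * Complex.exp (P.Ψ (zeta x))))) := by
  have hA := P.adapted hW hI hT hx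
  have hs := hA.shape.scale_ne
  have hp := phase_ne hW hI hT hx
  have hτ' : conj (P.τ x) ≠ 0 := by simpa using P.τ_ne hx
  have hw : (P.w (x 2) : ℂ) ≠ 0 := by exact_mod_cast (P.w_pos hx.2).ne'
  have he : conj (Complex.exp (P.Ψ (zeta x))) ≠ 0 := by simp
  rw [Tetrad.M, α_eq' hW hI hT hx, μ_eq hW hI hT hx, map_mul, map_pow]
  have h4 := hA.psi4
  rw [mul_pow, div_pow, div_pow, div_mul_div_comm, div_eq_div_iff]
  · linear_combination (8 * P.ρ (x 2) ^ 2 * P.t ^ 2 * conj (P.τ x) ^ 2) * h4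
  · exact mul_ne_zero (pow_ne_zero 2 (mul_ne_zero (by norm_num : (4 : ℂ) ≠ 0) hτ')) (pow_ne_zero 2 hs)
  · exact mul_ne_zero (by norm_num) (mul_ne_zero hw (mul_ne_zero (pow_ne_zero 2 hτ') he))

/-- In (3 - A) ν the F₁ part equals 1/α by `hF₁τ` and Ψ₄ = 1, and the ρ² terms cancel against Δμ +
μ² when t = -1/2; only the contribution of G survives. -/
theorem Y_eq {x : Pt} (hx : x ∈ spacetime W I) : T.Y (ppMetric P.f) x =
    2 * (1 + conj P.t) * T.phase x * conj (P.G (x 2)) / T.scale x ^ 2 := by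
  have hA := P.adapted hW hI hT hx
  have hs := hA.shape.scale_ne
  have hp := phase_ne hW hI hT hx
  have hτ := P.τ_ne hx
  have hτ' : conj (P.τ x) ≠ 0 := by simpa using hτ
  have h4 := hA.psi4
  have hF := congrArg conj (P.hF₁τ _ hx.1)
  have hpc : conj (T.phase x) = (T.phase x)⁻¹ := eq_inv_of_mul_eq_one_left hA.shape.phase_mul
  have hρ : (P.ρ (x 2) : ℂ) ^ 2 * ((1 + conj P.t) * (P.t - 1 / 2) + 2 * P.t ^ 2) = 0 := by
    rcases P.ρ_cases (x 2) with h | ⟨-, -, h⟩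
    · rw [h]; simp
    · rw [h]; simp; right; norm_num
  have hτdef : conj (P.τ x) = conj (P.t * zeta x + P.τ₀) := rfl
  rw [map_mul, map_mul, ← hτdef] at hF
  simp only [map_add, map_one] at hF
  rw [Tetrad.Y, A_eq hW hI hT hx, Δμ_eq hW hI hT hx, ν_eq hW hI hT hx, α_eq' hW hI hT hx,
    μ_eq hW hI hT hx, P.hct, f₁]
  simp only [map_div₀, map_mul, Complex.conj_conj, hpc, map_add, Complex.conj_ofReal]
  rw [conj_four]
  field_simp
  linear_combination (P.w (x 2) * T.phase x ^ 2) * hF * 4 + 4 * conj (P.τ x) * h4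
    + 8 * T.phase x ^ 2 * P.τ x * hρ

theorem hasD_Y {x : Pt} (hx : x ∈ spacetime W I) : ∃ e,
    HasD (T.Y (ppMetric P.f)) (-T.Y (ppMetric P.f) x / (4 * P.τ x))
      (-3 * T.Y (ppMetric P.f) x / (4 * conj (P.τ x))) e x := by
  have hA := P.adapted hW hI hT hx
  have hs := hA.shape.scale_ne
  have hτ := P.τ_ne hx
  have hτ' : conj (P.τ x) ≠ 0 := by simpa using hτ
  have h1 := ((((HasD.const (2 * (1 + conj P.t))).mul hA.hasD_phase).mul
    (P.hasD_G hI hx).conjugate).mul ((hA.hasD_scale.mul hA.hasD_scale).inv (mul_ne_zero hs hs)))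
  refine ⟨_, (h1.congr_on (isOpen_spacetime hW hI) hx
    (fun y hy => by rw [Y_eq hW hI hT hy, div_eq_mul_inv, sq])).congr' ?_ ?_ rfl⟩
  · rw [Y_eq hW hI hT hx]; simp; field_simp; ring
  · rw [Y_eq hW hI hT hx]; simp; field_simp; ring

/-- The definition of Y solved for ν. It isolates Y as the only term whose differential can leave
the span of θ. -/
theorem ν_eq_Y {x : Pt} (hx : x ∈ spacetime W I) : T.ν (ppMetric P.f) x =
    (4 * (1 + conj P.t))⁻¹ * (T.Y (ppMetric P.f) x + (T.α (ppMetric P.f) x)⁻¹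
      - 2 * (T.μ (ppMetric P.f) x * T.μ (ppMetric P.f) x)
        * (conj (T.α (ppMetric P.f) x))⁻¹) := by
  have h := P.one_add_t_ne
  rw [Tetrad.Y, A_eq hW hI hT hx, Δμ_eq hW hI hT hx, P.hct]
  field_simp
  ring

theorem hasD_ν {x : Pt} (hx : x ∈ spacetime W I) : ∃ n e,
    HasD (T.ν (ppMetric P.f))
      ((4 * (1 + conj P.t))⁻¹ * (-T.Y (ppMetric P.f) x / (4 * P.τ x)) + n * (conj P.c / P.τ x))
      ((4 * (1 + conj P.t))⁻¹ * (-3 * T.Y (ppMetric P.f) x / (4 * conj (P.τ x)))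
        + n * (P.c / conj (P.τ x))) ((4 * (1 + conj P.t))⁻¹ * e) x ∧
    (HasD (T.Y (ppMetric P.f)) (-T.Y (ppMetric P.f) x / (4 * P.τ x))
      (-3 * T.Y (ppMetric P.f) x / (4 * conj (P.τ x))) e x) := by
  obtain ⟨e, hY⟩ := hasD_Y hW hI hT hx
  have hα := hasD_α hW hI hT hx
  have hα0 := α_ne hW hI hT hx
  have hα0' : conj (T.α (ppMetric P.f) x) ≠ 0 := by simpa using hα0
  have hμ := hasD_μ hW hI hT hx
  have h1 := (HasD.const (4 * (1 + conj P.t))⁻¹).mul ((hY.add (hα.inv hα0)).sub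
    (((HasD.const 2).mul (hμ.mul hμ)).mul (hα.conjugate.inv hα0')))
  have hτ := P.τ_ne hx
  have hτ' : conj (P.τ x) ≠ 0 := by simpa using hτ
  have ht := P.one_add_t_ne
  have hc' := P.hc
  -- The θ-coefficient of the differential of 1/α - 2μ²/ᾱ: the three terms come from α, μ and ᾱ,
  -- with dμ = -(μ c/4) θ.
  refine ⟨(4 * (1 + conj P.t))⁻¹ * (-(P.c / 4) / T.α (ppMetric P.f) x +
    (T.μ (ppMetric P.f) x) ^ 2 * P.c / conj (T.α (ppMetric P.f) x) +
    (T.μ (ppMetric P.f) x) ^ 2 * conj P.c / (2 * conj (T.α (ppMetric P.f) x))), e,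
    (h1.congr_on (isOpen_spacetime hW hI) hx (fun y hy => ν_eq_Y hW hI hT hy)).congr' ?_ ?_ ?_, hY⟩
  · rcases μ_cases hW hI hT hx with h | ⟨h, h2, -⟩
    · simp [h]; field_simp
    · simp [h]; field_simp
      linear_combination (-8 * T.μ (ppMetric P.f) x ^ 2 * T.α (ppMetric P.f) x) * h2
  · rcases μ_cases hW hI hT hx with h | ⟨h, h2, -⟩
    · simp [h]; field_simp
    · simp [h]; field_simp
      linear_combination (-8 * T.μ (ppMetric P.f) x ^ 2 * T.α (ppMetric P.f) x) * h2
  · simp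

/-- Evaluating on a vector in the kernel of θ reduces dα ∧ dν = 0 to Y (3 c̄ - c) = 0, and 3 c̄ ≠ c
since c ≠ 0. -/
theorem Y_eq_zero_of_wedge
    (h : WedgeZero (spacetime W I) (T.α (ppMetric P.f)) (T.ν (ppMetric P.f)))
    {x : Pt} (hx : x ∈ spacetime W I) : T.Y (ppMetric P.f) x = 0 := by
  obtain ⟨n, e, hν, -⟩ := hasD_ν hW hI hT hx
  have hα := hasD_α hW hI hT hx
  have hα0 := α_ne hW hI hT hx
  have hτ := P.τ_ne hx
  have hτ' : conj (P.τ x) ≠ 0 := by simpa using hτ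
  have ht := P.one_add_t_ne
  have hc := P.hc
  have hc0 : P.c ≠ 0 := left_ne_zero_of_mul_eq_one hc
  -- The vector X has dζ/τ = i c, hence θ(X) = 0; the vector Y has dζ/τ = c, hence θ(Y) = 2.
  set X : Pt := ![(Complex.I * P.c * P.τ x).re, (Complex.I * P.c * P.τ x).im, 0, 0] with hX
  set Y : Pt := ![(P.c * P.τ x).re, (P.c * P.τ x).im, 0, 0] with hY
  have zX : zeta X = Complex.I * P.c * P.τ x := Complex.re_add_im _
  have zY : zeta Y = P.c * P.τ x := Complex.re_add_im _
  have X2 : X 2 = 0 := rfl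
  have Y2 : Y 2 = 0 := rfl
  have key := h x hx X Y
  rw [HasFDerivAt.fderiv hα, HasFDerivAt.fderiv hν] at key
  simp only [dform_apply, zX, zY, X2, Y2] at key
  simp only [map_mul, Complex.conj_I, Complex.ofReal_zero, mul_zero, add_zero] at key
  have h3 : 3 * conj P.c - P.c ≠ 0 := by
    intro h0
    have h1 : 3 * conj P.c = P.c := by linear_combination h0
    have h2 := congrArg norm h1
    simp at h2
    have := norm_pos_iff.2 hc0
    linarith
  have hk : (T.Y (ppMetric P.f) x) * (T.α (ppMetric P.f) x * P.c * (3 * conj P.c - P.c)) = 0 := by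
    field_simp at key
    linear_combination (Complex.I / 2) * key
      + (T.Y (ppMetric P.f) x * (T.α (ppMetric P.f) x * P.c * (3 * conj P.c - P.c)))
        * (P.c * conj P.c * Complex.I_sq - hc)
  exact (mul_eq_zero.1 hk).resolve_right (mul_ne_zero (mul_ne_zero hα0 hc0) h3)

/-- Without Y every differential is a multiple of θ; for ᾱ this uses that θ is real. -/
theorem count_of_Y_eq_zero (h : ∀ x ∈ spacetime W I, T.Y (ppMetric P.f) x = 0) :
    T.Count011 (ppMetric P.f) (spacetime W I) := by
  refine ⟨fun x hx => α_ne hW hI hT hx, ?_, ?_, ?_, ?_⟩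
  · refine WedgeZero.of_hasD fun x hx => ?_
    have hα := hasD_α hW hI hT hx
    exact ⟨_, conj (T.α (ppMetric P.f) x * P.c / 4), _, _, hα,
      hα.conjugate.congr' (by simp) (by simp) (by simp)⟩
  · refine WedgeZero.of_hasD fun x hx => ?_
    have hα := hasD_α hW hI hT hx
    refine ⟨_, -T.μ (ppMetric P.f) x * P.c / 4, _, _, hα, (hasD_μ hW hI hT hx).congr' ?_ ?_ rfl⟩
    · linear_combination (T.μ (ppMetric P.f) x / 4 / P.τ x) * P.hc
    · rcases μ_cases hW hI hT hx with h | ⟨-, h2, -⟩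
      · simp [h]
      · linear_combination (T.μ (ppMetric P.f) x / 4 / conj (P.τ x)) * h2
  · refine WedgeZero.of_hasD fun x hx => ?_
    exact ⟨_, 0, _, _, hasD_α hW hI hT hx, ((HasD.const (P.c ^ 2)).congr_on
      (isOpen_spacetime hW hI) hx (fun y hy => A_eq hW hI hT hy)).congr' (by simp) (by simp) rfl⟩
  · refine WedgeZero.of_hasD fun x hx => ?_
    obtain ⟨n, e, hν, hY⟩ := hasD_ν hW hI hT hx
    -- The u-derivative e of Y involves G' and was left unspecified; it vanishes because Y is zero
    -- on an open set.
    have he : e = 0 := by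
      have h0 : HasD (T.Y (ppMetric P.f)) 0 0 0 x :=
        (HasD.const 0).congr_on (isOpen_spacetime hW hI) hx h
      rw [← hY.pd2, h0.pd2]
    exact ⟨_, n, _, _, hasD_α hW hI hT hx,
      hν.congr' (by simp [h x hx]) (by simp [h x hx]) (by simp [he])⟩

theorem Y_eq_zero_iff {x : Pt} (hx : x ∈ spacetime W I) :
    T.Y (ppMetric P.f) x = 0 ↔ P.G (x 2) = 0 := by
  rw [Y_eq hW hI hT hx]
  simp [(P.adapted hW hI hT hx).shape.scale_ne, phase_ne hW hI hT hx, P.one_add_t_ne]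

end

end AffineProfile
end PPWave
end

noncomputable section

namespace PPWave

/-! ## Existence of a normalized tetrad -/

theorem contDiff_zeta : ContDiff ℝ ∞ zeta := by
  have : zeta = dzeta := by ext x; rw [dzeta_apply]
  rw [this]; exact dzeta.contDiff

theorem contDiffOn_comp_zeta {W : Set ℂ} (I : Set ℝ) (hW : IsOpen W) {h : ℂ → ℂ}
    (hh : DifferentiableOn ℂ h W) : ContDiffOn ℝ ∞ (fun x => h (zeta x)) (spacetime W I) :=
  ((hh.contDiffOn hW (n := ∞)).restrict_scalars ℝ).comp contDiff_zeta.contDiffOn fun _ hx => hx.1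

theorem contDiffOn_coord {E : Type*} [NormedAddCommGroup E] [NormedSpace ℝ E] (W : Set ℂ)
    {I : Set ℝ} {h : ℝ → E} (hh : ContDiffOn ℝ ∞ h I) :
    ContDiffOn ℝ ∞ (fun x => h (x 2)) (spacetime W I) :=
  hh.comp (contDiff_apply ℝ ℝ (2 : Fin 4)).contDiffOn fun _ hx => hx.2

theorem contDiffOn_ofReal {U : Set Pt} {h : Pt → ℝ} (hh : ContDiffOn ℝ ∞ h U) :
    ContDiffOn ℝ ∞ (fun x => (h x : ℂ)) U :=
  Complex.ofRealCLM.contDiff.comp_contDiffOn hh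

theorem contDiffOn_re {U : Set Pt} {h : Pt → ℂ} (hh : ContDiffOn ℝ ∞ h U) :
    ContDiffOn ℝ ∞ (fun x => (h x).re) U :=
  Complex.reCLM.contDiff.comp_contDiffOn hh

theorem contDiffOn_im {U : Set Pt} {h : Pt → ℂ} (hh : ContDiffOn ℝ ∞ h U) :
    ContDiffOn ℝ ∞ (fun x => (h x).im) U :=
  Complex.imCLM.contDiff.comp_contDiffOn hh

theorem contDiffOn_conj {U : Set Pt} {h : Pt → ℂ} (hh : ContDiffOn ℝ ∞ h U) :
    ContDiffOn ℝ ∞ (fun x => conj (h x)) U :=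
  Complex.conjCLE.toContinuousLinearMap.contDiff.comp_contDiffOn hh

namespace AffineProfile

variable {W : Set ℂ} {I : Set ℝ} (P : AffineProfile W I)

theorem contDiffOn_w : ContDiffOn ℝ ∞ P.w I := by
  rcases P.hw with h | ⟨-, h0, h⟩
  · rw [show P.w = fun _ => 1 from funext fun u => (h u).1]; exact contDiffOn_const
  · rw [show P.w = fun u => (u ^ 2)⁻¹ from funext fun u => (h u).1]
    refine (contDiff_id.pow 2).contDiffOn.inv fun u hu => ?_
    have : u ≠ 0 := fun h => h0 (h ▸ hu)
    simpa using this

theorem contDiffOn_ρ : ContDiffOn ℝ ∞ P.ρ I := by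
  rcases P.hw with h | ⟨-, h0, h⟩
  · rw [show P.ρ = fun _ => 0 from funext fun u => (h u).2]; exact contDiffOn_const
  · rw [show P.ρ = fun u => -2 / u from funext fun u => (h u).2]
    exact contDiffOn_const.div contDiffOn_id fun u hu h => h0 (h ▸ hu)

theorem contDiffOn_Ψ (hW : IsOpen W) :
    ContDiffOn ℝ ∞ (fun x => P.Ψ (zeta x)) (spacetime W I) :=
  contDiffOn_comp_zeta I hW fun ζ hζ => (P.hΨ ζ hζ).differentiableAt.differentiableWithinAt

theorem contDiffOn_f (hW : IsOpen W) :
    ContDiffOn ℝ ∞ (fun x => P.f (zeta x) (x 2)) (spacetime W I) :=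
  ((contDiffOn_ofReal (contDiffOn_coord W P.contDiffOn_w)).mul
    (contDiffOn_comp_zeta I hW fun ζ hζ => (P.hF ζ hζ).differentiableAt.differentiableWithinAt)).add
    ((contDiffOn_coord W P.hG).mul contDiff_zeta.contDiffOn)

theorem contDiffOn_potential (hW : IsOpen W) :
    ContDiffOn ℝ ∞ (potential P.f) (spacetime W I) :=
  contDiffOn_const.mul (contDiffOn_re (P.contDiffOn_f hW))

/-- The phase of the standard tetrad. -/
def phase₀ (x : Pt) : ℂ := Complex.exp ((P.Ψ (zeta x) - conj (P.Ψ (zeta x))) / 4)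

/-- The scale of the standard tetrad. -/
def scale₀ (x : Pt) : ℝ := √(P.w (x 2) / 2) * Real.exp ((P.Ψ (zeta x)).re / 2)

/-- The shift of the standard tetrad. -/
def shift₀ (x : Pt) : ℂ := -P.ρ (x 2) * P.τ x

/-- A normalized tetrad. -/
def tetrad : Tetrad where
  m x := ![conj (P.phase₀ x) / 2, -Complex.I * conj (P.phase₀ x) / 2, 0,
    conj (P.phase₀ x) * conj (P.shift₀ x)]
  l x := ![(P.shift₀ x).re / P.scale₀ x, (P.shift₀ x).im / P.scale₀ x, 1 / P.scale₀ x,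
    -- This component solves ⟨l, l⟩ = 0.
    ((P.shift₀ x).re ^ 2 + (P.shift₀ x).im ^ 2 - potential P.f x / 2) / P.scale₀ x]
  k x := ![0, 0, 0, P.scale₀ x]

theorem scale₀_pos {x : Pt} (hx : x ∈ spacetime W I) : 0 < P.scale₀ x :=
  mul_pos (Real.sqrt_pos.2 (half_pos (P.w_pos hx.2))) (Real.exp_pos _)

theorem conj_phase₀_mul (x : Pt) : conj (P.phase₀ x) * P.phase₀ x = 1 := by
  rw [phase₀, ← Complex.exp_conj, ← Complex.exp_add]
  simp
  ring_nf
  simp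

theorem tetrad_phase : P.tetrad.phase = P.phase₀ := by
  ext x; simp [Tetrad.phase, tetrad]; ring

theorem tetrad_scale (x : Pt) : P.tetrad.scale x = P.scale₀ x := by
  simp [Tetrad.scale, tetrad]

theorem tetrad_shift {x : Pt} (hx : x ∈ spacetime W I) : P.tetrad.shift x = P.shift₀ x := by
  have h0 : (P.scale₀ x : ℂ) ≠ 0 := by exact_mod_cast (P.scale₀_pos hx).ne'
  simp [Tetrad.shift, tetrad]
  field_simp
  rw [mul_comm Complex.I, Complex.re_add_im]

theorem tetrad_shape {x : Pt} (hx : x ∈ spacetime W I) : P.tetrad.Shape x := by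
  have h0 : (P.scale₀ x : ℂ) ≠ 0 := by exact_mod_cast (P.scale₀_pos hx).ne'
  have h1 : ((P.shift₀ x).re : ℂ) + Complex.I * (P.shift₀ x).im = P.shift₀ x := by
    rw [mul_comm Complex.I, Complex.re_add_im]
  have h2 : ((P.shift₀ x).re : ℂ) - Complex.I * (P.shift₀ x).im = conj (P.shift₀ x) := by
    apply Complex.ext <;> simp
  constructor <;> try simp only [tetrad_phase, tetrad_scale, P.tetrad_shift hx]
  · exact P.conj_phase₀_mul x
  · exact h0
  · simp [tetrad]
  · simp [tetrad]
  · simp [tetrad]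
  · simp [tetrad]
  · rw [← h1]; simp [tetrad]; ring
  · rw [← h2]; simp [tetrad]; ring
  · simp [tetrad]
  · simp [tetrad]
  · simp [tetrad]
  · simp [tetrad]

theorem tetrad_smooth (hW : IsOpen W) : ContDiffOn ℝ ∞ P.tetrad.m (spacetime W I) ∧
    ContDiffOn ℝ ∞ P.tetrad.l (spacetime W I) ∧ ContDiffOn ℝ ∞ P.tetrad.k (spacetime W I) := by
  have hΨ := P.contDiffOn_Ψ hW
  have hs : ContDiffOn ℝ ∞ P.scale₀ (spacetime W I) :=
    (ContDiffOn.sqrt ((contDiffOn_coord W P.contDiffOn_w).div_const 2)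
      fun x hx => (half_pos (P.w_pos hx.2)).ne').mul ((contDiffOn_re hΨ).div_const 2).exp
  have hp : ContDiffOn ℝ ∞ P.phase₀ (spacetime W I) := ((hΨ.sub (contDiffOn_conj hΨ)).div_const 4).cexp
  have hq : ContDiffOn ℝ ∞ P.shift₀ (spacetime W I) :=
    (contDiffOn_ofReal (contDiffOn_coord W P.contDiffOn_ρ)).neg.mul
      ((contDiff_const.mul contDiff_zeta).add contDiff_const).contDiffOn
  have hs0 : ∀ x ∈ spacetime W I, P.scale₀ x ≠ 0 := fun x hx => (P.scale₀_pos hx).ne'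
  refine ⟨contDiffOn_pi.2 fun i => ?_, contDiffOn_pi.2 fun i => ?_, contDiffOn_pi.2 fun i => ?_⟩
  · fin_cases i
    · exact (contDiffOn_conj hp).div_const 2
    · exact (contDiffOn_const.mul (contDiffOn_conj hp)).div_const 2
    · exact contDiffOn_const
    · exact (contDiffOn_conj hp).mul (contDiffOn_conj hq)
  · fin_cases i
    · exact (contDiffOn_re hq).div hs hs0
    · exact (contDiffOn_im hq).div hs hs0
    · exact contDiffOn_const.div hs hs0
    · exact ((((contDiffOn_re hq).pow 2).add ((contDiffOn_im hq).pow 2)).sub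
        ((P.contDiffOn_potential hW).div_const 2)).div hs hs0
  · fin_cases i
    · exact contDiffOn_const
    · exact contDiffOn_const
    · exact contDiffOn_const
    · exact hs

theorem tetrad_psi4 (hW : IsOpen W) (hI : IsOpen I) {x : Pt} (hx : x ∈ spacetime W I) :
    P.tetrad.Ψ₄ (ppMetric P.f) x = 1 := by
  have h0 : (P.scale₀ x : ℂ) ≠ 0 := by exact_mod_cast (P.scale₀_pos hx).ne'
  rw [Tetrad.psi4_eq (P.hasJet hI) (isOpen_spacetime hW hI) (P.tetrad_shape hx) hx, tetrad_phase,
    tetrad_scale, div_eq_one_iff_eq (mul_ne_zero two_ne_zero (pow_ne_zero 2 h0)), f₂, phase₀, scale₀]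
  have hw : √(P.w (x 2) / 2) ^ 2 = P.w (x 2) / 2 := Real.sq_sqrt (half_pos (P.w_pos hx.2)).le
  have hw' : ((√(P.w (x 2) / 2) : ℝ) : ℂ) ^ 2 = P.w (x 2) / 2 := by exact_mod_cast hw
  push_cast
  rw [mul_pow, hw', ← Complex.exp_nat_mul, ← Complex.exp_nat_mul, map_mul, ← Complex.exp_conj,
    Complex.conj_ofReal, mul_left_comm, ← Complex.exp_add]
  have : ((2 : ℕ) : ℂ) * ((P.Ψ (zeta x) - conj (P.Ψ (zeta x))) / 4) + conj (P.Ψ (zeta x))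
      = ((2 : ℕ) : ℂ) * ((P.Ψ (zeta x)).re / 2) := by
    apply Complex.ext <;> simp
    · ring
    · ring
  rw [this]; ring

theorem tetrad_isNormalized (hW : IsOpen W) (hI : IsOpen I) :
    P.tetrad.IsNormalized (ppMetric P.f) (spacetime W I) := by
  obtain ⟨sm, sl, sk⟩ := P.tetrad_smooth hW
  have hA := fun x hx => adapted_of_psi4 (P := P) hW hI sm sk (fun _ hy => P.tetrad_shape hy)
    (fun _ hy => P.tetrad_psi4 hW hI hy) (x := x) hx
  refine ⟨⟨sm, sl, sk, fun x hx a b => ?_⟩, fun x _ i hi => ?_, fun x hx => ?_,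
    fun x hx => P.tetrad_psi4 hW hI hx, fun x hx => ?_⟩
  · have h0 : (P.scale₀ x : ℂ) ≠ 0 := by exact_mod_cast (P.scale₀_pos hx).ne'
    have h1 : ((P.shift₀ x).re : ℂ) = (P.shift₀ x + conj (P.shift₀ x)) / 2 := by
      rw [Complex.add_conj]; push_cast; ring
    have h2 : ((P.shift₀ x).im : ℂ) = -Complex.I * (P.shift₀ x - conj (P.shift₀ x)) / 2 := by
      rw [Complex.sub_conj]; push_cast; linear_combination ((P.shift₀ x).im : ℂ) * Complex.I_sq
    have h3 := P.conj_phase₀_mul x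
    rw [dot_ppMetric]
    fin_cases a <;> fin_cases b <;> simp [Tetrad.frame, tetrad, toC, cconj, h1, h2] <;>
      try field_simp <;> try ring_nf <;> try simp only [Complex.I_sq] <;> try ring_nf
    all_goals linear_combination 2 * h3
  · fin_cases i <;> simp_all [tetrad]
  · have hz : HasD (fun y => conj (zeta y)) 0 1 0 x :=
      (HasD.zeta.conjugate).congr' (by simp) (by simp) (by simp)
    rw [Tetrad.δ, (P.tetrad_shape hx).along_m hz, mul_zero]
  · rw [γ_eq hW hI hA hx, P.tetrad_shift hx, shift₀]
    simp

end AffineProfile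
end PPWave
end

noncomputable section

namespace PPWave

/-! ## Partial derivatives of smooth functions on an open set -/

section Smooth

variable {U : Set Pt} {φ ψ : Pt → ℝ} {x : Pt}

theorem differentiableAt_of_smooth (hU : IsOpen U) (h : ContDiffOn ℝ ∞ φ U) (hx : x ∈ U) :
    DifferentiableAt ℝ φ x :=
  (h.contDiffAt (hU.mem_nhds hx)).differentiableAt (by simp)

theorem contDiffOn_pd (hU : IsOpen U) (h : ContDiffOn ℝ ∞ φ U) (i : Fin 4) :
    ContDiffOn ℝ ∞ (pd i φ) U :=
  (h.fderiv_of_isOpen hU (by simp)).clm_apply contDiffOn_const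

theorem pd_comm (hU : IsOpen U) (h : ContDiffOn ℝ ∞ φ U) (hx : x ∈ U) (i j : Fin 4) :
    pd i (pd j φ) x = pd j (pd i φ) x := by
  have hs : IsSymmSndFDerivAt ℝ φ x :=
    (h.contDiffAt (hU.mem_nhds hx)).isSymmSndFDerivAt (by simp; exact WithTop.coe_le_coe.2 le_top)
  have hd : DifferentiableAt ℝ (fderiv ℝ φ) x :=
    ((h.fderiv_of_isOpen hU (m := ∞) (by simp)).contDiffAt (hU.mem_nhds hx)).differentiableAt
      (by simp)
  have key : ∀ i j, pd i (pd j φ) x = fderiv ℝ (fderiv ℝ φ) x (Pi.single i 1) (Pi.single j 1) := by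
    intro i j
    unfold pd
    rw [fderiv_clm_apply hd (differentiableAt_const _)]
    simp
  rw [key, key, hs.eq]

theorem pd_eq_zero (hU : IsOpen U) (h : ∀ x ∈ U, φ x = 0) (hx : x ∈ U) (i : Fin 4) :
    pd i φ x = 0 := by
  rw [pd_congr hU h hx]; simp [pd]

theorem pd_add (h : DifferentiableAt ℝ φ x) (h' : DifferentiableAt ℝ ψ x) (i : Fin 4) :
    pd i (fun y => φ y + ψ y) x = pd i φ x + pd i ψ x := by
  unfold pd; rw [fderiv_fun_add h h']; rfl

theorem pd_sub (h : DifferentiableAt ℝ φ x) (h' : DifferentiableAt ℝ ψ x) (i : Fin 4) :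
    pd i (fun y => φ y - ψ y) x = pd i φ x - pd i ψ x := by
  unfold pd; rw [fderiv_fun_sub h h']; rfl

theorem pd_neg (i : Fin 4) : pd i (fun y => -φ y) x = -pd i φ x := by
  unfold pd; rw [fderiv_fun_neg]; rfl

theorem pd_mul (h : DifferentiableAt ℝ φ x) (h' : DifferentiableAt ℝ ψ x) (i : Fin 4) :
    pd i (fun y => φ y * ψ y) x = pd i φ x * ψ x + φ x * pd i ψ x := by
  unfold pd; rw [fderiv_fun_mul h h']; simp; ring

theorem pd_const_mul (h : DifferentiableAt ℝ φ x) (k : ℝ) (i : Fin 4) :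
    pd i (fun y => k * φ y) x = k * pd i φ x := by
  unfold pd; rw [fderiv_const_mul h]; simp

theorem eq_of_pd_eq_zero (hU : IsOpen U) (hU' : IsPreconnected U) (h : ContDiffOn ℝ ∞ φ U)
    (h0 : ∀ x ∈ U, ∀ i, pd i φ x = 0) {x y : Pt} (hx : x ∈ U) (hy : y ∈ U) : φ x = φ y := by
  refine hU.is_const_of_fderiv_eq_zero (𝕜 := ℝ) hU' (h.differentiableOn (by simp)) (fun z hz => ?_) hx hy
  ext v
  rw [← Finset.univ_sum_single v, map_sum]
  refine Finset.sum_eq_zero fun i _ => ?_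
  have := h0 z hz i
  unfold pd at this
  rw [show (Pi.single i (v i) : Pt) = v i • Pi.single i 1 by
    rw [← Pi.single_smul, smul_eq_mul, mul_one], map_smul, this, smul_zero]

/-- Wirtinger coefficients of a real function; the bridge from real Killing components to complex
calculus. -/
theorem HasD.of_real (h : DifferentiableAt ℝ φ x) (h3 : pd 3 φ x = 0) :
    HasD (fun y => (φ y : ℂ)) ((pd 0 φ x - Complex.I * pd 1 φ x) / 2)
      ((pd 0 φ x + Complex.I * pd 1 φ x) / 2) ((pd 2 φ x : ℝ) : ℂ) x := by
  have h1 := Complex.ofRealCLM.hasFDerivAt.comp x h.hasFDerivAt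
  refine HasFDerivAt.congr_fderiv h1 (ContinuousLinearMap.ext fun v => ?_)
  have hv : fderiv ℝ φ x v = ∑ i, v i * pd i φ x := by
    conv_lhs => rw [← Finset.univ_sum_single v, map_sum]
    refine Finset.sum_congr rfl fun i _ => ?_
    unfold pd
    rw [show (Pi.single i (v i) : Pt) = v i • Pi.single i 1 by
      rw [← Pi.single_smul, smul_eq_mul, mul_one], map_smul, smul_eq_mul]
  simp [dform_apply, hv, Fin.sum_univ_four, h3, PPWave.zeta]
  linear_combination (v 1 * pd 1 φ x : ℂ) * Complex.I_sq

end Smooth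

/-! ## The Killing equations of a pp-wave -/

/-- The Killing equations for the components of a vector field. -/
structure KillingSystem (H p q a b : Pt → ℝ) (U : Set Pt) : Prop where
  sp : ContDiffOn ℝ ∞ p U
  sq : ContDiffOn ℝ ∞ q U
  sa : ContDiffOn ℝ ∞ a U
  sb : ContDiffOn ℝ ∞ b U
  e33 : ∀ x ∈ U, pd 3 a x = 0
  e03 : ∀ x ∈ U, pd 0 a x = 2 * pd 3 p x
  e13 : ∀ x ∈ U, pd 1 a x = 2 * pd 3 q x
  e00 : ∀ x ∈ U, pd 0 p x = 0
  e11 : ∀ x ∈ U, pd 1 q x = 0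
  e01 : ∀ x ∈ U, pd 1 p x = -pd 0 q x
  e23 : ∀ x ∈ U, pd 3 b x = -pd 2 a x
  e02 : ∀ x ∈ U, pd 0 b x = 2 * pd 2 p x - H x * pd 0 a x
  e12 : ∀ x ∈ U, pd 1 b x = 2 * pd 2 q x - H x * pd 1 a x
  e22 : ∀ x ∈ U, p x * pd 0 H x + q x * pd 1 H x + a x * pd 2 H x
    + 2 * (H x * pd 2 a x) + 2 * pd 2 b x = 0

/-- Field `eij` is the (i, j) component of ℒ_X G = 0; `e23` is simplified by means of `e33`. -/
theorem IsKilling.killingSystem {f : ℂ → ℝ → ℂ} {U : Set Pt} {X : RField}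
    (h : IsKilling (ppMetric f) U X) :
    KillingSystem (potential f) (fun y => X y 0) (fun y => X y 1) (fun y => X y 2)
      (fun y => X y 3) U := by
  have hs := contDiffOn_pi.1 h.smooth
  have hl := h.lie
  simp only [pd_ppMetric, Fin.sum_univ_four] at hl
  have hH : ∀ x, ppMetric f x 2 2 = -potential f x := fun x => rfl
  have e33 : ∀ x ∈ U, pd 3 (fun y => X y 2) x = 0 := fun x hx => by
    have := hl x hx 3 3
    simp [ppMetric] at this; linarith
  refine ⟨hs 0, hs 1, hs 2, hs 3, e33, fun x hx => ?_, fun x hx => ?_, fun x hx => ?_,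
    fun x hx => ?_, fun x hx => ?_, fun x hx => ?_, fun x hx => ?_, fun x hx => ?_, fun x hx => ?_⟩
  · have := hl x hx 0 3
    simp [ppMetric] at this; linarith
  · have := hl x hx 1 3
    simp [ppMetric] at this; linarith
  · have := hl x hx 0 0
    simp [ppMetric] at this; linarith
  · have := hl x hx 1 1
    simp [ppMetric] at this; linarith
  · have := hl x hx 0 1
    simp [ppMetric] at this; linarith
  · have := hl x hx 2 3
    have h3 := e33 x hx
    simp [ppMetric, h3] at this; linarith
  · have := hl x hx 0 2
    simp [ppMetric] at this; unfold potential; linarith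
  · have := hl x hx 1 2
    simp [ppMetric] at this; unfold potential; linarith
  · have := hl x hx 2 2
    rw [pd_three_potential] at this
    simp [ppMetric] at this; unfold potential at this ⊢; linarith

theorem KillingSystem.isKilling {f : ℂ → ℝ → ℂ} {U : Set Pt} {X : RField}
    (h : KillingSystem (potential f) (fun y => X y 0) (fun y => X y 1) (fun y => X y 2)
      (fun y => X y 3) U) (h0 : ∀ x ∉ U, X x = 0) : IsKilling (ppMetric f) U X := by
  refine ⟨contDiffOn_pi.2 fun i => ?_, h0, fun x hx => ?_⟩
  · fin_cases i
    exacts [h.sp, h.sq, h.sa, h.sb]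
  · have e33 := h.e33 x hx
    have e03 := h.e03 x hx
    have e13 := h.e13 x hx
    have e00 := h.e00 x hx
    have e11 := h.e11 x hx
    have e01 := h.e01 x hx
    have e23 := h.e23 x hx
    have e02 := h.e02 x hx
    have e12 := h.e12 x hx
    have e22 := h.e22 x hx
    unfold potential at e02 e12 e22
    have h3 := pd_three_potential f x
    unfold potential at h3
    intro i j
    simp only [pd_ppMetric, Fin.sum_univ_four]
    unfold potential
    fin_cases i <;> fin_cases j <;> simp [ppMetric, h3, e33] <;> linarith

namespace KillingSystem

variable {H p q a b : Pt → ℝ} {U : Set Pt}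

section

variable (h : KillingSystem H p q a b U) (hU : IsOpen U) (sH : ContDiffOn ℝ ∞ H U)
  (hH3 : ∀ x ∈ U, pd 3 H x = 0) (hlap : ∀ x ∈ U, pd 1 (pd 1 H) x = -pd 0 (pd 0 H) x)
  (hdet : ∀ x ∈ U, pd 0 (pd 0 H) x ^ 2 + pd 1 (pd 0 H) x ^ 2 ≠ 0)
include h hU

/-- Integrability: the gradient of a in the wave plane has vanishing derivatives along the plane and
along u. -/
theorem pd_pd_a {x : Pt} (hx : x ∈ U) (hH3 : pd 3 H x = 0) (sH : ContDiffOn ℝ ∞ H U) :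
    pd 0 (pd 0 a) x = 0 ∧ pd 1 (pd 1 a) x = 0 ∧ pd 0 (pd 1 a) x = 0 ∧
    pd 2 (pd 0 a) x = 0 ∧ pd 2 (pd 1 a) x = 0 := by
  have d := @differentiableAt_of_smooth U
  have D := fun {φ : Pt → ℝ} (hφ : ContDiffOn ℝ ∞ φ U) (i : Fin 4) => contDiffOn_pd hU hφ i
  have dp3 := d hU (D h.sp 3) hx
  have dq3 := d hU (D h.sq 3) hx
  have e1 : ∀ i, pd i (pd 0 a) x = 2 * pd 3 (pd i p) x := fun i => by
    rw [pd_congr hU h.e03 hx, pd_const_mul dp3, pd_comm hU h.sp hx]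
  have e2 : ∀ i, pd i (pd 1 a) x = 2 * pd 3 (pd i q) x := fun i => by
    rw [pd_congr hU h.e13 hx, pd_const_mul dq3, pd_comm hU h.sq hx]
  have p10 : pd 3 (pd 1 p) x = -pd 3 (pd 0 q) x := by
    rw [pd_congr hU h.e01 hx, pd_neg]
  have c01 := pd_comm hU h.sa hx 0 1
  -- The two expressions for ∂₃∂ᵢb, from the (2,3) and the (i,2) equations, are -∂₂∂ᵢa and +∂₂∂ᵢa.
  have hb : ∀ (i : Fin 4) (r : Pt → ℝ), ContDiffOn ℝ ∞ r U →
      (∀ y ∈ U, pd i b y = 2 * pd 2 r y - H y * pd i a y) →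
      (∀ y ∈ U, pd i a y = 2 * pd 3 r y) → pd 2 (pd i a) x = 0 := by
    intro i r sr h1 h2
    have a3 : pd 3 (pd i a) x = 0 := by
      rw [pd_comm hU h.sa hx, pd_eq_zero hU h.e33 hx]
    have k1 : pd 3 (pd i b) x = -pd 2 (pd i a) x := by
      rw [pd_comm hU h.sb hx, pd_congr hU h.e23 hx, pd_neg, pd_comm hU h.sa hx]
    rw [pd_congr hU h1 hx, pd_sub ((d hU (D sr 2) hx).const_mul 2)
      ((d hU sH hx).fun_mul (d hU (D h.sa i) hx)), pd_const_mul (d hU (D sr 2) hx),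
      pd_mul (d hU sH hx) (d hU (D h.sa i) hx), hH3, a3, pd_comm hU sr hx] at k1
    have k2 : pd 2 (pd i a) x = 2 * pd 2 (pd 3 r) x := by
      rw [pd_congr hU h2 hx, pd_const_mul (d hU (D sr 3) hx)]
    linarith
  refine ⟨?_, ?_, ?_, hb 0 p h.sp h.e02 h.e03, hb 1 q h.sq h.e12 h.e13⟩
  · rw [e1, pd_eq_zero hU h.e00 hx, mul_zero]
  · rw [e2, pd_eq_zero hU h.e11 hx, mul_zero]
  · have := e1 1
    have := e2 0
    linarith

include sH hH3

/-- The v-derivative of `e22`. -/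
theorem grad_a_eq {x : Pt} (hx : x ∈ U) :
    pd 0 a x * pd 0 H x + pd 1 a x * pd 1 H x = 4 * pd 2 (pd 2 a) x := by
  have d := fun {φ : Pt → ℝ} (hφ : ContDiffOn ℝ ∞ φ U) => differentiableAt_of_smooth hU hφ hx
  have D := fun {φ : Pt → ℝ} (hφ : ContDiffOn ℝ ∞ φ U) (i : Fin 4) => contDiffOn_pd hU hφ i
  have H3 : ∀ i, pd 3 (pd i H) x = 0 := fun i => by
    rw [pd_comm hU sH hx, pd_eq_zero hU hH3 hx]
  have a23 : pd 3 (pd 2 a) x = 0 := by rw [pd_comm hU h.sa hx, pd_eq_zero hU h.e33 hx]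
  have b23 : pd 3 (pd 2 b) x = -pd 2 (pd 2 a) x := by
    rw [pd_comm hU h.sb hx, pd_congr hU h.e23 hx, pd_neg]
  have k := pd_eq_zero hU h.e22 hx 3
  have s1 := (d h.sp).fun_mul (d (D sH 0))
  have s2 := (d h.sq).fun_mul (d (D sH 1))
  have s3 := (d h.sa).fun_mul (d (D sH 2))
  have s4 := (d sH).fun_mul (d (D h.sa 2))
  have s5 := (d (D h.sb 2)).const_mul 2
  rw [pd_add (((s1.fun_add s2).fun_add s3).fun_add (s4.const_mul 2)) s5,
    pd_add ((s1.fun_add s2).fun_add s3) (s4.const_mul 2), pd_add (s1.fun_add s2) s3, pd_add s1 s2,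
    pd_const_mul s4, pd_const_mul (d (D h.sb 2)), pd_mul (d h.sp) (d (D sH 0)),
    pd_mul (d h.sq) (d (D sH 1)), pd_mul (d h.sa) (d (D sH 2)), pd_mul (d sH) (d (D h.sa 2)),
    H3, H3, H3, a23, b23, h.e33 x hx, hH3 x hx] at k
  rw [h.e03 x hx, h.e13 x hx]
  linarith

include hlap hdet

/-- Differentiating `grad_a_eq` in the wave plane gives Hess(H) ∇a = 0. For harmonic H the Hessian
is trace-free with determinant minus the quantity in `hdet`, so it is invertible. -/
theorem grad_a {x : Pt} (hx : x ∈ U) : pd 0 a x = 0 ∧ pd 1 a x = 0 := by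
  have d := fun {φ : Pt → ℝ} (hφ : ContDiffOn ℝ ∞ φ U) => differentiableAt_of_smooth hU hφ hx
  have D := fun {φ : Pt → ℝ} (hφ : ContDiffOn ℝ ∞ φ U) (i : Fin 4) => contDiffOn_pd hU hφ i
  have A := fun y hy => h.pd_pd_a hU (x := y) hy (hH3 y hy) sH
  obtain ⟨a00, a11, a01, -, -⟩ := A x hx
  have a10 : pd 1 (pd 0 a) x = 0 := by rw [pd_comm hU h.sa hx, a01]
  have a22 : ∀ i, (∀ y ∈ U, pd 2 (pd i a) y = 0) → pd i (pd 2 (pd 2 a)) x = 0 := fun i hi => by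
    rw [pd_comm hU (D h.sa 2) hx, pd_congr hU (fun y hy => pd_comm hU h.sa hy i 2) hx,
      pd_eq_zero hU hi hx]
  have key := fun y hy => h.grad_a_eq hU sH hH3 (x := y) hy
  have s1 := (d (D h.sa 0)).fun_mul (d (D sH 0))
  have s2 := (d (D h.sa 1)).fun_mul (d (D sH 1))
  have k : ∀ i, pd i (pd 0 a) x * pd 0 H x + pd 0 a x * pd i (pd 0 H) x +
      (pd i (pd 1 a) x * pd 1 H x + pd 1 a x * pd i (pd 1 H) x) = 4 * pd i (pd 2 (pd 2 a)) x := by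
    intro i
    have := pd_congr hU key hx i
    rwa [pd_add s1 s2, pd_mul (d (D h.sa 0)) (d (D sH 0)), pd_mul (d (D h.sa 1)) (d (D sH 1)),
      pd_const_mul (d (D (D h.sa 2) 2))] at this
  have k0 := k 0
  have k1 := k 1
  rw [a22 0 fun y hy => (A y hy).2.2.2.1, a00, a01, pd_comm hU sH hx 0 1] at k0
  rw [a22 1 fun y hy => (A y hy).2.2.2.2, a10, a11, hlap x hx] at k1
  have hd := hdet x hx
  constructor
  · refine (mul_eq_zero.1 ?_).resolve_right hd
    linear_combination pd 0 (pd 0 H) x * k0 + pd 1 (pd 0 H) x * k1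
  · refine (mul_eq_zero.1 ?_).resolve_right hd
    linear_combination pd 1 (pd 0 H) x * k0 - pd 0 (pd 0 H) x * k1

end

/-- The part of the Killing equations that does not involve second derivatives of the profile. -/
structure Reduced (p q a b : Pt → ℝ) (U : Set Pt) : Prop where
  a0 : ∀ x ∈ U, pd 0 a x = 0
  a1 : ∀ x ∈ U, pd 1 a x = 0
  a3 : ∀ x ∈ U, pd 3 a x = 0
  a2 : ∀ x ∈ U, ∀ i, pd i (pd 2 a) x = 0
  p3 : ∀ x ∈ U, pd 3 p x = 0
  q3 : ∀ x ∈ U, pd 3 q x = 0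
  rot : ∀ x ∈ U, ∀ i, pd i (pd 0 q) x = 0
  b0 : ∀ x ∈ U, pd 0 b x = 2 * pd 2 p x
  b1 : ∀ x ∈ U, pd 1 b x = 2 * pd 2 q x

theorem reduced (h : KillingSystem H p q a b U) (hU : IsOpen U) (sH : ContDiffOn ℝ ∞ H U)
    (hH3 : ∀ x ∈ U, pd 3 H x = 0) (hlap : ∀ x ∈ U, pd 1 (pd 1 H) x = -pd 0 (pd 0 H) x)
    (hdet : ∀ x ∈ U, pd 0 (pd 0 H) x ^ 2 + pd 1 (pd 0 H) x ^ 2 ≠ 0) : Reduced p q a b U := by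
  have D := fun {φ : Pt → ℝ} (hφ : ContDiffOn ℝ ∞ φ U) (i : Fin 4) => contDiffOn_pd hU hφ i
  have g := fun y hy => h.grad_a hU sH hH3 hlap hdet (x := y) hy
  have a0 := fun y hy => (g y hy).1
  have a1 := fun y hy => (g y hy).2
  have p3 : ∀ x ∈ U, pd 3 p x = 0 := fun x hx => by
    have := h.e03 x hx; rw [a0 x hx] at this; linarith
  have q3 : ∀ x ∈ U, pd 3 q x = 0 := fun x hx => by
    have := h.e13 x hx; rw [a1 x hx] at this; linarith
  have b0 : ∀ x ∈ U, pd 0 b x = 2 * pd 2 p x := fun x hx => by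
    rw [h.e02 x hx, a0 x hx]; ring
  have b1 : ∀ x ∈ U, pd 1 b x = 2 * pd 2 q x := fun x hx => by
    rw [h.e12 x hx, a1 x hx]; ring
  refine ⟨a0, a1, h.e33, fun x hx i => ?_, p3, q3, fun x hx i => ?_, b0, b1⟩
  · have h0 : ∀ j, (∀ y ∈ U, pd j a y = 0) → pd j (pd 2 a) x = 0 := fun j hj => by
      rw [pd_comm hU h.sa hx, pd_eq_zero hU hj hx]
    fin_cases i
    · exact h0 0 a0
    · exact h0 1 a1
    -- With ∇a = 0 this relation says a'' = 0.
    · have := h.grad_a_eq hU sH hH3 hx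
      rw [a0 x hx, a1 x hx] at this
      show pd 2 (pd 2 a) x = 0
      linarith
    · exact h0 3 h.e33
  · have dn : ∀ j, pd j (pd 1 p) x = -pd j (pd 0 q) x := fun j => by
      rw [pd_congr hU h.e01 hx, pd_neg]
    fin_cases i
    · show pd 0 (pd 0 q) x = 0
      have := dn 0
      rw [pd_comm hU h.sp hx, pd_eq_zero hU h.e00 hx] at this
      linarith
    · show pd 1 (pd 0 q) x = 0
      rw [pd_comm hU h.sq hx, pd_eq_zero hU h.e11 hx]
    -- Symmetry of the mixed derivatives of b equates ∂₂∂₀q with ∂₂∂₁p = -∂₂∂₀q.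
    · show pd 2 (pd 0 q) x = 0
      have d2 := fun {φ : Pt → ℝ} (hφ : ContDiffOn ℝ ∞ φ U) => differentiableAt_of_smooth hU hφ hx
      have k1 : pd 0 (pd 1 b) x = 2 * pd 2 (pd 0 q) x := by
        rw [pd_congr hU b1 hx, pd_const_mul (d2 (D h.sq 2)), pd_comm hU h.sq hx]
      have k2 : pd 1 (pd 0 b) x = 2 * pd 2 (pd 1 p) x := by
        rw [pd_congr hU b0 hx, pd_const_mul (d2 (D h.sp 2)), pd_comm hU h.sp hx]
      have k3 := pd_comm hU h.sb hx 0 1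
      have := dn 2
      linarith
    · show pd 3 (pd 0 q) x = 0
      rw [pd_comm hU h.sq hx, pd_eq_zero hU q3 hx]

end KillingSystem
end PPWave
end

/-! ### Killing fields of an affine profile: constraints and the bound on the dimension -/

noncomputable section

namespace PPWave

theorem HasD.unique {φ : Pt → ℂ} {a b c a' b' c' : ℂ} {x : Pt} (h : HasD φ a b c x)
    (h' : HasD φ a' b' c' x) : a = a' ∧ b = b' ∧ c = c' := by
  have h0 : a + b = a' + b' := by rw [← h.pd0, h'.pd0]
  have h1 : Complex.I * (a - b) = Complex.I * (a' - b') := by rw [← h.pd1, h'.pd1]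
  have h2 : c = c' := by rw [← h.pd2, h'.pd2]
  have h1' := mul_left_cancel₀ Complex.I_ne_zero h1
  exact ⟨by linear_combination (h0 + h1') / 2, by linear_combination (h0 - h1') / 2, h2⟩

/-- The `ζ`-component of a real vector field. -/
def RField.zcomp (X : RField) (x : Pt) : ℂ := X x 0 + Complex.I * X x 1

namespace AffineProfile

variable {W : Set ℂ} {I : Set ℝ} (P : AffineProfile W I)

theorem hasD_deriv_G (hI : IsOpen I) {x : Pt} (hx : x ∈ spacetime W I) :
    HasD (fun y => deriv P.G (y 2)) 0 0 (deriv (deriv P.G) (x 2)) x :=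
  HasD.ofCoord ((((P.hG.deriv_of_isOpen hI (m := ∞) (by simp)).contDiffAt
    (hI.mem_nhds hx.2)).differentiableAt (by simp)).hasDerivAt)

/-- `∂f/∂u`. -/
def fu (x : Pt) : ℂ := P.ρ (x 2) * P.w (x 2) * P.F (zeta x) + deriv P.G (x 2) * zeta x

/-- `∂²f/∂ζ∂u`. -/
def f₁u (x : Pt) : ℂ := P.ρ (x 2) * P.w (x 2) * P.F₁ (zeta x) + deriv P.G (x 2)

theorem hasD_fu (hI : IsOpen I) {x : Pt} (hx : x ∈ spacetime W I) :
    ∃ e, HasD P.fu (P.f₁u x) 0 e x :=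
  ⟨_, ((((P.hasD_ρ hx).mul (P.hasD_w hx)).mul (HasD.comp (P.hF _ hx.1) HasD.zeta)).add
    ((P.hasD_deriv_G hI hx).mul HasD.zeta)).congr' (by simp [f₁u]) (by simp) rfl⟩

theorem hasD_f₁u (hI : IsOpen I) {x : Pt} (hx : x ∈ spacetime W I) :
    ∃ e, HasD P.f₁u (P.ρ (x 2) * P.f₂ x) 0 e x :=
  ⟨_, ((((P.hasD_ρ hx).mul (P.hasD_w hx)).mul (HasD.comp (P.hF₁ _ hx.1) HasD.zeta)).add
    (P.hasD_deriv_G hI hx)).congr' (by simp [f₂]; ring) (by simp) rfl⟩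

theorem f₂_ne {x : Pt} (hx : x ∈ spacetime W I) : P.f₂ x ≠ 0 :=
  mul_ne_zero (by exact_mod_cast (P.w_pos hx.2).ne') (Complex.exp_ne_zero _)

variable {P} {X : RField} (hW : IsOpen W) (hI : IsOpen I)
  (hX : IsKilling (ppMetric P.f) (spacetime W I) X)
include hW hI hX

theorem killing_reduced : KillingSystem.Reduced (fun y => X y 0) (fun y => X y 1)
    (fun y => X y 2) (fun y => X y 3) (spacetime W I) := by
  have hU := isOpen_spacetime hW hI
  have J := P.hasJet hI
  refine hX.killingSystem.reduced hU (P.contDiffOn_potential hW)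
    (fun x _ => pd_three_potential _ x) (fun x hx => ?_) (fun x hx => ?_)
  · rw [J.pd_pd1 hU hx, J.pd_pd0 hU hx]
    simp [dform_apply, zeta]
  · rw [J.pd_pd0 hU hx, J.pd_pd0 hU hx]
    simp [dform_apply, zeta]
    intro h0
    apply P.f₂_ne hx
    have h1 : (P.f₂ x).re = 0 := by nlinarith [sq_nonneg (P.f₂ x).re, sq_nonneg (P.f₂ x).im]
    have h2 : (P.f₂ x).im = 0 := by nlinarith [sq_nonneg (P.f₂ x).re, sq_nonneg (P.f₂ x).im]
    exact Complex.ext h1 h2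

/-- The three Killing equations in the wave plane are Cauchy–Riemann equations with purely imaginary
derivative iω. -/
theorem hasD_zcomp {x : Pt} (hx : x ∈ spacetime W I) :
    HasD X.zcomp (Complex.I * (pd 0 (fun y => X y 1) x : ℝ)) 0
      ((pd 2 (fun y => X y 0) x : ℝ) + Complex.I * (pd 2 (fun y => X y 1) x : ℝ)) x := by
  have hU := isOpen_spacetime hW hI
  have S := hX.killingSystem
  have R := killing_reduced hW hI hX
  have h0 := HasD.of_real (differentiableAt_of_smooth hU S.sp hx) (R.p3 x hx)
  have h1 := HasD.of_real (differentiableAt_of_smooth hU S.sq hx) (R.q3 x hx)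
  rw [S.e00 x hx, S.e01 x hx] at h0
  rw [S.e11 x hx] at h1
  refine (h0.add ((HasD.const Complex.I).mul h1)).congr' ?_ ?_ ?_
  · push_cast; ring
  · push_cast; ring
  · ring

theorem hasD_rot {x : Pt} (hx : x ∈ spacetime W I) :
    HasD (fun y => ((pd 0 (fun y => X y 1) y : ℝ) : ℂ)) 0 0 0 x := by
  have hU := isOpen_spacetime hW hI
  have S := hX.killingSystem
  have R := killing_reduced hW hI hX
  have := HasD.of_real (differentiableAt_of_smooth hU (contDiffOn_pd hU S.sq 0) hx) (R.rot x hx 3)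
  simpa [R.rot x hx] using this

theorem hasD_a {x : Pt} (hx : x ∈ spacetime W I) :
    HasD (fun y => (X y 2 : ℂ)) 0 0 (pd 2 (fun y => X y 2) x : ℝ) x := by
  have hU := isOpen_spacetime hW hI
  have S := hX.killingSystem
  have R := killing_reduced hW hI hX
  have := HasD.of_real (differentiableAt_of_smooth hU S.sa hx) (R.a3 x hx)
  simpa [R.a0 x hx, R.a1 x hx] using this

theorem hasD_a2 {x : Pt} (hx : x ∈ spacetime W I) :
    HasD (fun y => ((pd 2 (fun y => X y 2) y : ℝ) : ℂ)) 0 0 0 x := by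
  have hU := isOpen_spacetime hW hI
  have S := hX.killingSystem
  have R := killing_reduced hW hI hX
  have := HasD.of_real (differentiableAt_of_smooth hU (contDiffOn_pd hU S.sa 2) hx) (R.a2 x hx 3)
  simpa [R.a2 x hx] using this

/-- The `ζ`-derivative of the last Killing equation. -/
theorem killing_first {x : Pt} (hx : x ∈ spacetime W I) :
    Complex.I * (pd 0 (fun y => X y 1) x : ℝ) * P.f₁ x + X.zcomp x * P.f₂ x + X x 2 * P.f₁u x
      + 2 * ((pd 2 (fun y => X y 2) x : ℝ) * P.f₁ x)
      + 2 * ((pd 2 (pd 2 (fun y => X y 0)) x : ℝ)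
        - Complex.I * (pd 2 (pd 2 (fun y => X y 1)) x : ℝ)) = 0 := by
  have hU := isOpen_spacetime hW hI
  have S := hX.killingSystem
  have R := killing_reduced hW hI hX
  have J := P.hasJet hI
  obtain ⟨e, hfu⟩ := P.hasD_fu hI hx
  have h1 := (((hasD_zcomp hW hI hX hx).mul (J.d₁ x hx)).add ((hasD_a hW hI hX hx).mul hfu)).add
    ((HasD.const 2).mul ((hasD_a2 hW hI hX hx).mul (J.d x hx)))
  have sb2 := contDiffOn_pd hU S.sb 2
  have b23 : pd 3 (pd 2 (fun y => X y 3)) x = 0 := by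
    rw [pd_comm hU S.sb hx, pd_congr hU S.e23 hx, pd_neg, R.a2 x hx, neg_zero]
  have h2 := HasD.of_real (differentiableAt_of_smooth hU sb2 hx) b23
  have b20 : pd 0 (pd 2 (fun y => X y 3)) x = 2 * pd 2 (pd 2 (fun y => X y 0)) x := by
    rw [pd_comm hU S.sb hx, pd_congr hU R.b0 hx,
      pd_const_mul (differentiableAt_of_smooth hU (contDiffOn_pd hU S.sp 2) hx)]
  have b21 : pd 1 (pd 2 (fun y => X y 3)) x = 2 * pd 2 (pd 2 (fun y => X y 1)) x := by
    rw [pd_comm hU S.sb hx, pd_congr hU R.b1 hx,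
      pd_const_mul (differentiableAt_of_smooth hU (contDiffOn_pd hU S.sq 2) hx)]
  rw [b20, b21] at h2
  have h3 := (h1.add h1.conjugate).add ((HasD.const 2).mul h2)
  have h4 : HasD (fun _ => (0 : ℂ)) 0 0 0 x := HasD.const 0
  -- `e22` has the form h + h̄ + 2 ∂_u b = 0 with h free of dζ̄; its dζ-coefficient is the claim.
  have h5 := h4.congr_on hU hx (φ := fun y => (X.zcomp y * P.f₁ y + X y 2 * P.fu y
      + 2 * ((pd 2 (fun y => X y 2) y : ℝ) * P.f (zeta y) (y 2)))
      + conj (X.zcomp y * P.f₁ y + X y 2 * P.fu y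
      + 2 * ((pd 2 (fun y => X y 2) y : ℝ) * P.f (zeta y) (y 2)))
      + 2 * ((pd 2 (fun y => X y 3) y : ℝ) : ℂ)) (fun y hy => by
    have k := S.e22 y hy
    rw [J.pd0 hy, J.pd1 hy, J.pd2 hy] at k
    rw [Complex.add_conj]
    norm_cast
    rw [← k]
    congr 1
    simp [RField.zcomp, fu, potential]
    ring)
  have h6 := (h3.unique h5).1
  simp at h6
  linear_combination h6

/-- The second `ζ`-derivative of the last Killing equation. -/
theorem zcomp_eq {x : Pt} (hx : x ∈ spacetime W I) :
    X.zcomp x = -(2 * Complex.I * (pd 0 (fun y => X y 1) x : ℝ) +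
      (X x 2 * P.ρ (x 2) + 2 * (pd 2 (fun y => X y 2) x : ℝ))) * P.τ x := by
  have hU := isOpen_spacetime hW hI
  have S := hX.killingSystem
  have R := killing_reduced hW hI hX
  have J := P.hasJet hI
  obtain ⟨e, hfu⟩ := P.hasD_f₁u hI hx
  have D := fun {φ : Pt → ℝ} (hφ : ContDiffOn ℝ ∞ φ (spacetime W I)) (i : Fin 4) =>
    contDiffOn_pd hU hφ i
  have z : ∀ {r : Pt → ℝ} (i : Fin 4), ContDiffOn ℝ ∞ r (spacetime W I) →
      (∀ y ∈ spacetime W I, pd 2 (pd i r) y = 0) → pd i (pd 2 (pd 2 r)) x = 0 := by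
    intro r i sr hr
    rw [pd_comm hU (D sr 2) hx, pd_congr hU (fun y hy => pd_comm hU sr hy i 2) hx,
      pd_eq_zero hU hr hx]
  have z' : ∀ {r : Pt → ℝ} (i : Fin 4), ContDiffOn ℝ ∞ r (spacetime W I) →
      (∀ y ∈ spacetime W I, pd i r y = 0) → pd i (pd 2 (pd 2 r)) x = 0 := fun i sr hr =>
    z i sr fun y hy => pd_eq_zero hU hr hy 2
  have p1 : ∀ y ∈ spacetime W I, pd 2 (pd 1 (fun y => X y 0)) y = 0 := fun y hy => by
    rw [pd_congr hU S.e01 hy, pd_neg, R.rot y hy, neg_zero]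
  -- The terms p_uu and q_uu depend on u alone, so they disappear after the second ζ-derivative;
  -- f''' = f''/τ and f'' ≠ 0 then give z.
  have hp := HasD.of_real (differentiableAt_of_smooth hU (D (D S.sp 2) 2) hx) (z' 3 S.sp R.p3)
  rw [z' 0 S.sp S.e00, z 1 S.sp p1] at hp
  have hq := HasD.of_real (differentiableAt_of_smooth hU (D (D S.sq 2) 2) hx) (z' 3 S.sq R.q3)
  rw [z 0 S.sq (fun y hy => R.rot y hy 2), z' 1 S.sq S.e11] at hq
  have h1 := ((((((HasD.const Complex.I).mul (hasD_rot hW hI hX hx)).mul (J.d₁ x hx)).add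
    ((hasD_zcomp hW hI hX hx).mul (P.hasD_f₂ hx))).add ((hasD_a hW hI hX hx).mul hfu)).add
    ((HasD.const 2).mul ((hasD_a2 hW hI hX hx).mul (J.d₁ x hx)))).add
    ((HasD.const 2).mul (hp.sub ((HasD.const Complex.I).mul hq)))
  have h2 := (HasD.const 0).congr_on hU hx (fun y hy => killing_first hW hI hX hy)
  have h3 := (h1.unique h2).1
  simp at h3
  have hτ := P.τ_ne hx
  have h4 : P.f₂ x * (X.zcomp x + (2 * Complex.I * (pd 0 (fun y => X y 1) x : ℝ) +
      (X x 2 * P.ρ (x 2) + 2 * (pd 2 (fun y => X y 2) x : ℝ))) * P.τ x) = 0 := by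
    field_simp at h3
    linear_combination h3
  have h5 := (mul_eq_zero.1 h4).resolve_left (P.f₂_ne hx)
  linear_combination h5

/-- Differentiates the formula for z and compares with `hasD_zcomp`: the dζ part relates κ = aρ +
2a' to ω, the du part shows that z does not depend on u. -/
theorem killing_constraints {x : Pt} (hx : x ∈ spacetime W I) :
    (X x 2 * P.ρ (x 2) + 2 * pd 2 (fun y => X y 2) x) * P.c.re
      = -2 * pd 0 (fun y => X y 1) x * P.c.im ∧
    Complex.I * (pd 0 (fun y => X y 1) x : ℝ) * (1 + 2 * P.t) +
      (X x 2 * P.ρ (x 2) + 2 * (pd 2 (fun y => X y 2) x : ℝ)) * P.t = 0 ∧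
    pd 2 (fun y => X y 0) x = 0 ∧ pd 2 (fun y => X y 1) x = 0 := by
  have hU := isOpen_spacetime hW hI
  have h1 := (((HasD.const (2 * Complex.I)).mul (hasD_rot hW hI hX hx)).add
    (((hasD_a hW hI hX hx).mul (P.hasD_ρ hx)).add
      ((HasD.const 2).mul (hasD_a2 hW hI hX hx)))).neg.mul (P.hasD_τ x)
  have h2 := h1.congr_on hU hx (fun y hy => zcomp_eq hW hI hX hy)
  obtain ⟨k1, -, k2⟩ := (hasD_zcomp hW hI hX hx).unique h2
  simp at k1 k2
  set rt := pd 0 (fun y => X y 1) x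
  set a2 := pd 2 (fun y => X y 2) x
  have kt : Complex.I * (rt : ℝ) * (1 + 2 * P.t) + (X x 2 * P.ρ (x 2) + 2 * (a2 : ℝ)) * P.t = 0 := by
    linear_combination k1
  have kc := congrArg conj kt
  simp at kc
  have hc := P.hc
  have hct := P.hct
  have e1 : P.c + conj P.c = 2 * P.c.re := by rw [Complex.add_conj]; push_cast; ring
  have e2 : P.c - conj P.c = 2 * P.c.im * Complex.I := by rw [Complex.sub_conj]; push_cast; ring
  have r1 : (X x 2 * P.ρ (x 2) + 2 * a2) * P.c.re = -2 * rt * P.c.im := by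
    have : ((X x 2 : ℂ) * P.ρ (x 2) + 2 * a2) * P.c.re = -2 * rt * P.c.im := by
      -- Conjugate of the dζ relation with 4 t̄ = -(c² + 1); multiplying by c̄ then turns it into a
      -- single real equation.
      have s1 : 2 * Complex.I * rt * (1 - P.c ^ 2)
          + (X x 2 * P.ρ (x 2) + 2 * a2) * (P.c ^ 2 + 1) = 0 := by
        linear_combination -4 * kc + (X x 2 * P.ρ (x 2) + 2 * a2 - 2 * Complex.I * rt) * hct
      have s2 : 2 * Complex.I * rt * (conj P.c - P.c)
          + (X x 2 * P.ρ (x 2) + 2 * a2) * (P.c + conj P.c) = 0 := by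
        linear_combination conj P.c * s1
          + (2 * Complex.I * rt - (X x 2 * P.ρ (x 2) + 2 * a2)) * P.c * hc
      linear_combination s2 / 2 - (X x 2 * P.ρ (x 2) + 2 * a2) / 2 * e1 + Complex.I * rt * e2
        + 2 * rt * P.c.im * Complex.I_sq
    exact_mod_cast this
  refine ⟨r1, kt, ?_⟩
  -- When ρ ≠ 0, c is real and nonzero, and the first constraint reads κ = 0.
  have r2 : P.ρ (x 2) * (X x 2 * P.ρ (x 2) + 2 * a2) = 0 := by
    rcases P.ρ_cases (x 2) with h | ⟨h, h', -⟩
    · have : P.ρ (x 2) = 0 := by exact_mod_cast h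
      rw [this, zero_mul]
    · have i0 : P.c.im = 0 := Complex.conj_eq_iff_im.1 h
      have r0 : P.c.re ≠ 0 := by
        intro h0
        have : P.c = 0 := Complex.ext h0 i0
        rw [this] at h'; simp at h'
      rw [i0, mul_zero] at r1
      rw [(mul_eq_zero.1 r1).resolve_right r0, mul_zero]
  have r3 : ((pd 2 (fun y => X y 0) x : ℝ) : ℂ) + Complex.I * ((pd 2 (fun y => X y 1) x : ℝ) : ℂ) = 0 := by
    have r2' : (P.ρ (x 2) : ℂ) * (X x 2 * P.ρ (x 2) + 2 * a2) = 0 := by exact_mod_cast r2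
    rw [k2]
    linear_combination (-P.τ x / 2) * r2'
  have h3 := congrArg Complex.re r3
  have h4 := congrArg Complex.im r3
  simp at h3 h4
  exact ⟨h3, h4⟩

/-- Once z is inserted, the F₁ terms of `killing_first` cancel by `hF₁τ` and the second constraint,
leaving an equation for G alone. -/
theorem killing_G {x : Pt} (hx : x ∈ spacetime W I) :
    Complex.I * (pd 0 (fun y => X y 1) x : ℝ) * P.G (x 2) + X x 2 * deriv P.G (x 2)
      + 2 * (pd 2 (fun y => X y 2) x : ℝ) * P.G (x 2) = 0 := by
  have hU := isOpen_spacetime hW hI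
  have hc := fun y hy => killing_constraints hW hI hX (x := y) hy
  have h1 := killing_first hW hI hX hx
  rw [pd_eq_zero hU (fun y hy => (hc y hy).2.2.1) hx, pd_eq_zero hU (fun y hy => (hc y hy).2.2.2) hx,
    zcomp_eq hW hI hX hx, f₁, f₂, f₁u] at h1
  have h2 := P.hF₁τ _ hx.1
  have h2' : (1 + P.t) * P.F₁ (zeta x) = P.τ x * Complex.exp (P.Ψ (zeta x)) := h2
  have h3 := (hc x hx).2.1
  push_cast at h1
  linear_combination h1 + P.w (x 2) * P.F₁ (zeta x) * h3 - P.w (x 2) *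
    (2 * Complex.I * (pd 0 (fun y => X y 1) x : ℝ) +
      (X x 2 * P.ρ (x 2) + 2 * (pd 2 (fun y => X y 2) x : ℝ))) * h2'

/-- A Killing field is determined by three of its components at a point. -/
theorem killing_eq_zero (hU' : IsPreconnected (spacetime W I)) {x₀ : Pt}
    (hx₀ : x₀ ∈ spacetime W I) (ha : X x₀ 2 = 0) (hz : (conj P.c * (X.zcomp x₀ / P.τ x₀)).im = 0)
    (hb : X x₀ 3 = 0) : X = 0 := by
  have hU := isOpen_spacetime hW hI
  have S := hX.killingSystem
  have R := killing_reduced hW hI hX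
  have hc := fun y hy => killing_constraints hW hI hX (x := y) hy
  have hzc := fun y hy => zcomp_eq hW hI hX (x := y) hy
  have D := fun {φ : Pt → ℝ} (hφ : ContDiffOn ℝ ∞ φ (spacetime W I)) (i : Fin 4) =>
    contDiffOn_pd hU hφ i
  have h1 : pd 0 (fun y => X y 1) x₀ = 0 ∧ pd 2 (fun y => X y 2) x₀ = 0 := by
    have k1 := (hc x₀ hx₀).1
    rw [hzc x₀ hx₀, mul_div_cancel_right₀ _ (P.τ_ne hx₀)] at hz
    rw [ha] at hz k1
    simp at hz k1
    have k2 : P.c.re * P.c.re + P.c.im * P.c.im = 1 := by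
      have := congrArg Complex.re P.hc
      simpa using this
    constructor
    · linear_combination (-P.c.re / 2) * hz - pd 0 (fun y => X y 1) x₀ * k2 + P.c.im / 2 * k1
    · linear_combination (P.c.im / 2) * hz - pd 2 (fun y => X y 2) x₀ * k2 + P.c.re / 2 * k1
  have rot0 : ∀ x ∈ spacetime W I, pd 0 (fun y => X y 1) x = 0 := fun x hx => by
    rw [eq_of_pd_eq_zero hU hU' (D S.sq 0) R.rot hx hx₀, h1.1]
  have a20 : ∀ x ∈ spacetime W I, pd 2 (fun y => X y 2) x = 0 := fun x hx => by
    rw [eq_of_pd_eq_zero hU hU' (D S.sa 2) R.a2 hx hx₀, h1.2]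
  have a0 : ∀ x ∈ spacetime W I, X x 2 = 0 := fun x hx => by
    rw [← ha]
    refine eq_of_pd_eq_zero (φ := fun y => X y 2) hU hU' S.sa (fun y hy i => ?_) hx hx₀
    fin_cases i
    exacts [R.a0 y hy, R.a1 y hy, a20 y hy, R.a3 y hy]
  have z0 : ∀ x ∈ spacetime W I, X.zcomp x = 0 := fun x hx => by
    rw [hzc x hx, rot0 x hx, a20 x hx, a0 x hx]; simp
  have x0 : ∀ x ∈ spacetime W I, X x 0 = 0 := fun x hx => by
    have := congrArg Complex.re (z0 x hx)
    simpa [RField.zcomp] using this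
  have x1 : ∀ x ∈ spacetime W I, X x 1 = 0 := fun x hx => by
    have := congrArg Complex.im (z0 x hx)
    simpa [RField.zcomp] using this
  have b0 : ∀ x ∈ spacetime W I, X x 3 = 0 := fun x hx => by
    rw [← hb]
    refine eq_of_pd_eq_zero (φ := fun y => X y 3) hU hU' S.sb (fun y hy i => ?_) hx hx₀
    fin_cases i
    · show pd 0 (fun y => X y 3) y = 0
      rw [R.b0 y hy, (hc y hy).2.2.1, mul_zero]
    · show pd 1 (fun y => X y 3) y = 0
      rw [R.b1 y hy, (hc y hy).2.2.2, mul_zero]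
    · have := S.e22 y hy
      rw [x0 y hy, x1 y hy, a0 y hy, a20 y hy] at this
      show pd 2 (fun y => X y 3) y = 0
      linarith
    · show pd 3 (fun y => X y 3) y = 0
      rw [S.e23 y hy, a20 y hy, neg_zero]
  ext x i
  by_cases hx : x ∈ spacetime W I
  · fin_cases i
    exacts [x0 x hx, x1 x hx, a0 x hx, b0 x hx]
  · rw [hX.zero_off x hx]; rfl

/-- The data give ω = -Re c/2 and a' = Im c/2, so `killing_G` multiplies G by Im c - i Re c/2, which
is nonzero. -/
theorem G_eq_zero_of_killing {x₀ : Pt} (hx₀ : x₀ ∈ spacetime W I) (ha : X x₀ 2 = 0)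
    (hz : (conj P.c * (X.zcomp x₀ / P.τ x₀)).im = 1) : P.G (x₀ 2) = 0 := by
  have hc := killing_constraints hW hI hX hx₀
  have k1 := hc.1
  have h := killing_G hW hI hX hx₀
  rw [zcomp_eq hW hI hX hx₀, mul_div_cancel_right₀ _ (P.τ_ne hx₀)] at hz
  rw [ha] at hz k1 h
  simp at hz k1
  have k2 : P.c.re * P.c.re + P.c.im * P.c.im = 1 := by
    have := congrArg Complex.re P.hc
    simpa using this
  have w1 : pd 0 (fun y => X y 1) x₀ = -P.c.re / 2 := by
    linear_combination (-P.c.re / 2) * hz - pd 0 (fun y => X y 1) x₀ * k2 + P.c.im / 2 * k1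
  have w2 : pd 2 (fun y => X y 2) x₀ = P.c.im / 2 := by
    linear_combination (P.c.im / 2) * hz - pd 2 (fun y => X y 2) x₀ * k2 + P.c.re / 2 * k1
  rw [w1, w2] at h
  have h' : (Complex.I * ((-P.c.re / 2 : ℝ) : ℂ) + ((P.c.im : ℝ) : ℂ)) * P.G (x₀ 2) = 0 := by
    push_cast at h ⊢
    linear_combination h
  refine (mul_eq_zero.1 h').resolve_left fun h0 => ?_
  have i0 := congrArg Complex.re h0
  have i1 := congrArg Complex.im h0
  simp at i0 i1
  rw [i0, i1] at k2
  norm_num at k2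

end AffineProfile
end PPWave
end

/-! ### Explicit Killing fields for G = 0 and the equivalences -/

noncomputable section

namespace PPWave

namespace HasD

variable {φ : Pt → ℂ} {a b c : ℂ} {x : Pt}

theorem pd_re_part (h : HasD φ a b c x) (i : Fin 4) :
    pd i (fun y => (φ y).re) x = (dform a b c (Pi.single i 1)).re := by
  have h1 := Complex.reCLM.hasFDerivAt.comp x h
  unfold pd
  rw [show (fun y => (φ y).re) = Complex.reCLM ∘ φ from rfl, h1.fderiv]; rfl

theorem pd_im_part (h : HasD φ a b c x) (i : Fin 4) :
    pd i (fun y => (φ y).im) x = (dform a b c (Pi.single i 1)).im := by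
  have h1 := Complex.imCLM.hasFDerivAt.comp x h
  unfold pd
  rw [show (fun y => (φ y).im) = Complex.imCLM ∘ φ from rfl, h1.fderiv]; rfl

end HasD

theorem pd_comp_coord {h : ℝ → ℝ} {h' : ℝ} {x : Pt} (j : Fin 4) (hh : HasDerivAt h h' (x j))
    (i : Fin 4) : pd i (fun y => h (y j)) x = if i = j then h' else 0 := by
  have h1 : HasFDerivAt (fun y : Pt => y j) (ContinuousLinearMap.proj (R := ℝ) (φ := fun _ => ℝ) j) x :=
    (ContinuousLinearMap.proj (R := ℝ) (φ := fun _ => ℝ) j).hasFDerivAt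
  have h2 := (hh.hasFDerivAt.comp x h1).fderiv
  unfold pd
  rw [show (fun y : Pt => h (y j)) = h ∘ fun y => y j from rfl, h2]
  simp [Pi.single_apply, eq_comm]

theorem KillingSystem.congr {H p q a b p' q' a' b' : Pt → ℝ} {U : Set Pt} (hU : IsOpen U)
    (h : KillingSystem H p q a b U) (hp : ∀ x ∈ U, p' x = p x) (hq : ∀ x ∈ U, q' x = q x)
    (ha : ∀ x ∈ U, a' x = a x) (hb : ∀ x ∈ U, b' x = b x) : KillingSystem H p' q' a' b' U := by
  refine ⟨h.sp.congr hp, h.sq.congr hq, h.sa.congr ha, h.sb.congr hb, ?_, ?_, ?_, ?_, ?_, ?_, ?_,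
    ?_, ?_, ?_⟩ <;> intro x hx <;>
    simp only [pd_congr hU hp hx, pd_congr hU hq hx, pd_congr hU ha hx, pd_congr hU hb hx,
      hp x hx, hq x hx, ha x hx]
  exacts [h.e33 x hx, h.e03 x hx, h.e13 x hx, h.e00 x hx, h.e11 x hx, h.e01 x hx, h.e23 x hx,
    h.e02 x hx, h.e12 x hx, h.e22 x hx]

namespace AffineProfile

variable {W : Set ℂ} {I : Set ℝ} (P : AffineProfile W I)

/-- The affine u-component with aρ + 2a' = r Im c. For w = u⁻² the right side is 0 and a is
proportional to u. -/
theorem exists_slope {u₀ : ℝ} (hu₀ : u₀ ∈ I) (y₀ r : ℝ) :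
    ∃ y₁ : ℝ, ∀ u ∈ I, (y₀ + y₁ * (u - u₀)) * P.ρ u + 2 * y₁ = r * P.c.im := by
  rcases P.hw with h | ⟨hc, h0, h⟩
  · exact ⟨r * P.c.im / 2, fun u _ => by rw [(h u).2]; ring⟩
  · refine ⟨y₀ / u₀, fun u hu => ?_⟩
    have h1 : u ≠ 0 := fun h => h0 (h ▸ hu)
    have h2 : u₀ ≠ 0 := fun h => h0 (h ▸ hu₀)
    rw [(h u).2, hc]
    field_simp
    ring

theorem exists_primitive_w (u₀ : ℝ) :
    ∃ Ω : ℝ → ℝ, Ω u₀ = 0 ∧ ContDiffOn ℝ ∞ Ω I ∧ ∀ u ∈ I, HasDerivAt Ω (P.w u) u := by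
  rcases P.hw with h | ⟨-, h0, h⟩
  · refine ⟨fun u => u - u₀, sub_self _, (contDiff_id.sub contDiff_const).contDiffOn, fun u _ => ?_⟩
    rw [(h u).1]; exact (hasDerivAt_id u).sub_const _
  · have h1 : ∀ u ∈ I, u ≠ 0 := fun u hu h => h0 (h ▸ hu)
    refine ⟨fun u => -u⁻¹ + u₀⁻¹, neg_add_cancel _,
      (contDiffOn_id.inv h1).neg.add contDiffOn_const, fun u hu => ?_⟩
    rw [(h u).1]
    simpa using (hasDerivAt_inv (h1 u hu)).neg.add_const u₀⁻¹

/-- Makes the derivative of i c r τ purely imaginary, that is, an infinitesimal rotation. -/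
theorem c_mul_t : P.c * P.t = -P.c.re / 2 := by
  have h := congrArg conj P.hct
  simp at h
  have e1 : P.c + conj P.c = 2 * P.c.re := by rw [Complex.add_conj]; push_cast; ring
  linear_combination P.c / 4 * h - conj P.c / 4 * P.hc - e1 / 4

/-- When G = 0, w times this combination is the profile's contribution to `e22`; as it is constant
in ζ, a v-component with u-derivative -w Re K can balance it. -/
theorem exists_const (hW : IsOpen W) (hWc : IsPreconnected W) (r : ℝ) : ∃ K : ℂ, ∀ ζ ∈ W,
    r * P.c.im * P.F ζ + Complex.I * P.c * r * (P.t * ζ + P.τ₀) * P.F₁ ζ = K := by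
  have hd : ∀ ζ ∈ W, HasDerivAt (fun ζ => r * P.c.im * P.F ζ
      + Complex.I * P.c * r * (P.t * ζ + P.τ₀) * P.F₁ ζ) 0 ζ := fun ζ hζ => by
    have h1 := ((P.hF ζ hζ).const_mul (r * P.c.im : ℂ)).add
      (((((hasDerivAt_id ζ).const_mul P.t).add_const P.τ₀).const_mul
        (Complex.I * P.c * r)).mul (P.hF₁ ζ hζ))
    refine h1.congr_deriv ?_
    have e2 : P.c = P.c.re + P.c.im * Complex.I := (Complex.re_add_im _).symm
    simp
    linear_combination (-Complex.I * P.c * r) * P.hF₁τ ζ hζ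
      + 2 * Complex.I * r * P.F₁ ζ * P.c_mul_t + Complex.I * r * P.F₁ ζ * e2
      + r * P.F₁ ζ * P.c.im * Complex.I_sq
  exact hW.exists_is_const_of_deriv_eq_zero hWc
    (fun ζ hζ => (hd ζ hζ).differentiableAt.differentiableWithinAt) fun ζ hζ => (hd ζ hζ).deriv

theorem exists_killing (hW : IsOpen W) (hI : IsOpen I) (hWc : IsPreconnected W)
    (hG0 : ∀ u ∈ I, P.G u = 0) {x₀ : Pt} (hx₀ : x₀ ∈ spacetime W I) (y₀ r e₀ : ℝ) :
    ∃ X : RField, IsKilling (ppMetric P.f) (spacetime W I) X ∧ X x₀ 2 = y₀ ∧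
      (conj P.c * (X.zcomp x₀ / P.τ x₀)).im = r ∧ X x₀ 3 = e₀ := by
  classical
  have hU := isOpen_spacetime hW hI
  have J := P.hasJet hI
  obtain ⟨y₁, hy⟩ := P.exists_slope hx₀.2 y₀ r
  obtain ⟨Ω, hΩ0, hΩs, hΩ⟩ := P.exists_primitive_w (x₀ 2)
  obtain ⟨K, hK⟩ := P.exists_const hW hWc r
  -- The general solution of the constraints found for z, with κ = r Im c and 2ω = -r Re c.
  set ξ : Pt → ℂ := fun y => Complex.I * P.c * r * P.τ y with hξ
  have dξ : ∀ x, HasD ξ (-(Complex.I * r * P.c.re / 2)) 0 0 x := fun x =>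
    ((HasD.const (Complex.I * P.c * r)).mul (P.hasD_τ x)).congr'
      (by linear_combination Complex.I * r * P.c_mul_t) (by simp) (by simp)
  set p : Pt → ℝ := fun y => (ξ y).re with hp
  set q : Pt → ℝ := fun y => (ξ y).im with hq
  set a : Pt → ℝ := fun y => y₀ + y₁ * (y 2 - x₀ 2) with ha
  set b : Pt → ℝ := fun y => (e₀ - K.re * Ω (y 2)) + -y₁ * (y 3 - x₀ 3) with hb
  have pdp : ∀ x i, pd i p x = (dform (-(Complex.I * r * P.c.re / 2)) 0 0 (Pi.single i 1)).re :=
    fun x i => (dξ x).pd_re_part i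
  have pdq : ∀ x i, pd i q x = (dform (-(Complex.I * r * P.c.re / 2)) 0 0 (Pi.single i 1)).im :=
    fun x i => (dξ x).pd_im_part i
  have pda : ∀ x i, pd i a x = if i = 2 then y₁ else 0 := fun x i =>
    pd_comp_coord (h := fun u => y₀ + y₁ * (u - x₀ 2)) 2
      (by simpa using (((hasDerivAt_id (x 2)).sub_const (x₀ 2)).const_mul y₁).const_add y₀) i
  have sξ : ContDiff ℝ ∞ ξ :=
    contDiff_const.mul ((contDiff_const.mul contDiff_zeta).add contDiff_const)
  have sΩ := contDiffOn_coord W hΩs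
  have s3 : ContDiff ℝ ∞ (fun y : Pt => -y₁ * (y 3 - x₀ 3)) :=
    contDiff_const.mul ((contDiff_apply ℝ ℝ (3 : Fin 4)).sub contDiff_const)
  have s2 : ContDiff ℝ ∞ a :=
    contDiff_const.add (contDiff_const.mul ((contDiff_apply ℝ ℝ (2 : Fin 4)).sub contDiff_const))
  have sb1 : ContDiffOn ℝ ∞ (fun y => e₀ - K.re * Ω (y 2)) (spacetime W I) :=
    contDiffOn_const.sub (contDiffOn_const.mul sΩ)
  have pdb : ∀ x ∈ spacetime W I, ∀ i, pd i b x =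
      (if i = 2 then -(K.re * P.w (x 2)) else 0) + if i = 3 then -y₁ else 0 := fun x hx i => by
    rw [hb, pd_add (differentiableAt_of_smooth hU sb1 hx)
      (s3.differentiable (by simp)).differentiableAt]
    congr 1
    · exact pd_comp_coord (h := fun u => e₀ - K.re * Ω u) 2
        (by simpa using ((hΩ _ hx.2).const_mul K.re).const_sub e₀) i
    · exact pd_comp_coord (h := fun u => -y₁ * (u - x₀ 3)) 3
        (by simpa using ((hasDerivAt_id (x 3)).sub_const (x₀ 3)).const_mul (-y₁)) i
  have sys : KillingSystem (potential P.f) p q a b (spacetime W I) := by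
    refine ⟨contDiffOn_re sξ.contDiffOn, contDiffOn_im sξ.contDiffOn, s2.contDiffOn,
      sb1.add s3.contDiffOn, ?_, ?_, ?_, ?_, ?_, ?_, ?_, ?_, ?_, ?_⟩ <;> intro x hx <;>
      simp only [pdp, pdq, pda, pdb x hx]
    on_goal 10 =>
      have hG : P.G (x 2) = 0 := hG0 _ hx.2
      have hG' : deriv P.G (x 2) = 0 := by
        rw [Filter.EventuallyEq.deriv_eq (f := fun _ => (0 : ℂ))
          (Filter.eventually_of_mem (hI.mem_nhds hx.2) hG0)]
        simp
      have key : ξ x * P.f₁ x + a x * (P.ρ (x 2) * P.w (x 2) * P.F (zeta x) + deriv P.G (x 2) * zeta x)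
          + 2 * y₁ * P.f (zeta x) (x 2) = P.w (x 2) * K := by
        rw [← hK _ hx.1, f₁, f, hG, hG', hξ]
        have hy' : ((y₀ : ℂ) + y₁ * (x 2 - x₀ 2)) * P.ρ (x 2) + 2 * y₁ = r * P.c.im := by
          exact_mod_cast hy _ hx.2
        simp only [τ, ha]
        push_cast
        linear_combination (P.w (x 2) * P.F (zeta x)) * hy'
      have key' := congrArg Complex.re key
      rw [J.pd0 hx, J.pd1 hx, J.pd2 hx]
      simp [hG'] at key' ⊢
      simp [potential, hp, hq]
      linarith
    all_goals simp [dform_apply, zeta]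
  refine ⟨fun y => if y ∈ spacetime W I then ![p y, q y, a y, b y] else 0,
    (sys.congr hU ?_ ?_ ?_ ?_).isKilling fun x hx => if_neg hx, ?_, ?_, ?_⟩
  · intro x hx; simp [hx]
  · intro x hx; simp [hx]
  · intro x hx; simp [hx]
  · intro x hx; simp [hx]
  · simp [hx₀, ha]
  · have : RField.zcomp (fun y => if y ∈ spacetime W I then ![p y, q y, a y, b y] else 0) x₀
        = ξ x₀ := by
      simp [RField.zcomp, hx₀, hp, hq]
      rw [mul_comm Complex.I, Complex.re_add_im]
    rw [this, hξ, mul_div_cancel_right₀ _ (P.τ_ne hx₀)]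
    have : conj P.c * (Complex.I * P.c * r) = r * Complex.I := by
      linear_combination Complex.I * r * P.hc
    rw [this]; simp
  · simp [hx₀, hb, hΩ0]

/-- Three components of a Killing field at a point. -/
def killingEval (hW : IsOpen W) (hI : IsOpen I) (x₀ : Pt) :
    killing (ppMetric P.f) (spacetime W I) (isOpen_spacetime hW hI) →ₗ[ℝ] (Fin 3 → ℝ) where
  toFun X := ![X.1 x₀ 2, (conj P.c * (X.1.zcomp x₀ / P.τ x₀)).im, X.1 x₀ 3]
  map_add' X Y := by
    have : (X + Y).1.zcomp x₀ = X.1.zcomp x₀ + Y.1.zcomp x₀ := by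
      simp [RField.zcomp]; ring
    ext i
    fin_cases i
    · simp
    · simp only [this, add_div, mul_add, Complex.add_im]; simp
    · simp
  map_smul' k X := by
    have : (k • X).1.zcomp x₀ = k * X.1.zcomp x₀ := by
      simp [RField.zcomp]; ring
    have h2 : conj P.c * ((k : ℂ) * X.1.zcomp x₀ / P.τ x₀)
        = k * (conj P.c * (X.1.zcomp x₀ / P.τ x₀)) := by ring
    ext i
    fin_cases i
    · simp
    · simp only [this, h2, Complex.im_ofReal_mul]; simp
    · simp

/-- `killingEval` is always injective, so dimension 3 means that it is onto. A preimage of (0, 1, 0)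
at a point over u gives G(u) = 0; conversely `exists_killing` is surjectivity. -/
theorem isG3_iff (hW : IsOpen W) (hI : IsOpen I) (hWc : IsConnected W) (hIc : IsConnected I) :
    IsG3 W I hW hI P.f ↔ ∀ u ∈ I, P.G u = 0 := by
  have hU' := isPreconnected_spacetime hWc.isPreconnected hIc.isPreconnected
  obtain ⟨ζ, hζ⟩ := hWc.nonempty
  have hpt : ∀ u ∈ I, (![ζ.re, ζ.im, u, 0] : Pt) ∈ spacetime W I := fun u hu =>
    ⟨by simpa [zeta, Complex.re_add_im] using hζ, by simpa using hu⟩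
  have hinj : ∀ x ∈ spacetime W I, Function.Injective (P.killingEval hW hI x) := by
    intro x hx
    rw [injective_iff_map_eq_zero]
    intro X hX
    have h0 := congrFun hX 0
    have h1 := congrFun hX 1
    have h2 := congrFun hX 2
    exact Subtype.ext (killing_eq_zero hW hI X.2 hU' hx h0 h1 h2)
  constructor
  · intro h u hu
    have hx := hpt u hu
    have hfin : FiniteDimensional ℝ
        (killing (ppMetric P.f) (spacetime W I) (isOpen_spacetime hW hI)) :=
      FiniteDimensional.of_injective _ (hinj _ hx)
    have hs := (LinearMap.injective_iff_surjective_of_finrank_eq_finrank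
      (h.trans (by simp))).1 (hinj _ hx)
    obtain ⟨X, hX⟩ := hs ![0, 1, 0]
    have h0 := congrFun hX 0
    have h1 := congrFun hX 1
    exact G_eq_zero_of_killing hW hI X.2 hx h0 h1
  · intro hG0
    obtain ⟨u, hu⟩ := hIc.nonempty
    have hx := hpt u hu
    have hs : Function.Surjective (P.killingEval hW hI ![ζ.re, ζ.im, u, 0]) := by
      intro v
      obtain ⟨X, hX, h0, h1, h2⟩ := P.exists_killing hW hI hWc.isPreconnected hG0 hx (v 0) (v 1) (v 2)
      refine ⟨⟨X, hX⟩, ?_⟩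
      ext i
      fin_cases i
      exacts [h0, h1, h2]
    have := (LinearEquiv.ofBijective _ ⟨hinj _ hx, hs⟩).finrank_eq
    rw [IsG3, this]
    simp

/-- The equivalent characterizations of `G = 0`. -/
theorem tfae (hW : IsOpen W) (hI : IsOpen I) (hWc : IsConnected W) (hIc : IsConnected I)
    {T : Tetrad} (hT : T.IsNormalized (ppMetric P.f) (spacetime W I)) :
    [WedgeZero (spacetime W I) (T.α (ppMetric P.f)) (T.ν (ppMetric P.f)),
      ∀ x ∈ spacetime W I, T.Y (ppMetric P.f) x = 0,
      ∀ u ∈ I, P.G u = 0,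
      T.Count011 (ppMetric P.f) (spacetime W I),
      IsG3 W I hW hI P.f].TFAE := by
  tfae_have 1 → 2 := fun h x hx => Y_eq_zero_of_wedge hW hI hT h hx
  tfae_have 2 → 3 := fun h u hu => by
    obtain ⟨ζ, hζ⟩ := hWc.nonempty
    have hx : (![ζ.re, ζ.im, u, 0] : Pt) ∈ spacetime W I :=
      ⟨by simpa [zeta, Complex.re_add_im] using hζ, by simpa using hu⟩
    exact (Y_eq_zero_iff hW hI hT hx).1 (h _ hx)
  tfae_have 3 → 4 := fun h => count_of_Y_eq_zero hW hI hT fun x hx =>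
    (Y_eq_zero_iff hW hI hT hx).2 (h _ hx.2)
  tfae_have 4 → 1 := fun h => h.2.2.2.2
  tfae_have 5 ↔ 3 := P.isG3_iff hW hI hWc hIc
  tfae_finish

end AffineProfile
end PPWave
end

noncomputable section

namespace PPWave

/-! ## The four classes -/

theorem IsLogBranch.ne_zero {k : ℂ} {L : ℂ → ℂ} {W : Set ℂ} (h : IsLogBranch k L W) {ζ : ℂ}
    (hζ : ζ ∈ W) : k ≠ 0 ∧ ζ ≠ 0 := by
  have := h.2 ζ hζ ▸ Complex.exp_ne_zero (L ζ)
  exact ⟨left_ne_zero_of_mul this, right_ne_zero_of_mul this⟩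

theorem IsLogBranch.hasDerivAt {k : ℂ} {L : ℂ → ℂ} {W : Set ℂ} (hW : IsOpen W)
    (h : IsLogBranch k L W) {ζ : ℂ} (hζ : ζ ∈ W) : HasDerivAt L ζ⁻¹ ζ := by
  obtain ⟨hk, hζ0⟩ := h.ne_zero hζ
  have h1 := (h.1.differentiableAt (hW.mem_nhds hζ)).hasDerivAt
  have h2 : HasDerivAt (fun z => Complex.exp (L z)) k ζ := by
    have h3 : HasDerivAt (fun z => k * z) k ζ := by
      simpa using (hasDerivAt_id ζ).const_mul k
    exact h3.congr_of_eventuallyEq (Filter.eventually_of_mem (hW.mem_nhds hζ) h.2)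
  have h3 := h1.cexp.unique h2
  rw [h.2 ζ hζ] at h3
  have : deriv L ζ = ζ⁻¹ := by
    field_simp
    apply mul_left_cancel₀ hk
    linear_combination h3
  rwa [this] at h1

section

variable {W : Set ℂ} {I : Set ℝ} {g : ℝ → ℂ}

/-- This exponent is the Ψ of the logarithmic profile, since (k log ζ)'' = -k/ζ². -/
theorem exp_neg_two_mul_add_log {L : ℂ → ℂ} (hL : IsLogBranch 1 L W) {k : ℂ} (hk : k ≠ 0) {ζ : ℂ}
    (hζ : ζ ∈ W) : Complex.exp (-2 * L ζ + Complex.log (-k)) = -k / ζ ^ 2 := by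
  rw [Complex.exp_add, Complex.exp_log (neg_ne_zero.2 hk),
    show -2 * L ζ = -((2 : ℕ) * L ζ) by push_cast; ring, Complex.exp_neg, Complex.exp_nat_mul,
    hL.2 ζ hζ, one_mul]
  ring

/-- Profiles `w(u) k log ζ + G(u) ζ`. -/
def logProfile (hW : IsOpen W) {L : ℂ → ℂ} (hL : IsLogBranch 1 L W) {k : ℂ} (hk : k ≠ 0)
    {G : ℝ → ℂ} (hG : ContDiffOn ℝ ∞ G I) (w ρ : ℝ → ℝ)
    (hw : (∀ u, w u = 1 ∧ ρ u = 0) ∨ ((0 : ℝ) ∉ I ∧ ∀ u, w u = (u ^ 2)⁻¹ ∧ ρ u = -2 / u)) :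
    AffineProfile W I where
  F ζ := k * L ζ
  F₁ ζ := k * ζ⁻¹
  Ψ ζ := -2 * L ζ + Complex.log (-k)
  t := -1 / 2
  τ₀ := 0
  c := 1
  w := w
  ρ := ρ
  G := G
  hF ζ hζ := (hL.hasDerivAt hW hζ).const_mul k
  hF₁ ζ hζ := by
    refine ((hasDerivAt_inv (hL.ne_zero hζ).2).const_mul k).congr_deriv ?_
    rw [exp_neg_two_mul_add_log hL hk hζ]
    ring
  hΨ ζ hζ := by
    refine (((hL.hasDerivAt hW hζ).const_mul (-2)).add_const _).congr_deriv ?_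
    rw [add_zero, mul_inv]
    norm_num
  hτ ζ hζ := by simpa using (hL.ne_zero hζ).2
  hF₁τ ζ hζ := by
    have := (hL.ne_zero hζ).2
    rw [exp_neg_two_mul_add_log hL hk hζ]
    field_simp
    ring
  hc := by simp
  hct := by simp; norm_num
  hG := hG
  hw := hw.imp id fun h => ⟨Complex.one_im, h⟩

/-- Profiles of class AE. -/
def expProfile {k : ℝ} (hk : k ≠ 0) (hg : ContDiffOn ℝ ∞ g I) : AffineProfile W I where
  F ζ := Complex.exp (k * ζ)
  F₁ ζ := k * Complex.exp (k * ζ)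
  -- The logarithm of k² rather than of k serves both signs of k.
  Ψ ζ := k * ζ + Real.log (k ^ 2)
  t := 0
  τ₀ := (k : ℂ)⁻¹
  c := Complex.I
  w := fun _ => 1
  ρ := fun _ => 0
  G := g
  hF ζ _ := by
    refine (((hasDerivAt_id ζ).const_mul (k : ℂ)).cexp).congr_deriv ?_
    simp; ring
  hF₁ ζ _ := by
    refine ((((hasDerivAt_id ζ).const_mul (k : ℂ)).cexp).const_mul (k : ℂ)).congr_deriv ?_
    rw [Complex.exp_add, ← Complex.ofReal_exp, Real.exp_log (by positivity)]
    simp; ring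
  hΨ ζ _ := by
    refine (((hasDerivAt_id ζ).const_mul (k : ℂ)).add_const _).congr_deriv ?_
    simp
  hτ ζ _ := by simpa using hk
  hF₁τ ζ _ := by
    have : (k : ℂ) ≠ 0 := by exact_mod_cast hk
    rw [Complex.exp_add, ← Complex.ofReal_exp, Real.exp_log (by positivity)]
    push_cast
    field_simp
    ring
  hc := by simp
  hct := by simp
  hG := hg
  hw := Or.inl fun _ => ⟨rfl, rfl⟩

theorem two_mul_I_mul_sub_ne (k : ℝ) (r : ℝ) (hr : r ≠ 0) : 2 * Complex.I * k - r ≠ 0 := by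
  intro h
  have := congrArg Complex.re h
  simp [hr] at this

/-- Profiles of class AP. -/
def powProfile (hW : IsOpen W) {L : ℂ → ℂ} {k₀ k₁ : ℝ} (hL : IsLogBranch k₀ L W) (h₀ : k₀ ≠ 0)
    (h₁ : k₁ ≠ 0) (hg : ContDiffOn ℝ ∞ g I) : AffineProfile W I :=
  have e0 : (k₀ : ℂ) ≠ 0 := by exact_mod_cast h₀
  have e1 : (k₁ : ℂ) ≠ 0 := by exact_mod_cast h₁
  have e2 : 2 * Complex.I * k₁ - 1 ≠ 0 := by
    simpa using two_mul_I_mul_sub_ne k₁ 1 one_ne_zero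
  have e3 : 2 * Complex.I * k₁ - 2 ≠ 0 := by
    simpa using two_mul_I_mul_sub_ne k₁ 2 two_ne_zero
  have e4 : 2 * Complex.I * k₁ * (2 * Complex.I * k₁ - 1) * k₀ ^ 2 ≠ 0 := by
    simp [e0, e1, e2]
  have e5 : ∀ ζ ∈ W, Complex.exp ((2 * Complex.I * k₁ - 2) * L ζ +
      Complex.log (2 * Complex.I * k₁ * (2 * Complex.I * k₁ - 1) * k₀ ^ 2)) =
      2 * Complex.I * k₁ * (2 * Complex.I * k₁ - 1) * Complex.exp (2 * Complex.I * k₁ * L ζ)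
        / ζ ^ 2 := fun ζ hζ => by
    have hζ0 := (hL.ne_zero hζ).2
    rw [Complex.exp_add, Complex.exp_log e4, sub_mul, Complex.exp_sub,
      show 2 * L ζ = (2 : ℕ) * L ζ by norm_num, Complex.exp_nat_mul, hL.2 ζ hζ]
    field_simp
  { F := fun ζ => Complex.exp (2 * Complex.I * k₁ * L ζ)
    F₁ := fun ζ => 2 * Complex.I * k₁ * Complex.exp (2 * Complex.I * k₁ * L ζ) * ζ⁻¹
    -- The factor k₀² compensates exp(-2L) = (k₀ ζ)⁻².
    Ψ := fun ζ => (2 * Complex.I * k₁ - 2) * L ζ +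
      Complex.log (2 * Complex.I * k₁ * (2 * Complex.I * k₁ - 1) * k₀ ^ 2)
    t := (2 * Complex.I * k₁ - 2)⁻¹
    τ₀ := 0
    -- A unit square root of -4 t̄ - 1 = (1 - i k₁)/(1 + i k₁).
    c := (1 - Complex.I * k₁) / √(1 + k₁ ^ 2)
    w := fun _ => 1
    ρ := fun _ => 0
    G := g
    hF := fun ζ hζ => by
      refine (((hL.hasDerivAt hW hζ).const_mul (2 * Complex.I * k₁)).cexp).congr_deriv ?_
      ring
    hF₁ := fun ζ hζ => by
      have hζ0 := (hL.ne_zero hζ).2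
      rw [e5 ζ hζ]
      refine (((((hL.hasDerivAt hW hζ).const_mul (2 * Complex.I * k₁)).cexp).const_mul
        (2 * Complex.I * k₁)).mul (hasDerivAt_inv hζ0)).congr_deriv ?_
      field_simp
      ring
    hΨ := fun ζ hζ => by
      refine (((hL.hasDerivAt hW hζ).const_mul (2 * Complex.I * k₁ - 2)).add_const _).congr_deriv ?_
      rw [add_zero, mul_inv, inv_inv]
    hτ := fun ζ hζ => by
      rw [add_zero]; exact mul_ne_zero (inv_ne_zero e3) (hL.ne_zero hζ).2
    hF₁τ := fun ζ hζ => by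
      have hζ0 := (hL.ne_zero hζ).2
      have ht : 1 + (2 * Complex.I * k₁ - 2)⁻¹ =
          (2 * Complex.I * k₁ - 2)⁻¹ * (2 * Complex.I * k₁ - 1) := by
        linear_combination -inv_mul_cancel₀ e3
      rw [e5 ζ hζ, ht, add_zero]
      generalize (2 * Complex.I * k₁ - 2)⁻¹ = t
      field_simp
    hc := by
      have h1 : (0 : ℝ) ≤ 1 + k₁ ^ 2 := by positivity
      have h2 : ((√(1 + k₁ ^ 2) : ℝ) : ℂ) ^ 2 = 1 + k₁ ^ 2 := by
        exact_mod_cast Real.sq_sqrt h1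
      have h3 : ((√(1 + k₁ ^ 2) : ℝ) : ℂ) ≠ 0 := by
        exact_mod_cast (Real.sqrt_pos.2 (by positivity : 0 < 1 + k₁ ^ 2)).ne'
      simp
      field_simp
      rw [h2]
      linear_combination (-k₁ ^ 2 : ℂ) * Complex.I_sq
    hct := by
      have h1 : (0 : ℝ) ≤ 1 + k₁ ^ 2 := by positivity
      have h2 : ((√(1 + k₁ ^ 2) : ℝ) : ℂ) ^ 2 = 1 + k₁ ^ 2 := by
        exact_mod_cast Real.sq_sqrt h1
      have h3 : (1 + k₁ ^ 2 : ℂ) ≠ 0 := by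
        exact_mod_cast (by positivity : 0 < 1 + k₁ ^ 2).ne'
      have e6 : -(2 * Complex.I * k₁) - 2 ≠ 0 := by
        have := (map_ne_zero (starRingEnd ℂ)).2 e3
        simpa using this
      have h4 : (starRingEnd ℂ) (2 * Complex.I * k₁ - 2)⁻¹ = (-(2 * Complex.I * k₁) - 2)⁻¹ := by
        simp
      have h5 := inv_mul_cancel₀ e6
      rw [div_pow, h2, h4]
      generalize (-(2 * Complex.I * k₁) - 2)⁻¹ = s at h5 ⊢
      rw [div_eq_iff h3]
      linear_combination (-2 * (1 - Complex.I * k₁)) * h5 +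
        (k₁ ^ 2 + 4 * s * k₁ ^ 2) * Complex.I_sq
    hG := hg
    hw := Or.inl fun _ => ⟨rfl, rfl⟩ }

end

namespace AffineProfile

variable {W : Set ℂ} {I : Set ℝ} (P : AffineProfile W I) {T : Tetrad}

theorem μ_eq_zero (hW : IsOpen W) (hI : IsOpen I)
    (hT : T.IsNormalized (ppMetric P.f) (spacetime W I)) (h : ∀ u, P.ρ u = 0) {x : Pt}
    (hx : x ∈ spacetime W I) : T.μ (ppMetric P.f) x = 0 := by
  rw [μ_eq hW hI hT hx, h]; simp

end AffineProfile

end PPWave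
end

/-! ### Specialization to the four classes -/

open PPWave in
theorem proposition8p1
    (W : Set ℂ) (hW : IsOpen W) (hWc : IsConnected W)
    (I : Set ℝ) (hI : IsOpen I) (hIc : IsConnected I)
    (g : ℝ → ℂ) (hg : ContDiffOn ℝ ∞ g I) :
    -- class BL
    (∀ (L : ℂ → ℂ) (C : ℂ), IsLogBranch 1 L W → (0 : ℝ) ∉ I → C ≠ 0 →
      (∃ T : Tetrad, T.IsNormalized (ppMetric (formBL L C g)) (spacetime W I)) ∧
      ∀ T : Tetrad, T.IsNormalized (ppMetric (formBL L C g)) (spacetime W I) →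
        (∀ x ∈ spacetime W I,
          T.α (ppMetric (formBL L C g)) x ≠ 0 ∧
          T.B (ppMetric (formBL L C g)) x = 0 ∧
          T.A (ppMetric (formBL L C g)) x = 1 ∧
          T.Δ (T.μ (ppMetric (formBL L C g))) x = T.μ (ppMetric (formBL L C g)) x ^ 2 ∧
          T.μ (ppMetric (formBL L C g)) x ≠ 0 ∧
          T.M (ppMetric (formBL L C g)) x ^ 2 = -1 / (2 * conj C)) ∧
        [WedgeZero (spacetime W I) (T.α (ppMetric (formBL L C g))) (T.ν (ppMetric (formBL L C g))),
          ∀ x ∈ spacetime W I, T.Y (ppMetric (formBL L C g)) x = 0,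
          ∀ u ∈ I, g u = 0,
          T.Count011 (ppMetric (formBL L C g)) (spacetime W I),
          IsG3 W I hW hI (formBL L C g)].TFAE) ∧
    -- class AP
    (∀ (L : ℂ → ℂ) (k₀ k₁ : ℝ), k₀ ≠ 0 → IsLogBranch k₀ L W → k₁ ≠ 0 →
      (∃ T : Tetrad, T.IsNormalized (ppMetric (formAP L k₁ g)) (spacetime W I)) ∧
      ∀ T : Tetrad, T.IsNormalized (ppMetric (formAP L k₁ g)) (spacetime W I) →
        (∀ x ∈ spacetime W I,
          T.α (ppMetric (formAP L k₁ g)) x ≠ 0 ∧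
          T.μ (ppMetric (formAP L k₁ g)) x = 0 ∧
          T.A (ppMetric (formAP L k₁ g)) x * conj (T.A (ppMetric (formAP L k₁ g)) x) = 1 ∧
          T.A (ppMetric (formAP L k₁ g)) x ^ 2 ≠ 1) ∧
        [WedgeZero (spacetime W I) (T.α (ppMetric (formAP L k₁ g))) (T.ν (ppMetric (formAP L k₁ g))),
          ∀ x ∈ spacetime W I, T.Y (ppMetric (formAP L k₁ g)) x = 0,
          ∀ u ∈ I, g u = 0,
          T.Count011 (ppMetric (formAP L k₁ g)) (spacetime W I),
          IsG3 W I hW hI (formAP L k₁ g)].TFAE) ∧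
    -- class AE
    (∀ k : ℝ, k ≠ 0 →
      (∃ T : Tetrad, T.IsNormalized (ppMetric (formAE k g)) (spacetime W I)) ∧
      ∀ T : Tetrad, T.IsNormalized (ppMetric (formAE k g)) (spacetime W I) →
        (∀ x ∈ spacetime W I,
          T.α (ppMetric (formAE k g)) x ≠ 0 ∧
          T.μ (ppMetric (formAE k g)) x = 0 ∧
          T.A (ppMetric (formAE k g)) x = -1) ∧
        [WedgeZero (spacetime W I) (T.α (ppMetric (formAE k g))) (T.ν (ppMetric (formAE k g))),
          ∀ x ∈ spacetime W I, T.Y (ppMetric (formAE k g)) x = 0,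
          ∀ u ∈ I, g u = 0,
          T.Count011 (ppMetric (formAE k g)) (spacetime W I),
          IsG3 W I hW hI (formAE k g)].TFAE) ∧
    -- class AL
    (∀ (L : ℂ → ℂ) (k : ℝ), IsLogBranch 1 L W →
      (∃ T : Tetrad, T.IsNormalized (ppMetric (formAL L k g)) (spacetime W I)) ∧
      ∀ T : Tetrad, T.IsNormalized (ppMetric (formAL L k g)) (spacetime W I) →
        (∀ x ∈ spacetime W I,
          T.α (ppMetric (formAL L k g)) x ≠ 0 ∧
          T.μ (ppMetric (formAL L k g)) x = 0 ∧
          T.A (ppMetric (formAL L k g)) x = 1) ∧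
        [WedgeZero (spacetime W I) (T.α (ppMetric (formAL L k g))) (T.ν (ppMetric (formAL L k g))),
          ∀ x ∈ spacetime W I, T.Y (ppMetric (formAL L k g)) x = 0,
          ∀ u ∈ I, g u = 0,
          T.Count011 (ppMetric (formAL L k g)) (spacetime W I),
          IsG3 W I hW hI (formAL L k g)].TFAE) := by
  refine ⟨fun L C hL h0 hC => ?_, fun L k₀ k₁ h₀ hL h₁ => ?_, fun k hk => ?_, fun L k hL => ?_⟩
  · have hG : ContDiffOn ℝ ∞ (fun u : ℝ => g u * ((u : ℂ) ^ 2)⁻¹) I :=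
      hg.mul (((Complex.ofRealCLM.contDiff (n := ∞)).pow 2).contDiffOn.inv fun u hu => by
        have : u ≠ 0 := fun h => h0 (h ▸ hu)
        simpa using this)
    let P := logProfile hW hL hC hG (fun u => (u ^ 2)⁻¹) (fun u => -2 / u)
      (Or.inr ⟨h0, fun _ => ⟨rfl, rfl⟩⟩)
    have hf : formBL L C g = P.f := by
      ext ζ u
      simp [formBL, AffineProfile.f, P, logProfile]
      ring
    rw [hf]
    refine ⟨⟨_, P.tetrad_isNormalized hW hI⟩, fun T hT => ⟨fun x hx => ?_, ?_⟩⟩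
    · have hu : x 2 ≠ 0 := fun h => h0 (h ▸ hx.2)
      have hu' : ((x 2 : ℝ) : ℂ) ≠ 0 := by exact_mod_cast hu
      have hζ := (hL.ne_zero hx.1).2
      refine ⟨AffineProfile.α_ne hW hI hT hx, AffineProfile.B_eq hW hI hT hx, ?_,
        AffineProfile.Δμ_eq hW hI hT hx, ?_, ?_⟩
      · rw [AffineProfile.A_eq hW hI hT hx]; simp [P, logProfile]
      · rw [AffineProfile.μ_eq hW hI hT hx]
        have := (P.adapted hW hI hT hx).shape.scale_ne
        simp [P, logProfile, this, hu]
      · rw [AffineProfile.M_sq hW hI hT hx]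
        -- Here τ = -ζ/2, so ζ cancels; likewise ρ² t²/w = 1, and M² is constant.
        have h1 : P.τ x ^ 2 * Complex.exp (P.Ψ (zeta x)) = -C / 4 := by
          simp only [AffineProfile.τ, P, logProfile]
          rw [exp_neg_two_mul_add_log hL hC hx.1]
          field_simp
          ring
        rw [h1]
        have hC' : conj C ≠ 0 := by simpa using hC
        simp [P, logProfile]
        field_simp
        norm_num
    · have h := P.tfae hW hI hWc hIc hT
      have hgG : (∀ u ∈ I, P.G u = 0) ↔ ∀ u ∈ I, g u = 0 := by
        refine forall₂_congr fun u hu => ?_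
        have : u ≠ 0 := fun h => h0 (h ▸ hu)
        simp [P, logProfile, this]
      rwa [hgG] at h
  · let P := powProfile hW hL h₀ h₁ hg
    have hf : formAP L k₁ g = P.f := by
      ext ζ u
      simp [formAP, AffineProfile.f, P, powProfile]
    rw [hf]
    refine ⟨⟨_, P.tetrad_isNormalized hW hI⟩, fun T hT => ⟨fun x hx => ?_,
      P.tfae hW hI hWc hIc hT⟩⟩
    refine ⟨AffineProfile.α_ne hW hI hT hx, P.μ_eq_zero hW hI hT (fun _ => rfl) hx, ?_, ?_⟩
    · rw [AffineProfile.A_eq hW hI hT hx, map_pow, ← mul_pow, P.hc, one_pow]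
    · rw [AffineProfile.A_eq hW hI hT hx, P.hct]
      have e1 : (k₁ : ℂ) ≠ 0 := by exact_mod_cast h₁
      intro h
      -- A² = 1 leaves t = 0, impossible for an inverse of a nonzero number, or t = -1/2, which
      -- means k₁ = 0.
      have h2 : conj P.t * (2 * conj P.t + 1) = 0 := by linear_combination h / 8
      have e3 : 2 * Complex.I * k₁ - 2 ≠ 0 := by
        simpa using two_mul_I_mul_sub_ne k₁ 2 two_ne_zero
      rcases mul_eq_zero.1 h2 with h3 | h3
      · have h4 : P.t = 0 := by simpa using h3
        exact inv_ne_zero e3 h4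
      · have h4 : 2 * P.t + 1 = 0 := by
          have := congrArg conj h3
          simpa using this
        have h5 : P.t * (2 * Complex.I * k₁ - 2) = 1 := inv_mul_cancel₀ e3
        have h6 : Complex.I * k₁ = 0 := by
          linear_combination (Complex.I * k₁ - 1) * h4 - h5
        exact mul_ne_zero Complex.I_ne_zero e1 h6
  · let P : AffineProfile W I := expProfile hk hg
    have hf : formAE k g = P.f := by
      ext ζ u
      simp [formAE, AffineProfile.f, P, expProfile]
    rw [hf]
    refine ⟨⟨_, P.tetrad_isNormalized hW hI⟩, fun T hT => ⟨fun x hx => ?_,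
      P.tfae hW hI hWc hIc hT⟩⟩
    refine ⟨AffineProfile.α_ne hW hI hT hx, P.μ_eq_zero hW hI hT (fun _ => rfl) hx, ?_⟩
    rw [AffineProfile.A_eq hW hI hT hx]; exact Complex.I_sq
  · let P := logProfile hW hL (Complex.exp_ne_zero (Complex.I * k)) hg (fun _ => 1) (fun _ => 0)
      (Or.inl fun _ => ⟨rfl, rfl⟩)
    have hf : formAL L k g = P.f := by
      ext ζ u
      simp [formAL, AffineProfile.f, P, logProfile]
    rw [hf]
    refine ⟨⟨_, P.tetrad_isNormalized hW hI⟩, fun T hT => ⟨fun x hx => ?_,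
      P.tfae hW hI hWc hIc hT⟩⟩
    refine ⟨AffineProfile.α_ne hW hI hT hx, P.μ_eq_zero hW hI hT (fun _ => rfl) hx, ?_⟩
    rw [AffineProfile.A_eq hW hI hT hx]; exact one_pow 2
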